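/- Let $k\in[0,1)$, $k'=\sqrt{1-k^2}$, let $K=\int_0^{\pi/2}(1-k^2\sin^2\tau)^{-1/2}d\tau$, $E=\int_0^{\pi/2}(1-k^2\sin^2\tau)^{1/2}d\tau$ be the complete elliptic integrals, $K'=K(k')$, let $\mathrm{sc}(\cdot|k)$, $\mathrm{dc}(\cdot|k)$ be Jacobi's elliptic functions (equal to $\tan$ and $1/\cos$ for $k=0$), and $$\mathrm A(u|k)=\frac1{k'}\Big(\int_0^u \mathrm{dc}^2(v|k)\,dv+\frac{E-K}{K}u\Big).$$ Let $\mathbb T(k)=\mathbb C/(4K\mathbb Z+4iK'\mathbb Z)$ (for $k=0$, where $K'=\infty$, $\mathbb T(0)=\mathbb C/2\pi\mathbb Z$). Let $\mathsf G=(\mathsf V,\mathsf E)$ be an infinite isoradial graph, that is, a locally finite graph drawn in the plane with straight edges that meet only at common endpoints, with every face the interior of a polygon inscribed in a circle of radius $1$ whose center lies in the face. The diamond graph $\mathsf G^R$ has as vertices the vertices of $\mathsf G$ and the circumcenters of the faces, each circumcenter being joined to the vertices of $\mathsf G$ on the boundary of its face; its edges have length $1$. Every edge $xy$ of $\mathsf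 G$ is a diagonal of a unit rhombus of $\mathsf G^R$, with half-angle $\bar\theta_{xy}\in(0,\frac\pi2)$ at $x$; put $\theta_{xy}=\bar\theta_{xy}\frac{2K}\pi$. The massive Laplacian is $$(\Delta^{m(k)}f)(x)=\sum_{y\sim x}\mathrm{sc}(\theta_{xy}|k)\,[f(x)-f(y)]+m^2(x|k)f(x),\qquad m^2(x|k)=\sum_{y\sim x}\big[\mathrm A(\theta_{xy}|k)-\mathrm{sc}(\theta_{xy}|k)\big].$$ For a path $x=x_1,\dots,x_n=y$ of $\mathsf G^R$ with steps $x_{j+1}-x_j=e^{i\bar\alpha_j}$ and $\alpha_j=\bar\alpha_j\frac{2K}\pi$, the discrete massive exponential function is the meromorphic function of $u\in\mathbb C$ $$\mathrm e_{(x,y)}(u|k)=\prod_{j=1}^{n-1} i\sqrt{k'}\;\mathrm{sc}\Big(\frac{u-\alpha_j}2\Big|k\Big).$$ Then: 1. any two vertices $x,y$ of $\mathsf G^R$ are joined by a path of $\mathsf G^R$, and the meromorphic function $\mathrm e_{(x,y)}(\cdot|k)$ does not depend on the choice of this path; 2. if $x,y\in\mathsf V$, then $\mathrm e_{(x,y)}(\cdot|k)$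 is a function on the torus $\mathbb T(k)$; 3. for every $u\in\mathbb T(k)$, $\mathrm e_{(x,y)}(u|k)$ is massive harmonic on $\mathsf G$ in each of the variables $x$ and $y$: for all $x,y\in\mathsf V$, $$\big(\Delta^{m(k)}\mathrm e_{(\cdot,y)}(u|k)\big)(x)=0,\qquad \big(\Delta^{m(k)}\mathrm e_{(x,\cdot)}(u|k)\big)(y)=0,$$ at every $u$ that is not a pole of one of the finitely many functions $\mathrm e$ occurring in the respective expression (so each identity also holds as an identity of meromorphic functions of $u$). -/

import Mathlib

open scoped Real

noncomputable section

namespace IsoradialMassive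

/-! ## Elliptic integrals and Jacobi elliptic functions -/

/-- Incomplete elliptic integral of the first kind with modulus `k`. -/
def ellipticF (k φ : ℝ) : ℝ := ∫ τ in (0 : ℝ)..φ, 1 / √(1 - k ^ 2 * Real.sin τ ^ 2)

/-- Complete elliptic integral of the first kind `K(k)`. -/
def ellipticK (k : ℝ) : ℝ := ∫ τ in (0 : ℝ)..(π / 2), 1 / √(1 - k ^ 2 * Real.sin τ ^ 2)

/-- Complete elliptic integral of the second kind `E(k)`. -/
def ellipticE (k : ℝ) : ℝ := ∫ τ in (0 : ℝ)..(π / 2), √(1 - k ^ 2 * Real.sin τ ^ 2)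

/-- The complementary modulus `k' = √(1 - k²)`. -/
def complModulus (k : ℝ) : ℝ := √(1 - k ^ 2)

/-- Jacobi amplitude: the inverse function of the increasing bijection `ellipticF k` of the real
line (used for moduli `k` with `k² < 1`). -/
def amplitude (k x : ℝ) : ℝ := Function.invFun (ellipticF k) x

/-- `sn(x|k)` for real `x`. -/
def realSn (k x : ℝ) : ℝ := Real.sin (amplitude k x)

/-- `cn(x|k)` for real `x`. -/
def realCn (k x : ℝ) : ℝ := Real.cos (amplitude k x)

/-- `dn(x|k)` for real `x`. -/
def realDn (k x : ℝ) : ℝ := √(1 - k ^ 2 * realSn k x ^ 2)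

/-- The common denominator `cn(y|k')² + k² sn(x|k)² sn(y|k')²` of `sn`, `cn`, `dn` at
`u = x + iy`. -/
def jacobiDen (k : ℝ) (u : ℂ) : ℝ :=
  realCn (complModulus k) u.im ^ 2 + k ^ 2 * realSn k u.re ^ 2 * realSn (complModulus k) u.im ^ 2

/-- `sn(u|k)` for complex `u = x + iy` (Jacobi's imaginary transformation combined with the
addition theorem); for `k = 0` it is the sine. -/
def jacobiSn (k : ℝ) (u : ℂ) : ℂ :=
  if k = 0 then Complex.sin u else
    ((realSn k u.re * realDn (complModulus k) u.im : ℝ) + Complex.I *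
      (realCn k u.re * realDn k u.re * realSn (complModulus k) u.im * realCn (complModulus k) u.im : ℝ)) /
      (jacobiDen k u : ℂ)

/-- `cn(u|k)` for complex `u = x + iy`; for `k = 0` it is the cosine. -/
def jacobiCn (k : ℝ) (u : ℂ) : ℂ :=
  if k = 0 then Complex.cos u else
    ((realCn k u.re * realCn (complModulus k) u.im : ℝ) - Complex.I *
      (realSn k u.re * realDn k u.re * realSn (complModulus k) u.im * realDn (complModulus k) u.im : ℝ)) /
      (jacobiDen k u : ℂ)

/-- `dn(u|k)` for complex `u = x + iy`; for `k = 0` it is constant equal to `1`. -/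
def jacobiDn (k : ℝ) (u : ℂ) : ℂ :=
  if k = 0 then 1 else
    ((realDn k u.re * realCn (complModulus k) u.im * realDn (complModulus k) u.im : ℝ) - Complex.I *
      (k ^ 2 * realSn k u.re * realCn k u.re * realSn (complModulus k) u.im : ℝ)) /
      (jacobiDen k u : ℂ)

/-- The Jacobi function `sc = sn / cn`, as a meromorphic function on `ℂ`: removable singularities
of the quotient are removed, and the value is set to `0` at the poles. -/
def jacobiSc (k : ℝ) : ℂ → ℂ :=
  toMeromorphicNFOn (fun u => jacobiSn k u / jacobiCn k u) Set.univ

/-- The Jacobi function `dc = dn / cn`, as a meromorphic function on `ℂ`. -/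
def jacobiDc (k : ℝ) : ℂ → ℂ :=
  toMeromorphicNFOn (fun u => jacobiDn k u / jacobiCn k u) Set.univ

/-- `Dc(u|k) = ∫₀ᵘ dc²(v|k) dv`, integrated along the straight segment from `0` to `u` (meant for
`u` such that this segment avoids the poles of `dc`, e.g. for real `u` in `(-K, K)`). -/
def integralDcSq (k : ℝ) (u : ℂ) : ℂ :=
  ∫ t in (0 : ℝ)..1, jacobiDc k ((t : ℂ) * u) ^ 2 * u

/-- `A(u|k) = (Dc(u|k) + ((E - K) / K) u) / k'`. -/
def ellipticA (k : ℝ) (u : ℂ) : ℂ :=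
  (1 / (complModulus k : ℂ)) *
    (integralDcSq k u + ((ellipticE k : ℂ) - ellipticK k) / (ellipticK k : ℂ) * u)

/-- The lattice `4Kℤ + 4iK'ℤ`, `K' = K(k')`, with quotient the torus `𝕋(k)`. For `k = 0` one has
`K' = ∞`, and only the period `4K = 2π` is left. -/
def periodLattice (k : ℝ) : AddSubgroup ℂ :=
  AddSubgroup.closure
    ({4 * (ellipticK k : ℂ)} ∪ {w | k ≠ 0 ∧ w = 4 * Complex.I * (ellipticK (complModulus k) : ℂ)})

/-! ## Infinite isoradial graphs and their diamond graphs -/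

section Graph

variable {V : Type*}

/-- The closed subset of the plane covered by the vertices and the (straight) edges of the graph
`G` whose vertices are placed in the plane by `p`. -/
def drawing (G : SimpleGraph V) (p : V → ℂ) : Set ℂ :=
  Set.range p ∪ {z | ∃ x y, G.Adj x y ∧ z ∈ segment ℝ (p x) (p y)}

/-- The face containing the point `z` (for `z` outside the drawing): the connected component of
`z` in the complement of the drawing. -/
def face (G : SimpleGraph V) (p : V → ℂ) (z : ℂ) : Set ℂ :=
  connectedComponentIn (drawing G p)ᶜ z

/-- The vertices of `G` on the boundary of the face containing `z`. -/
def faceVerts (G : SimpleGraph V) (p : V → ℂ) (z : ℂ) : Set V :=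
  {v | p v ∈ closure (face G p z)}

/-- `c` is the circumcenter of the face in which it lies: all vertices on the boundary of this
face are on the circle of radius `1` centered at `c`. -/
def IsCircumcenter (G : SimpleGraph V) (p : V → ℂ) (c : ℂ) : Prop :=
  c ∉ drawing G p ∧ ∀ v ∈ faceVerts G p c, dist (p v) c = 1

/-- `p` is an isoradial embedding of the infinite graph `G`: a locally finite straight-line planar
embedding such that every face is a polygon inscribed in a circle of radius `1` whose center is in
the interior of the face. In particular all faces are bounded, which forces `G` to be infinite. -/
structure IsIsoradial (G : SimpleGraph V) (p : V → ℂ) : Prop where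
  /-- Distinct vertices are at distinct points. -/
  injective : Function.Injective p
  /-- A vertex lies on an edge only if it is one of its endpoints. -/
  vertex_edge : ∀ x y z, G.Adj y z → p x ∈ segment ℝ (p y) (p z) → x = y ∨ x = z
  /-- Distinct edges meet at most at common endpoints. -/
  edge_edge : ∀ x y z w, G.Adj x y → G.Adj z w → s(x, y) ≠ s(z, w) →
    segment ℝ (p x) (p y) ∩ segment ℝ (p z) (p w) ⊆ {p x, p y} ∩ {p z, p w}
  /-- A bounded region contains finitely many vertices. -/
  finite_verts : ∀ r : ℝ, {x : V | ‖p x‖ ≤ r}.Finite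
  /-- A bounded region meets finitely many edges. -/
  finite_edges : ∀ r : ℝ, {e : V × V | G.Adj e.1 e.2 ∧
    (segment ℝ (p e.1) (p e.2) ∩ Metric.closedBall 0 r).Nonempty}.Finite
  /-- Every face is the open polygon spanned by its vertices. -/
  polygon : ∀ z, z ∉ drawing G p →
    face G p z = interior (convexHull ℝ (p '' faceVerts G p z))
  /-- Every face contains the center of a circle of radius `1` through all its vertices. -/
  inscribed : ∀ z, z ∉ drawing G p → ∃ c ∈ face G p z, IsCircumcenter G p c

/-- The dual vertices: the circumcenters of the faces. -/
def DualVertex (G : SimpleGraph V) (p : V → ℂ) : Type := {c : ℂ // IsCircumcenter G p c}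

/-- Position in the plane of the vertices of the diamond graph. -/
def diamondPos (G : SimpleGraph V) (p : V → ℂ) : V ⊕ DualVertex G p → ℂ :=
  Sum.elim p Subtype.val

/-- The diamond graph: its vertices are the vertices of `G` and the dual vertices, and a dual vertex
is joined to all vertices of `G` on the boundary of the corresponding face. -/
def diamondGraph (G : SimpleGraph V) (p : V → ℂ) : SimpleGraph (V ⊕ DualVertex G p) where
  Adj a b := match a, b with
    | Sum.inl v, Sum.inr c => v ∈ faceVerts G p c.1
    | Sum.inr c, Sum.inl v => v ∈ faceVerts G p c.1
    | _, _ => False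
  symm := ⟨by rintro (v | c) (w | d) h <;> exact h⟩
  loopless := ⟨by rintro (v | c) h <;> exact h⟩

/-- Half-angle at the vertex `x` of a rhombus with diagonal `xy`, third vertex `c` and unit sides. -/
theorem angle_eq_arccos_of_unit_sides (c x y : ℂ) (hx : dist x c = 1) (hy : dist y c = 1)
    (hxy : x ≠ y) : EuclideanGeometry.angle c x y = Real.arccos (dist x y / 2) := by
  have h := EuclideanGeometry.law_cos c x y
  rw [dist_comm c x, hx, dist_comm c y, hy, dist_comm y x] at h
  have hd : dist x y ≠ 0 := dist_ne_zero.2 hxy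
  have h2 : Real.cos (EuclideanGeometry.angle c x y) = dist x y / 2 := by
    field_simp
    apply mul_left_cancel₀ hd
    nlinarith
  rw [← h2, Real.arccos_cos (EuclideanGeometry.angle_nonneg _ _ _)
    (EuclideanGeometry.angle_le_pi _ _ _)]

/-- The rhombus half-angle of the edge `xy`, in `(0, π/2)`: the angle between the edge and a side
of the corresponding rhombus of the diamond graph. This rhombus has unit sides and `xy` as a
diagonal, see `angle_eq_arccos_of_unit_sides`. -/
def halfAngle (p : V → ℂ) (x y : V) : ℝ := Real.arccos (dist (p x) (p y) / 2)

/-- The rescaled half-angle `θ = θ̄ · 2K/π`, in `(0, K)`. -/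
def theta (k : ℝ) (p : V → ℂ) (x y : V) : ℝ := halfAngle p x y * (2 * ellipticK k / π)

/-! ## Massive Laplacian -/

/-- The conductance `ρ(xy) = sc(θ|k)`. -/
def conductance (k : ℝ) (p : V → ℂ) (x y : V) : ℂ := jacobiSc k (theta k p x y : ℂ)

/-- The (squared) mass `m²(x|k)`. -/
def massSq (k : ℝ) (G : SimpleGraph V) [G.LocallyFinite] (p : V → ℂ) (x : V) : ℂ :=
  ∑ y ∈ G.neighborFinset x, (ellipticA k (theta k p x y : ℂ) - conductance k p x y)

/-- The `k`-massive Laplacian `Δ^{m(k)}`. -/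
def massiveLaplacian (k : ℝ) (G : SimpleGraph V) [G.LocallyFinite] (p : V → ℂ) (f : V → ℂ)
    (x : V) : ℂ :=
  ∑ y ∈ G.neighborFinset x, conductance k p x y * (f x - f y) + massSq k G p x * f x

/-! ## The massive exponential function -/

/-- The factor `i √k' sc((u - α)/2 | k)` of a step from `a` to `b` with `b - a = exp(i ᾱ)`, where
`α = ᾱ · 2K/π`. The value does not depend on the determination of `ᾱ`, because `sc(·|k)` has
period `2K`. -/
def stepFactor (k : ℝ) (a b u : ℂ) : ℂ :=
  Complex.I * (√(complModulus k) : ℝ) *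
    jacobiSc k ((u - (Complex.arg (b - a) * (2 * ellipticK k / π) : ℝ)) / 2)

/-- The product of the factors of the steps of a path of the diamond graph. -/
def pathProduct (k : ℝ) {G : SimpleGraph V} {p : V → ℂ} {a b : V ⊕ DualVertex G p}
    (w : (diamondGraph G p).Walk a b) (u : ℂ) : ℂ :=
  (w.darts.map fun d => stepFactor k (diamondPos G p d.fst) (diamondPos G p d.snd) u).prod

/-- The product along a path as a meromorphic function on `ℂ`: zeros and poles of different factors
at the same point are simplified; by convention the value at a pole is `0`. -/
def pathExp (k : ℝ) {G : SimpleGraph V} {p : V → ℂ} {a b : V ⊕ DualVertex G p}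
    (w : (diamondGraph G p).Walk a b) : ℂ → ℂ :=
  toMeromorphicNFOn (pathProduct k w) Set.univ

open Classical in
/-- The discrete `k`-massive exponential function `u ↦ expo_{(a,b)}(u|k)`, computed along some path
of the diamond graph from `a` to `b`. -/
def massiveExp (k : ℝ) (G : SimpleGraph V) (p : V → ℂ) (a b : V ⊕ DualVertex G p) : ℂ → ℂ :=
  if h : (diamondGraph G p).Reachable a b then pathExp k h.some else 0

end Graph

end IsoradialMassive

end

open IsoradialMassive

open scoped Real ComplexConjugate
open Filter Topology Set MeasureTheory

namespace IsoradialMassive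

/-! ## Real Jacobi elliptic functions -/

/-! Write `K'` for `K(k')` and call `u` generic when `Im u / 2` avoids the heights of the zeros and
poles of `sc` (`genericSet`). Every identity is proved for generic `u`, where all step factors are
analytic and nonzero. Generic points are dense, so path independence and the periods extend because
meromorphic functions in normal form are determined on a dense set (`eq_of_eqOn_dense`), and
harmonicity extends by continuity (`massiveLaplacian_eq_zero_of_dense`).

Path independence. Reversing a step shifts the argument of `sc` by `K`. Since `k' sc(a) sc(a - K) =
-1` (`jacobiSc_mul_jacobiSc_sub`) and `(i√k')² = -k'`, reversal inverts the step factor. Opposite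
sides of a rhombus then cancel, so the factors multiply to one around each rhombus. They define a
local system on the plane, which is trivial because the plane is simply connected
(`IsLocalCocycle.exists_section`, `IsIsoradial.exists_potential`).

Torus. The shift by `4K` fixes every factor. The shift by `4iK'` negates every factor, and paths
between two vertices of `G` have even length because the diamond graph is bipartite.

Harmonicity. Along an edge of half-angle `θ` the exponential is `-k' sc(a) sc(a - θ)`. The addition
theorem for `A` (`ellipticA_add`) turns `A(θ) - sc(θ) e` into `1/k'` times the integral of `dc²(a -
s) + (E - K)/K` for `s` in `[0, θ]`, that is, up to scaling, over the directions pointing into the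
rhombus of the edge. The rhombi at a vertex tile a neighbourhood of it (`exists_dist_lt`,
`eq_of_dist_lt`), so the sum over the neighbours is an integral over a whole period `2K`. It
vanishes because `dc²` has integral `2(K - E)` over a period (`integral_dcSq_horizontal`). -/

/-- The radical `√(1 - k² sin² φ)`. -/
noncomputable def ellipticDelta (k φ : ℝ) : ℝ := √(1 - k ^ 2 * Real.sin φ ^ 2)

section RealJacobi

variable {k : ℝ}

theorem one_sub_mul_pos (hk : k ^ 2 < 1) {s : ℝ} (hs : s ^ 2 ≤ 1) : 0 < 1 - k ^ 2 * s ^ 2 := by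
  nlinarith [sq_nonneg k, sq_nonneg s]

theorem ellipticDelta_pos (hk : k ^ 2 < 1) (φ : ℝ) : 0 < ellipticDelta k φ :=
  Real.sqrt_pos.2 (one_sub_mul_pos hk (Real.sin_sq_le_one φ))

theorem continuous_ellipticDelta : Continuous (ellipticDelta k) := by
  unfold ellipticDelta; fun_prop

theorem continuous_inv_ellipticDelta (hk : k ^ 2 < 1) :
    Continuous fun φ => 1 / ellipticDelta k φ :=
  continuous_const.div continuous_ellipticDelta fun φ => (ellipticDelta_pos hk φ).ne'

theorem hasDerivAt_ellipticF (hk : k ^ 2 < 1) (φ : ℝ) :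
    HasDerivAt (ellipticF k) (1 / ellipticDelta k φ) φ :=
  intervalIntegral.integral_hasDerivAt_right
    ((continuous_inv_ellipticDelta hk).intervalIntegrable _ _)
    ((continuous_inv_ellipticDelta hk).stronglyMeasurableAtFilter _ _)
    (continuous_inv_ellipticDelta hk).continuousAt

theorem continuous_ellipticF (hk : k ^ 2 < 1) : Continuous (ellipticF k) :=
  continuous_iff_continuousAt.2 fun φ => (hasDerivAt_ellipticF hk φ).continuousAt

theorem strictMono_ellipticF (hk : k ^ 2 < 1) : StrictMono (ellipticF k) :=
  strictMono_of_deriv_pos fun φ => by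
    rw [(hasDerivAt_ellipticF hk φ).deriv]
    exact one_div_pos.2 (ellipticDelta_pos hk φ)

theorem ellipticF_zero : ellipticF k 0 = 0 := by simp [ellipticF]

theorem ellipticF_pi_div_two : ellipticF k (π / 2) = ellipticK k := rfl

theorem ellipticDelta_add_pi (φ : ℝ) : ellipticDelta k (φ + π) = ellipticDelta k φ := by
  simp [ellipticDelta]

theorem ellipticF_neg (φ : ℝ) : ellipticF k (-φ) = -ellipticF k φ := by
  have h := intervalIntegral.integral_comp_neg (a := 0) (b := φ)
    (fun τ => 1 / √(1 - k ^ 2 * Real.sin τ ^ 2))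
  simp only [Real.sin_neg, neg_sq, neg_zero] at h
  rw [ellipticF, ellipticF, h, intervalIntegral.integral_symm]

theorem ellipticF_pi (hk : k ^ 2 < 1) : ellipticF k π = 2 * ellipticK k := by
  have hi := fun a b => (continuous_inv_ellipticDelta hk).intervalIntegrable (μ := volume) a b
  have h1 : ellipticF k π = ellipticF k (π / 2) + ∫ τ in (π / 2)..π, 1 / ellipticDelta k τ :=
    (intervalIntegral.integral_add_adjacent_intervals (hi _ _) (hi _ _)).symm
  have h := intervalIntegral.integral_comp_sub_left (a := π / 2) (b := π)
    (fun τ => 1 / ellipticDelta k τ) π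
  have h2 : ∀ τ, ellipticDelta k (π - τ) = ellipticDelta k τ := fun τ => by simp [ellipticDelta]
  simp only [h2, sub_self] at h
  rw [h1, h, show π - π / 2 = π / 2 by ring, ellipticF_pi_div_two]
  change _ + ellipticK k = _
  ring

theorem ellipticF_add_pi (hk : k ^ 2 < 1) (φ : ℝ) :
    ellipticF k (φ + π) = ellipticF k φ + 2 * ellipticK k := by
  have hi := fun a b => (continuous_inv_ellipticDelta hk).intervalIntegrable (μ := volume) a b
  have h1 : ellipticF k (φ + π) = ellipticF k π + ∫ τ in π..(φ + π), 1 / ellipticDelta k τ :=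
    (intervalIntegral.integral_add_adjacent_intervals (hi _ _) (hi _ _)).symm
  have h := intervalIntegral.integral_comp_add_right (a := 0) (b := φ)
    (fun τ => 1 / ellipticDelta k τ) π
  simp only [ellipticDelta_add_pi, zero_add] at h
  rw [h1, ← h, ellipticF_pi hk]
  change _ + ellipticF k φ = _
  ring

theorem ellipticK_pos (hk : k ^ 2 < 1) : 0 < ellipticK k := by
  rw [← ellipticF_pi_div_two, ← ellipticF_zero (k := k)]
  exact strictMono_ellipticF hk (by positivity)

theorem ellipticF_int_mul_pi (hk : k ^ 2 < 1) (n : ℤ) :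
    ellipticF k (n * π) = n * (2 * ellipticK k) := by
  induction n with
  | zero => simp [ellipticF_zero]
  | succ i ih => push_cast at ih ⊢; rw [add_mul, one_mul, ellipticF_add_pi hk, ih]; ring
  | pred i ih =>
    have := ellipticF_add_pi hk ((-(i : ℝ) - 1) * π)
    push_cast at ih ⊢
    rw [show (-(i : ℝ) - 1) * π + π = -i * π by ring, ih] at this
    linarith

theorem surjective_ellipticF (hk : k ^ 2 < 1) : Function.Surjective (ellipticF k) := by
  intro x
  have hK := ellipticK_pos hk
  obtain ⟨n, hn⟩ := exists_nat_ge (|x| / (2 * ellipticK k))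
  rw [div_le_iff₀ (by positivity)] at hn
  have h1 := ellipticF_int_mul_pi hk n
  have h2 : ellipticF k (-(((n : ℤ) : ℝ) * π)) = _ := ellipticF_neg _
  rw [h1] at h2
  push_cast at h1 h2
  have := intermediate_value_Icc (a := -((n : ℝ) * π)) (b := n * π)
    (by have := Real.pi_pos; nlinarith [(Nat.cast_nonneg n : (0 : ℝ) ≤ n)])
    (continuous_ellipticF hk).continuousOn
  obtain ⟨y, -, hy⟩ := this (show x ∈ _ by
    rw [h1, h2]; exact ⟨by linarith [neg_abs_le x], by linarith [le_abs_self x]⟩)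
  exact ⟨y, hy⟩

theorem ellipticF_amplitude (hk : k ^ 2 < 1) (x : ℝ) : ellipticF k (amplitude k x) = x :=
  Function.rightInverse_invFun (surjective_ellipticF hk) x

theorem amplitude_ellipticF (hk : k ^ 2 < 1) (φ : ℝ) : amplitude k (ellipticF k φ) = φ :=
  Function.leftInverse_invFun (strictMono_ellipticF hk).injective φ

theorem strictMono_amplitude (hk : k ^ 2 < 1) : StrictMono (amplitude k) := fun x y h => by
  by_contra! h'
  have := (strictMono_ellipticF hk).monotone h'
  rw [ellipticF_amplitude hk, ellipticF_amplitude hk] at this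
  linarith

theorem continuous_amplitude (hk : k ^ 2 < 1) : Continuous (amplitude k) :=
  (strictMono_amplitude hk).monotone.continuous_of_surjective
    fun φ => ⟨_, amplitude_ellipticF hk φ⟩

theorem realDn_eq (x : ℝ) : realDn k x = ellipticDelta k (amplitude k x) := rfl

theorem realDn_pos (hk : k ^ 2 < 1) (x : ℝ) : 0 < realDn k x := ellipticDelta_pos hk _

theorem hasDerivAt_amplitude (hk : k ^ 2 < 1) (x : ℝ) :
    HasDerivAt (amplitude k) (realDn k x) x := by
  have h := (hasDerivAt_ellipticF hk (amplitude k x)).of_local_left_inverse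
    (continuous_amplitude hk).continuousAt (one_div_pos.2 (ellipticDelta_pos hk _)).ne'
    (Eventually.of_forall fun y => ellipticF_amplitude hk y)
  simpa [realDn_eq] using h

theorem hasDerivAt_realSn (hk : k ^ 2 < 1) (x : ℝ) :
    HasDerivAt (realSn k) (realCn k x * realDn k x) x :=
  (hasDerivAt_amplitude hk x).sin

theorem hasDerivAt_realCn (hk : k ^ 2 < 1) (x : ℝ) :
    HasDerivAt (realCn k) (-(realSn k x * realDn k x)) x := by
  have := (hasDerivAt_amplitude hk x).cos
  rwa [neg_mul] at this

theorem realDn_sq (hk : k ^ 2 < 1) (x : ℝ) : realDn k x ^ 2 = 1 - k ^ 2 * realSn k x ^ 2 :=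
  Real.sq_sqrt (one_sub_mul_pos hk (Real.sin_sq_le_one _)).le

theorem realCn_sq (x : ℝ) : realCn k x ^ 2 = 1 - realSn k x ^ 2 := Real.cos_sq' _

theorem hasDerivAt_realDn (hk : k ^ 2 < 1) (x : ℝ) :
    HasDerivAt (realDn k) (-(k ^ 2 * realSn k x * realCn k x)) x := by
  have h := ((((hasDerivAt_realSn hk x).pow 2).const_mul (k ^ 2)).const_sub 1).sqrt
    (one_sub_mul_pos hk (Real.sin_sq_le_one _)).ne'
  refine h.congr_deriv ?_
  have hd := (realDn_pos hk x).ne'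
  change _ / (2 * realDn k x) = _
  field_simp
  push_cast
  ring

theorem amplitude_add (hk : k ^ 2 < 1) (x : ℝ) :
    amplitude k (x + 2 * ellipticK k) = amplitude k x + π := by
  apply (strictMono_ellipticF hk).injective
  rw [ellipticF_amplitude hk, ellipticF_add_pi hk, ellipticF_amplitude hk]

theorem realSn_add (hk : k ^ 2 < 1) (x : ℝ) : realSn k (x + 2 * ellipticK k) = -realSn k x := by
  rw [realSn, amplitude_add hk, Real.sin_add_pi, realSn]

theorem realCn_add (hk : k ^ 2 < 1) (x : ℝ) : realCn k (x + 2 * ellipticK k) = -realCn k x := by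
  rw [realCn, amplitude_add hk, Real.cos_add_pi, realCn]

theorem realDn_add (hk : k ^ 2 < 1) (x : ℝ) : realDn k (x + 2 * ellipticK k) = realDn k x := by
  rw [realDn, realSn_add hk, neg_sq, realDn]

theorem amplitude_zero (hk : k ^ 2 < 1) : amplitude k 0 = 0 := by
  have := amplitude_ellipticF hk 0
  rwa [ellipticF_zero] at this

theorem amplitude_ellipticK (hk : k ^ 2 < 1) : amplitude k (ellipticK k) = π / 2 :=
  amplitude_ellipticF hk (π / 2)

theorem amplitude_neg (hk : k ^ 2 < 1) (x : ℝ) : amplitude k (-x) = -amplitude k x := by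
  apply (strictMono_ellipticF hk).injective
  rw [ellipticF_amplitude hk, ellipticF_neg, ellipticF_amplitude hk]

theorem realSn_zero (hk : k ^ 2 < 1) : realSn k 0 = 0 := by simp [realSn, amplitude_zero hk]
theorem realCn_zero (hk : k ^ 2 < 1) : realCn k 0 = 1 := by simp [realCn, amplitude_zero hk]
theorem realDn_zero (hk : k ^ 2 < 1) : realDn k 0 = 1 := by simp [realDn, realSn_zero hk]
theorem realSn_ellipticK (hk : k ^ 2 < 1) : realSn k (ellipticK k) = 1 := by
  simp [realSn, amplitude_ellipticK hk]
theorem realCn_ellipticK (hk : k ^ 2 < 1) : realCn k (ellipticK k) = 0 := by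
  simp [realCn, amplitude_ellipticK hk]

theorem realCn_pos (hk : k ^ 2 < 1) {x : ℝ} (hx : |x| < ellipticK k) : 0 < realCn k x := by
  rw [abs_lt] at hx
  apply Real.cos_pos_of_mem_Ioo
  rw [← amplitude_ellipticK hk, ← amplitude_neg hk]
  exact ⟨strictMono_amplitude hk hx.1, strictMono_amplitude hk hx.2⟩

theorem realSn_eq_zero_iff (hk : k ^ 2 < 1) {x : ℝ} :
    realSn k x = 0 ↔ ∃ n : ℤ, n * (2 * ellipticK k) = x := by
  rw [realSn, Real.sin_eq_zero_iff]
  refine exists_congr fun n => ⟨fun h => ?_, fun h => ?_⟩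
  · rw [← ellipticF_int_mul_pi hk, h, ellipticF_amplitude hk]
  · rw [← h, ← ellipticF_int_mul_pi hk, amplitude_ellipticF hk]

theorem realSn_sq_add_realCn_sq (x : ℝ) : realSn k x ^ 2 + realCn k x ^ 2 = 1 :=
  Real.sin_sq_add_cos_sq _

theorem continuous_realSn (hk : k ^ 2 < 1) : Continuous (realSn k) :=
  continuous_iff_continuousAt.2 fun x => (hasDerivAt_realSn hk x).continuousAt

theorem continuous_realCn (hk : k ^ 2 < 1) : Continuous (realCn k) :=
  continuous_iff_continuousAt.2 fun x => (hasDerivAt_realCn hk x).continuousAt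

theorem continuous_realDn (hk : k ^ 2 < 1) : Continuous (realDn k) :=
  continuous_iff_continuousAt.2 fun x => (hasDerivAt_realDn hk x).continuousAt

theorem integral_ellipticDelta_zero_pi : ∫ φ in (0 : ℝ)..π, ellipticDelta k φ = 2 * ellipticE k := by
  have hi := fun a b => (continuous_ellipticDelta (k := k)).intervalIntegrable (μ := volume) a b
  have h := intervalIntegral.integral_comp_sub_left (a := π / 2) (b := π)
    (fun τ => ellipticDelta k τ) π
  have h2 : ∀ τ, ellipticDelta k (π - τ) = ellipticDelta k τ := fun τ => by simp [ellipticDelta]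
  simp only [h2, sub_self] at h
  rw [← intervalIntegral.integral_add_adjacent_intervals (hi _ (π / 2)) (hi _ _), h,
    show π - π / 2 = π / 2 by ring, ellipticE]
  change ellipticE k + ellipticE k = _
  rw [ellipticE]; ring

/-- The substitution `x = F(φ)` turns `dn² dx` into `Δ dφ`, whose integral over `[0, π]` is `2E`. -/
theorem integral_realDn_sq (hk : k ^ 2 < 1) :
    ∫ x in (0 : ℝ)..(2 * ellipticK k), realDn k x ^ 2 = 2 * ellipticE k := by
  have h := intervalIntegral.integral_comp_mul_deriv (a := 0) (b := π) (f := ellipticF k)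
    (f' := fun φ => 1 / ellipticDelta k φ) (g := fun x => realDn k x ^ 2)
    (fun φ _ => hasDerivAt_ellipticF hk φ) (continuous_inv_ellipticDelta hk).continuousOn
    ((continuous_realDn hk).pow 2)
  rw [ellipticF_zero, ellipticF_pi hk] at h
  rw [← h, ← integral_ellipticDelta_zero_pi]
  congr 1
  ext φ
  have := (ellipticDelta_pos hk φ).ne'
  simp only [Function.comp, realDn_eq, amplitude_ellipticF hk]
  field_simp

/-- `∫ k'² / dn²` over a period. -/
theorem integral_inv_realDn_sq (hk : k ^ 2 < 1) :
    ∫ x in (0 : ℝ)..(2 * ellipticK k), (1 - k ^ 2) / realDn k x ^ 2 = 2 * ellipticE k := by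
  have hd := fun x => (realDn_pos hk x).ne'
  -- The function `sn cn / dn` vanishes at `0` and `2K`, and `k'²/dn² = dn² - k² (sn cn / dn)'`.
  -- Hence `k'²/dn²` and `dn²` have the same integral.
  have h : ∀ x, HasDerivAt (fun x => realSn k x * realCn k x / realDn k x)
      (realCn k x ^ 2 - realSn k x ^ 2 + k ^ 2 * realSn k x ^ 2 * realCn k x ^ 2 /
        realDn k x ^ 2) x := fun x => by
    refine (((hasDerivAt_realSn hk x).mul (hasDerivAt_realCn hk x)).div
      (hasDerivAt_realDn hk x) (hd x)).congr_deriv ?_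
    have := hd x
    simp only [Pi.mul_apply]
    field_simp
    ring
  have hc : Continuous fun x => realCn k x ^ 2 - realSn k x ^ 2 +
      k ^ 2 * realSn k x ^ 2 * realCn k x ^ 2 / realDn k x ^ 2 := by
    have h1 := continuous_realSn hk
    have h2 := continuous_realCn hk
    have h3 := continuous_realDn hk
    exact ((h2.pow 2).sub (h1.pow 2)).add
      (((continuous_const.mul (h1.pow 2)).mul (h2.pow 2)).div (h3.pow 2)
        fun x => pow_ne_zero 2 (hd x))
  have h0 := intervalIntegral.integral_eq_sub_of_hasDerivAt (a := 0) (b := 2 * ellipticK k)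
    (fun x _ => h x) (hc.intervalIntegrable _ _)
  have hz := realSn_add hk 0
  rw [zero_add, realSn_zero hk, neg_zero] at hz
  rw [hz, realSn_zero hk] at h0
  rw [← integral_realDn_sq hk]
  have h1 : ∀ x, (1 - k ^ 2) / realDn k x ^ 2 = realDn k x ^ 2 -
      k ^ 2 * (realCn k x ^ 2 - realSn k x ^ 2 +
        k ^ 2 * realSn k x ^ 2 * realCn k x ^ 2 / realDn k x ^ 2) := fun x => by
    have hdx := one_sub_mul_pos hk (Real.sin_sq_le_one (amplitude k x))
    change 0 < 1 - k ^ 2 * realSn k x ^ 2 at hdx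
    rw [realCn_sq, realDn_sq hk]
    field_simp
    ring
  simp_rw [h1]
  have hc1 : Continuous fun x => realDn k x ^ 2 := (continuous_realDn hk).pow 2
  have hc2 : Continuous fun x => k ^ 2 * (realCn k x ^ 2 - realSn k x ^ 2 +
      k ^ 2 * realSn k x ^ 2 * realCn k x ^ 2 / realDn k x ^ 2) := continuous_const.mul hc
  rw [intervalIntegral.integral_sub (hc1.intervalIntegrable _ _) (hc2.intervalIntegrable _ _),
    intervalIntegral.integral_const_mul, h0]
  simp

end RealJacobi

/-! ### Real partial derivatives and the Cauchy-Riemann equation. -/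

/-- `f` is real differentiable at `z` with partial derivatives `a` and `b`. -/
def HasPartials (f : ℂ → ℂ) (a b : ℂ) (z : ℂ) : Prop :=
  HasFDerivAt (𝕜 := ℝ) f (Complex.reCLM.smulRight a + Complex.imCLM.smulRight b) z

namespace HasPartials

variable {f g : ℂ → ℂ} {a b a' b' z : ℂ}

theorem const (c z : ℂ) : HasPartials (fun _ => c) 0 0 z :=
  (hasFDerivAt_const (𝕜 := ℝ) c z).congr_fderiv (by ext; simp)

theorem add (hf : HasPartials f a b z) (hg : HasPartials g a' b' z) :
    HasPartials (fun u => f u + g u) (a + a') (b + b') z :=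
  (HasFDerivAt.add hf hg).congr_fderiv (by
    ext; simp; ring)

theorem sub (hf : HasPartials f a b z) (hg : HasPartials g a' b' z) :
    HasPartials (fun u => f u - g u) (a - a') (b - b') z :=
  (HasFDerivAt.sub hf hg).congr_fderiv (by ext; simp; ring)

theorem mul (hf : HasPartials f a b z) (hg : HasPartials g a' b' z) :
    HasPartials (fun u => f u * g u) (a * g z + f z * a') (b * g z + f z * b') z :=
  (HasFDerivAt.mul hf hg).congr_fderiv (by ext; simp; ring)

theorem inv (hf : HasPartials f a b z) (h0 : f z ≠ 0) :
    HasPartials (fun u => (f u)⁻¹) (-a / f z ^ 2) (-b / f z ^ 2) z :=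
  (((hasDerivAt_inv h0).hasFDerivAt.restrictScalars ℝ).comp z hf).congr_fderiv (by
    ext; simp [div_eq_mul_inv]; ring)

theorem ofReal_re {r : ℝ → ℝ} {r' : ℝ} (hr : HasDerivAt r r' z.re) :
    HasPartials (fun u => (r u.re : ℂ)) r' 0 z :=
  (hr.ofReal_comp.hasFDerivAt.comp z Complex.reCLM.hasFDerivAt).congr_fderiv (by ext; simp)

theorem ofReal_im {r : ℝ → ℝ} {r' : ℝ} (hr : HasDerivAt r r' z.im) :
    HasPartials (fun u => (r u.im : ℂ)) 0 r' z :=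
  (hr.ofReal_comp.hasFDerivAt.comp z Complex.imCLM.hasFDerivAt).congr_fderiv (by ext; simp)

/-- The Cauchy-Riemann equation implies complex differentiability. -/
theorem differentiableAt (hf : HasPartials f a b z) (h : b = Complex.I * a) :
    DifferentiableAt ℂ f z := by
  rw [differentiableAt_complex_iff_differentiableAt_real]
  refine ⟨HasFDerivAt.differentiableAt hf, ?_⟩
  rw [HasFDerivAt.fderiv hf]
  simp [h]

/-- Clearing denominators in the Cauchy-Riemann equation of a quotient leaves a polynomial identity,
which can be checked from the algebraic relations between the real Jacobi functions. -/
theorem differentiableAt_div (hf : HasPartials f a b z) (hg : HasPartials g a' b' z)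
    (h0 : g z ≠ 0)
    (h : b * g z - f z * b' = Complex.I * (a * g z - f z * a')) :
    DifferentiableAt ℂ (fun u => f u / g u) z := by
  simp_rw [div_eq_mul_inv]
  refine (hf.mul (hg.inv h0)).differentiableAt ?_
  field_simp
  linear_combination h

end HasPartials


/-! ## The Jacobi functions off the imaginary axis of periods -/

section ComplexJacobi

variable {k : ℝ}

/-- The denominator of the explicit formulas for `sc` and `dc`. -/
noncomputable def scDen (k : ℝ) (u : ℂ) : ℝ :=
  realCn k u.re ^ 2 + complModulus k ^ 2 * realSn k u.re ^ 2 * realSn (complModulus k) u.im ^ 2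

/-- The explicit formula for `sc (x + iy)`. -/
noncomputable def scFormula (k : ℝ) (u : ℂ) : ℂ :=
  ((realSn k u.re * realCn k u.re * realCn (complModulus k) u.im * realDn (complModulus k) u.im : ℝ)
    + Complex.I * (realDn k u.re * realSn (complModulus k) u.im : ℝ)) / (scDen k u : ℂ)

/-- The explicit formula for `dc (x + iy)`. -/
noncomputable def dcFormula (k : ℝ) (u : ℂ) : ℂ :=
  ((realDn k u.re * realCn k u.re * realDn (complModulus k) u.im : ℝ) + Complex.I *
    (complModulus k ^ 2 * realSn k u.re * realSn (complModulus k) u.im *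
      realCn (complModulus k) u.im : ℝ)) / (scDen k u : ℂ)

theorem complModulus_sq (hk : k ^ 2 < 1) : complModulus k ^ 2 = 1 - k ^ 2 :=
  Real.sq_sqrt (by linarith)

theorem complModulus_pos (hk : k ^ 2 < 1) : 0 < complModulus k := Real.sqrt_pos.2 (by linarith)

theorem complModulus_sq_lt_one (hk : k ^ 2 < 1) (hk0 : k ≠ 0) : complModulus k ^ 2 < 1 := by
  rw [complModulus_sq hk]; have : 0 < k ^ 2 := by positivity
  linarith

section Differentiability

/-- The complex functions are given by formulas in the real and imaginary parts of `u`, so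
holomorphy is not automatic. It is a Cauchy-Riemann identity modulo `cn² = 1 - sn²`, `dn² = 1 - k²
sn²`, their analogues for `k'`, and `k'² = 1 - k²`. -/
theorem differentiableAt_jacobi (hk : k ^ 2 < 1) (hk0 : k ≠ 0) {z : ℂ} (hz : jacobiDen k z ≠ 0) :
    DifferentiableAt ℂ (jacobiSn k) z ∧ DifferentiableAt ℂ (jacobiCn k) z ∧
      DifferentiableAt ℂ (jacobiDn k) z := by
  have hk' := complModulus_sq_lt_one hk hk0
  have hz' := Complex.ofReal_ne_zero.2 hz
  have es := HasPartials.ofReal_re (hasDerivAt_realSn hk z.re)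
  have ec := HasPartials.ofReal_re (hasDerivAt_realCn hk z.re)
  have ed := HasPartials.ofReal_re (hasDerivAt_realDn hk z.re)
  have es1 := HasPartials.ofReal_im (hasDerivAt_realSn hk' z.im)
  have ec1 := HasPartials.ofReal_im (hasDerivAt_realCn hk' z.im)
  have ed1 := HasPartials.ofReal_im (hasDerivAt_realDn hk' z.im)
  have rc := congrArg Complex.ofReal (realCn_sq (k := k) z.re)
  have rd := congrArg Complex.ofReal (realDn_sq hk z.re)
  have rc1 := congrArg Complex.ofReal (realCn_sq (k := complModulus k) z.im)
  have rd1 := congrArg Complex.ofReal (realDn_sq hk' z.im)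
  have rk := congrArg Complex.ofReal (complModulus_sq hk)
  have rI := Complex.I_sq
  have eI := HasPartials.const Complex.I z
  have ek := HasPartials.const (k : ℂ) z
  have eD := (ec1.mul ec1).add ((((ek.mul ek).mul (es.mul es))).mul (es1.mul es1))
  push_cast at *
  refine ⟨?_, ?_, ?_⟩
  · have := HasPartials.differentiableAt_div
      ((es.mul ed1).add (eI.mul ((ec.mul ed).mul (es1.mul ec1)))) eD
      (by convert hz' using 1; simp only [jacobiDen]; push_cast; ring) (by grind)
    refine this.congr_of_eventuallyEq (Eventually.of_forall fun u => ?_)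
    simp only [jacobiSn, hk0, if_false, jacobiDen]
    push_cast
    ring
  · have := HasPartials.differentiableAt_div
      ((ec.mul ec1).sub (eI.mul ((es.mul ed).mul (es1.mul ed1)))) eD
      (by convert hz' using 1; simp only [jacobiDen]; push_cast; ring) (by grind)
    refine this.congr_of_eventuallyEq (Eventually.of_forall fun u => ?_)
    simp only [jacobiCn, hk0, if_false, jacobiDen]
    push_cast
    ring
  · have := HasPartials.differentiableAt_div
      ((ed.mul (ec1.mul ed1)).sub (eI.mul ((ek.mul ek).mul ((es.mul ec).mul es1)))) eD
      (by convert hz' using 1; simp only [jacobiDen]; push_cast; ring) (by grind)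
    refine this.congr_of_eventuallyEq (Eventually.of_forall fun u => ?_)
    simp only [jacobiDn, hk0, if_false, jacobiDen]
    push_cast
    ring

theorem differentiableAt_formula (hk : k ^ 2 < 1) (hk0 : k ≠ 0) {z : ℂ} (hz : scDen k z ≠ 0) :
    DifferentiableAt ℂ (scFormula k) z ∧ DifferentiableAt ℂ (dcFormula k) z := by
  have hk' := complModulus_sq_lt_one hk hk0
  have hz' := Complex.ofReal_ne_zero.2 hz
  have es := HasPartials.ofReal_re (hasDerivAt_realSn hk z.re)
  have ec := HasPartials.ofReal_re (hasDerivAt_realCn hk z.re)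
  have ed := HasPartials.ofReal_re (hasDerivAt_realDn hk z.re)
  have es1 := HasPartials.ofReal_im (hasDerivAt_realSn hk' z.im)
  have ec1 := HasPartials.ofReal_im (hasDerivAt_realCn hk' z.im)
  have ed1 := HasPartials.ofReal_im (hasDerivAt_realDn hk' z.im)
  have rc := congrArg Complex.ofReal (realCn_sq (k := k) z.re)
  have rd := congrArg Complex.ofReal (realDn_sq hk z.re)
  have rc1 := congrArg Complex.ofReal (realCn_sq (k := complModulus k) z.im)
  have rd1 := congrArg Complex.ofReal (realDn_sq hk' z.im)
  have rk := congrArg Complex.ofReal (complModulus_sq hk)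
  have rI := Complex.I_sq
  have eI := HasPartials.const Complex.I z
  have ek := HasPartials.const (complModulus k : ℂ) z
  have eD := (ec.mul ec).add ((((ek.mul ek).mul (es.mul es))).mul (es1.mul es1))
  push_cast at *
  refine ⟨?_, ?_⟩
  · have := HasPartials.differentiableAt_div
      (((es.mul ec).mul (ec1.mul ed1)).add (eI.mul (ed.mul es1))) eD
      (by convert hz' using 1; simp only [scDen]; push_cast; ring) (by grind)
    refine this.congr_of_eventuallyEq (Eventually.of_forall fun u => ?_)
    simp only [scFormula, scDen]
    push_cast
    ring
  · have := HasPartials.differentiableAt_div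
      (((ed.mul ec).mul ed1).add (eI.mul (((ek.mul ek).mul es).mul (es1.mul ec1)))) eD
      (by convert hz' using 1; simp only [scDen]; push_cast; ring) (by grind)
    refine this.congr_of_eventuallyEq (Eventually.of_forall fun u => ?_)
    simp only [dcFormula, scDen]
    push_cast
    ring

end Differentiability

end ComplexJacobi

/-! ## Meromorphic functions in normal form -/

/-- A meromorphic function which coincides with an analytic one in a punctured neighbourhood is
equal to it after normalization. -/
theorem toMeromorphicNFOn_eventuallyEq_of_analyticAt {f g : ℂ → ℂ} {z : ℂ} (hf : Meromorphic f)
    (hg : AnalyticAt ℂ g z) (h : f =ᶠ[𝓝[≠] z] g) : toMeromorphicNFOn f univ =ᶠ[𝓝 z] g := by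
  have hf' : MeromorphicOn f univ := fun x _ => hf x
  rw [← (meromorphicNFOn_toMeromorphicNFOn f univ
    (mem_univ z)).eventuallyEq_nhdsNE_iff_eventuallyEq_nhds hg.meromorphicNFAt]
  exact (hf'.toMeromorphicNFOn_eq_self_on_nhdsNE (mem_univ z)).trans h

/-! ### The functions `sc` and `dc` as meromorphic functions. -/

section ComplexJacobi

variable {k : ℝ}

theorem scDen_eq (hk : k ^ 2 < 1) (hk0 : k ≠ 0) (u : ℂ) :
    scDen k u = 1 - realSn k u.re ^ 2 * realDn (complModulus k) u.im ^ 2 := by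
  rw [scDen, realCn_sq, realDn_sq (complModulus_sq_lt_one hk hk0)]
  ring

theorem jacobi_div_eq_formula (hk : k ^ 2 < 1) (hk0 : k ≠ 0) {u : ℂ} (h1 : jacobiDen k u ≠ 0)
    (h2 : scDen k u ≠ 0) :
    jacobiSn k u / jacobiCn k u = scFormula k u ∧ jacobiDn k u / jacobiCn k u = dcFormula k u := by
  have hk' := complModulus_sq_lt_one hk hk0
  have h1' := Complex.ofReal_ne_zero.2 h1
  have h2' := Complex.ofReal_ne_zero.2 h2
  have rc := congrArg Complex.ofReal (realCn_sq (k := k) u.re)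
  have rd := congrArg Complex.ofReal (realDn_sq hk u.re)
  have rc1 := congrArg Complex.ofReal (realCn_sq (k := complModulus k) u.im)
  have rd1 := congrArg Complex.ofReal (realDn_sq hk' u.im)
  have rk := congrArg Complex.ofReal (complModulus_sq hk)
  have rI := Complex.I_sq
  -- The squared modulus of the numerator of `cn` factors as `jacobiDen * scDen`. Multiplying
  -- numerator and denominator by the conjugate therefore cancels `jacobiDen` and leaves `scDen` as
  -- the only denominator.
  have hprod : (((realCn k u.re * realCn (complModulus k) u.im : ℝ) : ℂ) - Complex.I *
      (realSn k u.re * realDn k u.re * realSn (complModulus k) u.im *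
        realDn (complModulus k) u.im : ℝ)) * (((realCn k u.re * realCn (complModulus k) u.im : ℝ) : ℂ)
        + Complex.I * (realSn k u.re * realDn k u.re * realSn (complModulus k) u.im *
        realDn (complModulus k) u.im : ℝ)) = jacobiDen k u * scDen k u := by
    simp only [jacobiDen, scDen]
    push_cast at *
    grind
  have hne := left_ne_zero_of_mul (hprod.trans_ne (mul_ne_zero h1' h2'))
  simp only [jacobiSn, jacobiCn, jacobiDn, hk0, if_false, scFormula, dcFormula]
  rw [div_div_div_cancel_right₀ h1', div_div_div_cancel_right₀ h1', div_eq_div_iff hne h2',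
    div_eq_div_iff hne h2']
  clear hprod hne h1' h2'
  simp only [scDen]
  push_cast at *
  constructor <;> grind

theorem isOpen_jacobiDen (hk : k ^ 2 < 1) (hk0 : k ≠ 0) : IsOpen {u | jacobiDen k u ≠ 0} := by
  have h1 := continuous_realSn hk
  have h2 := continuous_realSn (complModulus_sq_lt_one hk hk0)
  have h3 := continuous_realCn (complModulus_sq_lt_one hk hk0)
  refine isOpen_ne_fun ?_ continuous_const
  unfold jacobiDen
  fun_prop

theorem isOpen_scDen (hk : k ^ 2 < 1) (hk0 : k ≠ 0) : IsOpen {u | scDen k u ≠ 0} := by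
  have h1 := continuous_realSn hk
  have h2 := continuous_realSn (complModulus_sq_lt_one hk hk0)
  have h3 := continuous_realCn hk
  refine isOpen_ne_fun ?_ continuous_const
  unfold scDen
  fun_prop

theorem jacobiDen_eq_zero_iff (hk0 : k ≠ 0) {u : ℂ} :
    jacobiDen k u = 0 ↔ realSn k u.re = 0 ∧ realCn (complModulus k) u.im = 0 := by
  have h := realSn_sq_add_realCn_sq (k := complModulus k) u.im
  constructor
  · intro h0
    have hk2 : 0 < k ^ 2 := by positivity
    have hc : realCn (complModulus k) u.im ^ 2 = 0 := by
      unfold jacobiDen at h0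
      nlinarith [sq_nonneg (realCn (complModulus k) u.im),
        sq_nonneg (k * realSn k u.re * realSn (complModulus k) u.im)]
    have hc' : realCn (complModulus k) u.im = 0 := by simpa using hc
    refine ⟨?_, hc'⟩
    rw [hc] at h
    have : realSn (complModulus k) u.im ^ 2 = 1 := by linarith
    unfold jacobiDen at h0
    rw [hc, this] at h0
    simpa [hk0] using h0
  · rintro ⟨h1, h2⟩
    simp [jacobiDen, h1, h2]

/-- A zero requires `sn(x|k) = 0` and `cn(y|k') = 0` together, and both real functions have only
simple zeros, so the zeros are isolated. -/
theorem eventually_jacobiDen_ne_zero (hk : k ^ 2 < 1) (hk0 : k ≠ 0) (z : ℂ) :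
    ∀ᶠ u in 𝓝[≠] z, jacobiDen k u ≠ 0 := by
  have hk' := complModulus_sq_lt_one hk hk0
  by_cases hz : jacobiDen k z = 0
  swap
  · exact nhdsWithin_le_nhds ((isOpen_jacobiDen hk hk0).mem_nhds hz)
  obtain ⟨h1, h2⟩ := (jacobiDen_eq_zero_iff hk0).1 hz
  have hs := realSn_sq_add_realCn_sq (k := k) z.re
  have hs' := realSn_sq_add_realCn_sq (k := complModulus k) z.im
  have e1 : ∀ᶠ x in 𝓝[≠] z.re, realSn k x ≠ 0 := by
    refine (hasDerivAt_realSn hk z.re).eventually_ne (mul_ne_zero ?_ (realDn_pos hk _).ne')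
    intro h; simp [h1, h] at hs
  have e2 : ∀ᶠ y in 𝓝[≠] z.im, realCn (complModulus k) y ≠ 0 := by
    refine (hasDerivAt_realCn hk' z.im).eventually_ne
      (neg_ne_zero.2 (mul_ne_zero ?_ (realDn_pos hk' _).ne'))
    intro h; simp [h2, h] at hs'
  rw [eventually_nhdsWithin_iff] at e1 e2 ⊢
  filter_upwards [Complex.continuous_re.continuousAt.eventually e1,
    Complex.continuous_im.continuousAt.eventually e2] with u h1 h2 hu h0
  obtain ⟨h3, h4⟩ := (jacobiDen_eq_zero_iff hk0).1 h0
  refine hu (Complex.ext ?_ ?_)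
  · by_contra h; exact h1 h h3
  · by_contra h; exact h2 h h4

theorem analyticAt_of_isOpen {f : ℂ → ℂ} {U : Set ℂ} (hU : IsOpen U)
    (h : ∀ z ∈ U, DifferentiableAt ℂ f z) {z : ℂ} (hz : z ∈ U) : AnalyticAt ℂ f z :=
  (DifferentiableOn.analyticOnNhd (fun z hz => (h z hz).differentiableWithinAt) hU) z hz

theorem analyticAt_formula (hk : k ^ 2 < 1) (hk0 : k ≠ 0) {z : ℂ} (hz : scDen k z ≠ 0) :
    AnalyticAt ℂ (scFormula k) z ∧ AnalyticAt ℂ (dcFormula k) z :=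
  ⟨analyticAt_of_isOpen (isOpen_scDen hk hk0)
    (fun _ h => (differentiableAt_formula hk hk0 h).1) hz,
   analyticAt_of_isOpen (isOpen_scDen hk hk0)
    (fun _ h => (differentiableAt_formula hk hk0 h).2) hz⟩

theorem eventually_jacobi_div_eq_formula (hk : k ^ 2 < 1) (hk0 : k ≠ 0) {z : ℂ}
    (hz : scDen k z ≠ 0) :
    (fun u => jacobiSn k u / jacobiCn k u) =ᶠ[𝓝[≠] z] scFormula k ∧
      (fun u => jacobiDn k u / jacobiCn k u) =ᶠ[𝓝[≠] z] dcFormula k := by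
  have h : ∀ᶠ u in 𝓝[≠] z, jacobiDen k u ≠ 0 ∧ scDen k u ≠ 0 :=
    (eventually_jacobiDen_ne_zero hk hk0 z).and
      (nhdsWithin_le_nhds ((isOpen_scDen hk hk0).mem_nhds hz))
  exact ⟨h.mono fun u hu => (jacobi_div_eq_formula hk hk0 hu.1 hu.2).1,
    h.mono fun u hu => (jacobi_div_eq_formula hk hk0 hu.1 hu.2).2⟩

theorem jacobi_zero : jacobiSn 0 = Complex.sin ∧ jacobiCn 0 = Complex.cos ∧ jacobiDn 0 = 1 := by
  refine ⟨?_, ?_, ?_⟩ <;> ext u <;> simp [jacobiSn, jacobiCn, jacobiDn]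

theorem meromorphic_jacobi_div (hk : k ^ 2 < 1) :
    Meromorphic (fun u => jacobiSn k u / jacobiCn k u) ∧
      Meromorphic (fun u => jacobiDn k u / jacobiCn k u) := by
  suffices h : ∀ z, MeromorphicAt (fun u => jacobiSn k u / jacobiCn k u) z ∧
      MeromorphicAt (fun u => jacobiDn k u / jacobiCn k u) z from
    ⟨fun z => (h z).1, fun z => (h z).2⟩
  intro z
  by_cases hk0 : k = 0
  · subst hk0
    obtain ⟨h1, h2, h3⟩ := jacobi_zero
    rw [h1, h2, h3]
    have hs : AnalyticAt ℂ Complex.sin z := Complex.analyticAt_sin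
    have hc : AnalyticAt ℂ Complex.cos z := Complex.analyticAt_cos
    exact ⟨hs.meromorphicAt.div hc.meromorphicAt,
      (MeromorphicAt.const 1 z).div hc.meromorphicAt⟩
  by_cases hz : jacobiDen k z = 0
  -- At a zero of `jacobiDen`, `scDen` equals `1`. The explicit formulas therefore continue the two
  -- quotients analytically across such points.
  · have hz2 : scDen k z ≠ 0 := by
      rw [scDen_eq hk hk0, ((jacobiDen_eq_zero_iff hk0).1 hz).1]; simp
    obtain ⟨h1, h2⟩ := eventually_jacobi_div_eq_formula hk hk0 hz2
    obtain ⟨h3, h4⟩ := analyticAt_formula hk hk0 hz2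
    exact ⟨h3.meromorphicAt.congr h1.symm, h4.meromorphicAt.congr h2.symm⟩
  · have hD := isOpen_jacobiDen hk hk0
    have h1 := analyticAt_of_isOpen hD (fun _ h => (differentiableAt_jacobi hk hk0 h).1) hz
    have h2 := analyticAt_of_isOpen hD (fun _ h => (differentiableAt_jacobi hk hk0 h).2.1) hz
    have h3 := analyticAt_of_isOpen hD (fun _ h => (differentiableAt_jacobi hk hk0 h).2.2) hz
    exact ⟨h1.meromorphicAt.div h2.meromorphicAt, h3.meromorphicAt.div h2.meromorphicAt⟩

theorem meromorphic_jacobiSc : Meromorphic (jacobiSc k) := fun z =>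
  (meromorphicNFOn_toMeromorphicNFOn _ univ (mem_univ z)).meromorphicAt

theorem jacobiSc_eventuallyEq_formula (hk : k ^ 2 < 1) (hk0 : k ≠ 0) {z : ℂ}
    (hz : scDen k z ≠ 0) : jacobiSc k =ᶠ[𝓝 z] scFormula k :=
  toMeromorphicNFOn_eventuallyEq_of_analyticAt (meromorphic_jacobi_div hk).1
    (analyticAt_formula hk hk0 hz).1 (eventually_jacobi_div_eq_formula hk hk0 hz).1

theorem jacobiDc_eventuallyEq_formula (hk : k ^ 2 < 1) (hk0 : k ≠ 0) {z : ℂ}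
    (hz : scDen k z ≠ 0) : jacobiDc k =ᶠ[𝓝 z] dcFormula k :=
  toMeromorphicNFOn_eventuallyEq_of_analyticAt (meromorphic_jacobi_div hk).2
    (analyticAt_formula hk hk0 hz).2 (eventually_jacobi_div_eq_formula hk hk0 hz).2

theorem jacobiSc_zero_eventuallyEq {z : ℂ} (hz : Complex.cos z ≠ 0) :
    jacobiSc 0 =ᶠ[𝓝 z] Complex.tan := by
  obtain ⟨h1, h2, h3⟩ := jacobi_zero
  refine toMeromorphicNFOn_eventuallyEq_of_analyticAt
    (meromorphic_jacobi_div (by norm_num)).1 ?_ (Eventually.of_forall fun u => ?_)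
  · exact analyticAt_of_isOpen (isOpen_ne_fun Complex.continuous_cos continuous_const)
      (fun _ h => Complex.differentiableAt_tan.2 h) hz
  · rw [h1, h2, Complex.tan]

theorem jacobiDc_zero_eventuallyEq {z : ℂ} (hz : Complex.cos z ≠ 0) :
    jacobiDc 0 =ᶠ[𝓝 z] fun u => 1 / Complex.cos u := by
  obtain ⟨h1, h2, h3⟩ := jacobi_zero
  refine toMeromorphicNFOn_eventuallyEq_of_analyticAt
    (meromorphic_jacobi_div (by norm_num)).2 ?_ (Eventually.of_forall fun u => ?_)
  · exact analyticAt_const.div Complex.analyticAt_cos hz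
  · simp [h3, h2]

/-! ## The values of `sc` off the lines of poles -/

/-- The imaginary parts of the zeros and of the poles of `sc`. -/
def scBadIm (k : ℝ) : Set ℝ := {y | if k = 0 then y = 0 else realSn (complModulus k) y = 0}

theorem isClosed_scBadIm (hk : k ^ 2 < 1) : IsClosed (scBadIm k) := by
  by_cases hk0 : k = 0
  · simp only [scBadIm, hk0, if_true, ofPred_eq_eq_singleton]
    exact isClosed_singleton
  · simp only [scBadIm, hk0, if_false]
    exact isClosed_eq (continuous_realSn (complModulus_sq_lt_one hk hk0)) continuous_const

theorem mem_scBadIm_iff (hk : k ^ 2 < 1) (hk0 : k ≠ 0) {y : ℝ} :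
    y ∈ scBadIm k ↔ ∃ n : ℤ, n * (2 * ellipticK (complModulus k)) = y := by
  simp only [scBadIm, hk0, if_false, mem_ofPred_eq]
  exact realSn_eq_zero_iff (complModulus_sq_lt_one hk hk0)

theorem countable_scBadIm (hk : k ^ 2 < 1) : (scBadIm k).Countable := by
  by_cases hk0 : k = 0
  · simp [scBadIm, hk0]
  · refine (countable_range fun n : ℤ => n * (2 * ellipticK (complModulus k))).mono fun y hy => ?_
    exact (mem_scBadIm_iff hk hk0).1 hy

/-- A domain on which `sc` is analytic. -/
def scDomain (k : ℝ) : Set ℂ := {u | u.im ∉ scBadIm k ∨ |u.re| < ellipticK k}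

theorem zero_mem_scDomain (hk : k ^ 2 < 1) : 0 ∈ scDomain k :=
  Or.inr (by simpa using ellipticK_pos hk)

/-- Each point is reached from `0` along the imaginary axis, which lies in the strip `|Re| < K`, and
then along a horizontal segment, which stays in the domain for either of the two reasons of
membership. -/
theorem isPreconnected_scDomain (hk : k ^ 2 < 1) : IsPreconnected (scDomain k) := by
  refine isPreconnected_of_forall 0 fun u hu => ⟨(fun t : ℝ => (t * u.im : ℂ) * Complex.I) '' univ ∪
    (fun t : ℝ => ((t * u.re : ℝ) : ℂ) + u.im * Complex.I) '' Icc 0 1, ?_, ?_, ?_, ?_⟩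
  · rintro _ (⟨t, -, rfl⟩ | ⟨t, ht, rfl⟩)
    · exact Or.inr (by simpa using ellipticK_pos hk)
    · rcases hu with h | h
      · exact Or.inl (by simpa using h)
      · refine Or.inr ?_
        have : |t * u.re| ≤ |u.re| := by
          rw [abs_mul, abs_of_nonneg ht.1]
          exact mul_le_of_le_one_left (abs_nonneg _) ht.2
        simpa using this.trans_lt h
  · exact Or.inl ⟨0, mem_univ _, by simp⟩
  · exact Or.inr ⟨1, by simp, by simp [Complex.re_add_im]⟩
  · refine IsPreconnected.union (u.im * Complex.I) ⟨1, mem_univ _, by simp⟩ ⟨0, by simp, by simp⟩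
      (isPreconnected_univ.image _ (by fun_prop)) (isPreconnected_Icc.image _ (by fun_prop))

/-- `scDen` is a sum of two nonnegative terms. It vanishes only if `cn(x|k) = 0`, whence `sn(x|k)² =
1`, and then `sn(y|k') = 0` as well. -/
theorem scDen_ne_zero (hk : k ^ 2 < 1) (hk0 : k ≠ 0) {u : ℂ} (hu : u ∈ scDomain k) :
    scDen k u ≠ 0 := by
  have hk' := complModulus_pos hk
  have h := realSn_sq_add_realCn_sq (k := k) u.re
  rcases hu with hu | hu
  · simp only [scBadIm, hk0, if_false, mem_ofPred_eq] at hu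
    intro h0
    have h1 : 0 < complModulus k ^ 2 * realSn (complModulus k) u.im ^ 2 := by positivity
    simp only [scDen] at h0
    have h2 : realCn k u.re ^ 2 = 0 := by
      nlinarith [sq_nonneg (realCn k u.re), sq_nonneg (realSn k u.re)]
    have h3 : realSn k u.re ^ 2 = 1 := by linarith
    rw [h2, h3] at h0
    linarith
  · have := realCn_pos hk hu
    unfold scDen
    positivity

theorem ellipticF_zero_modulus (φ : ℝ) : ellipticF 0 φ = φ := by simp [ellipticF]

theorem amplitude_zero_modulus (x : ℝ) : amplitude 0 x = x := by
  have := amplitude_ellipticF (k := 0) (by norm_num) x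
  rwa [ellipticF_zero_modulus] at this

theorem ellipticK_zero_modulus : ellipticK 0 = π / 2 := ellipticF_zero_modulus _

theorem ellipticE_zero_modulus : ellipticE 0 = π / 2 := by simp [ellipticE]

theorem cos_ne_zero_of_mem_scDomain {u : ℂ} (hu : u ∈ scDomain 0) : Complex.cos u ≠ 0 := by
  intro h
  obtain ⟨n, hn⟩ := Complex.cos_eq_zero_iff.1 h
  have hn' : u = (((2 * n + 1) * π / 2 : ℝ) : ℂ) := by rw [hn]; push_cast; rfl
  rcases hu with hu | hu
  · apply hu
    simp [scBadIm, hn']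
  · rw [hn', Complex.ofReal_re, ellipticK_zero_modulus, abs_lt] at hu
    have h1 : (-1 : ℝ) < 2 * n + 1 := by nlinarith [Real.pi_pos]
    have h2 : (2 * n + 1 : ℝ) < 1 := by nlinarith [Real.pi_pos]
    norm_cast at h1 h2
    omega

theorem analyticAt_jacobiSc (hk : k ^ 2 < 1) {u : ℂ} (hu : u ∈ scDomain k) :
    AnalyticAt ℂ (jacobiSc k) u := by
  by_cases hk0 : k = 0
  · subst hk0
    refine AnalyticAt.congr ?_ (jacobiSc_zero_eventuallyEq (cos_ne_zero_of_mem_scDomain hu)).symm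
    exact analyticAt_of_isOpen (isOpen_ne_fun Complex.continuous_cos continuous_const)
      (fun _ h => Complex.differentiableAt_tan.2 h) (cos_ne_zero_of_mem_scDomain hu)
  · have h := scDen_ne_zero hk hk0 hu
    exact (analyticAt_formula hk hk0 h).1.congr (jacobiSc_eventuallyEq_formula hk hk0 h).symm

theorem ofReal_mem_scDomain {x : ℝ} (hx : |x| < ellipticK k) : (x : ℂ) ∈ scDomain k :=
  Or.inr (by simpa using hx)

theorem jacobiSc_ofReal (hk : k ^ 2 < 1) {x : ℝ} (hx : |x| < ellipticK k) :
    jacobiSc k x = ((realSn k x / realCn k x : ℝ) : ℂ) := by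
  have hu := ofReal_mem_scDomain hx
  by_cases hk0 : k = 0
  · subst hk0
    rw [(jacobiSc_zero_eventuallyEq (cos_ne_zero_of_mem_scDomain hu)).self_of_nhds]
    simp [realSn, realCn, amplitude_zero_modulus, Complex.tan]
  · have hk' := complModulus_sq_lt_one hk hk0
    have hc : (realCn k x : ℂ) ≠ 0 := Complex.ofReal_ne_zero.2 (realCn_pos hk hx).ne'
    rw [(jacobiSc_eventuallyEq_formula hk hk0 (scDen_ne_zero hk hk0 hu)).self_of_nhds]
    simp [scFormula, scDen, realSn_zero hk', realCn_zero hk', realDn_zero hk']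
    field_simp

theorem jacobiDc_ofReal (hk : k ^ 2 < 1) {x : ℝ} (hx : |x| < ellipticK k) :
    jacobiDc k x = ((realDn k x / realCn k x : ℝ) : ℂ) := by
  have hu := ofReal_mem_scDomain hx
  by_cases hk0 : k = 0
  · subst hk0
    rw [(jacobiDc_zero_eventuallyEq (cos_ne_zero_of_mem_scDomain hu)).self_of_nhds]
    simp [realDn, realCn, amplitude_zero_modulus]
  · have hk' := complModulus_sq_lt_one hk hk0
    have hc : (realCn k x : ℂ) ≠ 0 := Complex.ofReal_ne_zero.2 (realCn_pos hk hx).ne'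
    rw [(jacobiDc_eventuallyEq_formula hk hk0 (scDen_ne_zero hk hk0 hu)).self_of_nhds]
    simp [dcFormula, scDen, realSn_zero hk', realCn_zero hk', realDn_zero hk']
    field_simp

/-- For `k = 0` the zeros of the sine are real. Otherwise the imaginary part `dn(x|k) sn(y|k')` of
the numerator is nonzero off the excluded lines. -/
theorem jacobiSc_ne_zero (hk : k ^ 2 < 1) {u : ℂ} (hu : u.im ∉ scBadIm k) : jacobiSc k u ≠ 0 := by
  have hu' : u ∈ scDomain k := Or.inl hu
  by_cases hk0 : k = 0
  · subst hk0
    have hc := cos_ne_zero_of_mem_scDomain hu'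
    rw [(jacobiSc_zero_eventuallyEq hc).self_of_nhds, Complex.tan]
    refine div_ne_zero (fun h => hu ?_) hc
    obtain ⟨n, hn⟩ := Complex.sin_eq_zero_iff.1 h
    simp [scBadIm, hn]
  · have hD := scDen_ne_zero hk hk0 hu'
    rw [(jacobiSc_eventuallyEq_formula hk hk0 hD).self_of_nhds, scFormula]
    refine div_ne_zero (fun h => ?_) (Complex.ofReal_ne_zero.2 hD)
    have := congrArg Complex.im h
    simp [-Complex.ofReal_mul] at this
    simp only [scBadIm, hk0, if_false, mem_ofPred_eq] at hu
    exact this.elim (realDn_pos hk _).ne' hu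

theorem scFormula_add (hk : k ^ 2 < 1) (hk0 : k ≠ 0) (u : ℂ) :
    scFormula k (u + 2 * Complex.I * ellipticK (complModulus k)) = -scFormula k u := by
  have hk' := complModulus_sq_lt_one hk hk0
  simp [scFormula, scDen, realSn_add hk', realCn_add hk', realDn_add hk']
  ring

theorem add_mem_scBadIm_iff (hk : k ^ 2 < 1) (hk0 : k ≠ 0) {y : ℝ} :
    y + 2 * ellipticK (complModulus k) ∈ scBadIm k ↔ y ∈ scBadIm k := by
  have hk' := complModulus_sq_lt_one hk hk0
  simp only [scBadIm, hk0, if_false, mem_ofPred_eq, realSn_add hk', neg_eq_zero]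

theorem jacobiSc_add_imaginary (hk : k ^ 2 < 1) (hk0 : k ≠ 0) {u : ℂ} (hu : u.im ∉ scBadIm k) :
    jacobiSc k (u + 2 * Complex.I * ellipticK (complModulus k)) = -jacobiSc k u := by
  have hu' : u + 2 * Complex.I * ellipticK (complModulus k) ∈ scDomain k :=
    Or.inl (by simpa [add_mem_scBadIm_iff hk hk0] using hu)
  rw [(jacobiSc_eventuallyEq_formula hk hk0 (scDen_ne_zero hk hk0 hu')).self_of_nhds,
    (jacobiSc_eventuallyEq_formula hk hk0 (scDen_ne_zero hk hk0 (Or.inl hu))).self_of_nhds,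
    scFormula_add hk hk0]

end ComplexJacobi

/-! ### The differential equation and the addition theorem for `sc`. -/

section Addition

variable {k : ℝ}

theorem hasDerivAt_jacobiSc (hk : k ^ 2 < 1) {u : ℂ} (hu : u ∈ scDomain k) :
    HasDerivAt (jacobiSc k) (deriv (jacobiSc k) u) u :=
  (analyticAt_jacobiSc hk hu).differentiableAt.hasDerivAt

theorem hasDerivAt_deriv_jacobiSc (hk : k ^ 2 < 1) {u : ℂ} (hu : u ∈ scDomain k) :
    HasDerivAt (deriv (jacobiSc k)) (deriv (deriv (jacobiSc k)) u) u :=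
  (analyticAt_jacobiSc hk hu).deriv.differentiableAt.hasDerivAt

theorem eventually_abs_lt {K x : ℝ} (hx : |x| < K) : ∀ᶠ y in 𝓝 x, |y| < K :=
  (isOpen_lt continuous_abs continuous_const).mem_nhds hx

theorem deriv_jacobiSc_ofReal (hk : k ^ 2 < 1) {x : ℝ} (hx : |x| < ellipticK k) :
    deriv (jacobiSc k) x = ((realDn k x / realCn k x ^ 2 : ℝ) : ℂ) := by
  have h1 := (hasDerivAt_jacobiSc hk (ofReal_mem_scDomain hx)).comp_ofReal
  have hc := (realCn_pos hk hx).ne'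
  have h2 := ((hasDerivAt_realSn hk x).div (hasDerivAt_realCn hk x) hc).ofReal_comp
  have h3 : (fun y : ℝ => jacobiSc k y) =ᶠ[𝓝 x] fun y =>
      (((realSn k / realCn k) y : ℝ) : ℂ) :=
    (eventually_abs_lt hx).mono fun y hy => jacobiSc_ofReal hk hy
  rw [(h1.congr_of_eventuallyEq h3.symm).unique h2]
  congr 1
  have := realCn_sq (k := k) x
  field_simp
  linear_combination realDn k x * this

theorem deriv_deriv_jacobiSc_ofReal (hk : k ^ 2 < 1) {x : ℝ} (hx : |x| < ellipticK k) :
    deriv (deriv (jacobiSc k)) x = (((2 * realDn k x ^ 2 - k ^ 2 * realCn k x ^ 2) * realSn k x /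
      realCn k x ^ 3 : ℝ) : ℂ) := by
  have h1 := (hasDerivAt_deriv_jacobiSc hk (ofReal_mem_scDomain hx)).comp_ofReal
  have hc := (realCn_pos hk hx).ne'
  have h2 := ((hasDerivAt_realDn hk x).div ((hasDerivAt_realCn hk x).pow 2)
    (pow_ne_zero 2 hc)).ofReal_comp
  have h3 : (fun y : ℝ => deriv (jacobiSc k) y) =ᶠ[𝓝 x] fun y =>
      (((realDn k / realCn k ^ 2) y : ℝ) : ℂ) :=
    (eventually_abs_lt hx).mono fun y hy => deriv_jacobiSc_ofReal hk hy
  rw [(h1.congr_of_eventuallyEq h3.symm).unique h2]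
  congr 1
  simp only [Pi.pow_apply]
  field_simp
  push_cast
  ring

theorem frequently_ofReal {p : ℂ → Prop} (h : ∀ᶠ x : ℝ in 𝓝 0, p x) : ∃ᶠ z in 𝓝[≠] (0 : ℂ), p z := by
  have ht : Tendsto (fun x : ℝ => (x : ℂ)) (𝓝[≠] 0) (𝓝[≠] 0) := by
    refine tendsto_nhdsWithin_of_tendsto_nhds_of_eventually_within _ ?_ ?_
    · have : Tendsto (fun x : ℝ => (x : ℂ)) (𝓝 0) (𝓝 ((0 : ℝ) : ℂ)) :=
        Complex.continuous_ofReal.continuousAt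
      exact this.mono_left nhdsWithin_le_nhds
    · filter_upwards [self_mem_nhdsWithin] with x hx
      simpa using hx
  exact ht.frequently (Eventually.frequently (nhdsWithin_le_nhds h))

/-- The differential equation satisfied by `sc`. -/
theorem jacobiSc_ode (hk : k ^ 2 < 1) {u : ℂ} (hu : u ∈ scDomain k) :
    deriv (jacobiSc k) u ^ 2 =
      (1 + jacobiSc k u ^ 2) * (1 + complModulus k ^ 2 * jacobiSc k u ^ 2) ∧
    deriv (deriv (jacobiSc k)) u = (1 + complModulus k ^ 2) * jacobiSc k u +
      2 * complModulus k ^ 2 * jacobiSc k u ^ 3 := by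
  have ha : AnalyticOnNhd ℂ (jacobiSc k) (scDomain k) := fun u hu => analyticAt_jacobiSc hk hu
  have hev : ∀ᶠ x : ℝ in 𝓝 0, |x| < ellipticK k :=
    eventually_abs_lt (by simpa using ellipticK_pos hk)
  have rk := complModulus_sq hk
  constructor
  -- By the identity theorem on the connected set `scDomain k`, it suffices to check real points
  -- near `0`, where `sc = sn/cn`. The second equation is treated in the same way.
  · refine (ha.deriv.pow 2).eqOn_of_preconnected_of_frequently_eq
      ((analyticOnNhd_const.add (ha.pow 2)).mul
        (analyticOnNhd_const.add (analyticOnNhd_const.mul (ha.pow 2))))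
      (isPreconnected_scDomain hk) (zero_mem_scDomain hk)
      (frequently_ofReal (hev.mono fun x hx => ?_)) hu
    have hc := realCn_pos hk hx
    have rd := realDn_sq hk x
    have rc := realCn_sq (k := k) x
    change deriv (jacobiSc k) x ^ 2 =
      (1 + jacobiSc k x ^ 2) * (1 + complModulus k ^ 2 * jacobiSc k x ^ 2)
    rw [deriv_jacobiSc_ofReal hk hx, jacobiSc_ofReal hk hx]
    norm_cast
    rw [rk]
    field_simp
    grind
  · refine ha.deriv.deriv.eqOn_of_preconnected_of_frequently_eq
      ((analyticOnNhd_const.mul ha).add (analyticOnNhd_const.mul (ha.pow 3)))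
      (isPreconnected_scDomain hk) (zero_mem_scDomain hk)
      (frequently_ofReal (hev.mono fun x hx => ?_)) hu
    have hc := realCn_pos hk hx
    have rd := realDn_sq hk x
    have rc := realCn_sq (k := k) x
    change deriv (deriv (jacobiSc k)) x = (1 + complModulus k ^ 2) * jacobiSc k x +
      2 * complModulus k ^ 2 * jacobiSc k x ^ 3
    rw [deriv_deriv_jacobiSc_ofReal hk hx, jacobiSc_ofReal hk hx]
    norm_cast
    rw [rk]
    field_simp
    grind

theorem jacobiSc_zero (hk : k ^ 2 < 1) : jacobiSc k 0 = 0 := by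
  have := jacobiSc_ofReal hk (x := 0) (by simpa using ellipticK_pos hk)
  simpa [realSn_zero hk] using this

theorem deriv_jacobiSc_zero (hk : k ^ 2 < 1) : deriv (jacobiSc k) 0 = 1 := by
  have := deriv_jacobiSc_ofReal hk (x := 0) (by simpa using ellipticK_pos hk)
  simpa [realDn_zero hk, realCn_zero hk] using this

/-- The addition theorem for `sc`, in subtraction form. -/
theorem jacobiSc_addition (hk : k ^ 2 < 1) {a : ℂ} (ha : a.im ∉ scBadIm k) {x : ℝ}
    (hx : |x| < ellipticK k) :
    jacobiSc k a * (jacobiSc k x * deriv (jacobiSc k) (a - x) -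
      deriv (jacobiSc k) x * jacobiSc k (a - x)) = jacobiSc k x ^ 2 - jacobiSc k (a - x) ^ 2 := by
  set f := jacobiSc k with hf
  set T := f a
  obtain ⟨δ, hδ, hball⟩ := Metric.isOpen_iff.1 (isClosed_scBadIm hk).isOpen_compl _ ha
  -- `Ω` is a convex rectangle: its width keeps `z` in the strip `|Re| < K`, and its height keeps `a
  -- - z` away from the excluded horizontal lines.
  set Ω : Set ℂ := {z | |z.re| < ellipticK k} ∩ {z | |z.im| < δ} with hΩ
  have hΩo : IsOpen Ω := (isOpen_lt (continuous_abs.comp Complex.continuous_re)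
    continuous_const).inter (isOpen_lt (continuous_abs.comp Complex.continuous_im) continuous_const)
  have hΩc : IsPreconnected Ω := by
    have h1 : Convex ℝ {z : ℂ | |z.re| < ellipticK k} := by
      rw [show {z : ℂ | |z.re| < ellipticK k} = Complex.reLm ⁻¹' Metric.ball 0 (ellipticK k) from by
        ext z; simp]
      exact (convex_ball (0 : ℝ) (ellipticK k)).linear_preimage Complex.reLm
    have h2 : Convex ℝ {z : ℂ | |z.im| < δ} := by
      rw [show {z : ℂ | |z.im| < δ} = Complex.imLm ⁻¹' Metric.ball 0 δ from by
        ext z; simp]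
      exact (convex_ball (0 : ℝ) δ).linear_preimage Complex.imLm
    exact (h1.inter h2).isPreconnected
  have h0 : (0 : ℂ) ∈ Ω := ⟨by simpa using ellipticK_pos hk, by simpa using hδ⟩
  have hd1 : ∀ z ∈ Ω, z ∈ scDomain k := fun z hz => Or.inr hz.1
  have hd2 : ∀ z ∈ Ω, a - z ∈ scDomain k := fun z hz => Or.inl (hball (by
    have := hz.2
    simpa [Real.dist_eq, abs_sub_comm] using this))
  have hs : ∀ z, HasDerivAt (fun z => a - z) (-1) z := fun z => (hasDerivAt_id z).const_sub a
  have e1 : ∀ z ∈ Ω, HasDerivAt f (deriv f z) z := fun z hz => hasDerivAt_jacobiSc hk (hd1 z hz)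
  have e2 : ∀ z ∈ Ω, HasDerivAt (deriv f) (deriv (deriv f) z) z := fun z hz =>
    hasDerivAt_deriv_jacobiSc hk (hd1 z hz)
  have e3 : ∀ z ∈ Ω, HasDerivAt (fun z => f (a - z)) (deriv f (a - z) * -1) z := fun z hz =>
    (hasDerivAt_jacobiSc hk (hd2 z hz)).comp z (hs z)
  have e4 : ∀ z ∈ Ω, HasDerivAt (fun z => deriv f (a - z)) (deriv (deriv f) (a - z) * -1) z :=
    fun z hz => (hasDerivAt_deriv_jacobiSc hk (hd2 z hz)).comp z (hs z)
  set M : ℂ → ℂ := fun z => f z * deriv f (a - z) - deriv f z * f (a - z) with hM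
  set N : ℂ → ℂ := fun z => f z ^ 2 - f (a - z) ^ 2 with hN
  have dM : ∀ z ∈ Ω, HasDerivAt M (2 * deriv f z * deriv f (a - z) -
      f z * deriv (deriv f) (a - z) - deriv (deriv f) z * f (a - z)) z := fun z hz =>
    (((e1 z hz).mul (e4 z hz)).sub ((e2 z hz).mul (e3 z hz))).congr_deriv (by ring)
  have dN : ∀ z ∈ Ω, HasDerivAt N (2 * f z * deriv f z + 2 * f (a - z) * deriv f (a - z)) z :=
    fun z hz => (((e1 z hz).pow 2).sub ((e3 z hz).pow 2)).congr_deriv (by push_cast; ring)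
  -- Euler's method: the differential equation gives `N' M = N M'`, so `N / M` is constant where `M
  -- ≠ 0`. At `z = 0` the values are `N = -T²` and `M = -T`, so the constant is `T`. Thus `Q`
  -- vanishes near `0`, and then on all of `Ω` by the identity theorem.
  set Q : ℂ → ℂ := fun z => T * M z - N z with hQ
  have dQ : ∀ z ∈ Ω, HasDerivAt Q _ z := fun z hz => ((dM z hz).const_mul T).sub (dN z hz)
  have hM0 : M 0 ≠ 0 := by
    simp only [hM, hf, jacobiSc_zero hk, deriv_jacobiSc_zero hk, sub_zero, zero_mul, one_mul,
      zero_sub, neg_ne_zero]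
    exact jacobiSc_ne_zero hk ha
  have hQ0 : Q 0 = 0 := by
    simp only [hQ, hM, hN, hf, jacobiSc_zero hk, deriv_jacobiSc_zero hk, sub_zero, zero_mul,
      one_mul, zero_sub, T]
    ring
  have hMe : ∀ᶠ z in 𝓝 0, z ∈ Ω ∧ M z ≠ 0 :=
    (show ∀ᶠ z in 𝓝 0, z ∈ Ω from hΩo.mem_nhds h0).and ((dM 0 h0).continuousAt.eventually_ne hM0)
  obtain ⟨ε, hε, hεb⟩ := Metric.eventually_nhds_iff_ball.1 hMe
  have hQz : ∀ z ∈ Metric.ball (0 : ℂ) ε, Q z / M z = Q 0 / M 0 := by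
    intro z hz
    refine Metric.isOpen_ball.is_const_of_deriv_eq_zero (f := fun z => Q z / M z)
      (convex_ball (0 : ℂ) ε).isPreconnected (fun z hz => ?_) (fun z hz => ?_) hz
      (Metric.mem_ball_self hε)
    · obtain ⟨h1, h2⟩ := hεb z hz
      exact ((dQ z h1).div (dM z h1) h2).differentiableAt.differentiableWithinAt
    · obtain ⟨h1, h2⟩ := hεb z hz
      change deriv (Q / M) z = 0
      rw [((dQ z h1).div (dM z h1) h2).deriv]
      refine div_eq_zero_iff.2 (Or.inl ?_)
      obtain ⟨o1, o2⟩ := jacobiSc_ode hk (hd1 z h1)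
      obtain ⟨o3, o4⟩ := jacobiSc_ode hk (hd2 z h1)
      simp only [hQ, hM, hN]
      change deriv f z ^ 2 = (1 + f z ^ 2) * (1 + (complModulus k : ℂ) ^ 2 * f z ^ 2) at o1
      change deriv f (a - z) ^ 2 =
        (1 + f (a - z) ^ 2) * (1 + (complModulus k : ℂ) ^ 2 * f (a - z) ^ 2) at o3
      rw [hf, o2, o4, ← hf]
      clear_value f T
      clear hQ hM hN dQ dM dN e1 e2 e3 e4 hd1 hd2 hs h0 hM0 hQ0 hMe hεb hball
      grind
  have hQa : AnalyticOnNhd ℂ Q Ω := DifferentiableOn.analyticOnNhd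
    (fun z hz => (dQ z hz).differentiableAt.differentiableWithinAt) hΩo
  have hev : Q =ᶠ[𝓝 0] 0 := by
    filter_upwards [Metric.ball_mem_nhds (0 : ℂ) hε] with z hz
    have := hQz z hz
    rw [hQ0, zero_div, div_eq_zero_iff] at this
    exact this.resolve_right (hεb z hz).2
  have hxΩ : (x : ℂ) ∈ Ω := ⟨by simpa using hx, by simpa using hδ⟩
  have := hQa.eqOn_zero_of_preconnected_of_eventuallyEq_zero hΩc h0 hev hxΩ
  exact sub_eq_zero.1 this

/-- `sc (u + K) = -1 / (k' sc u)`. -/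
theorem jacobiSc_mul_jacobiSc_sub (hk : k ^ 2 < 1) {a : ℂ} (ha : a.im ∉ scBadIm k) :
    complModulus k * jacobiSc k a * jacobiSc k (a - ellipticK k) = -1 := by
  have hK := ellipticK_pos hk
  -- `L` and `R` are the two sides of the addition theorem multiplied by `cn(x)²`. This removes the
  -- pole at `x = K`, so the equality passes to the limit there, where `sn = 1`, `cn = 0` and `dn =
  -- k'`.
  set L : ℝ → ℂ := fun x => jacobiSc k a * (realSn k x * realCn k x * deriv (jacobiSc k) (a - x) -
      realDn k x * jacobiSc k (a - x)) with hL
  set R : ℝ → ℂ := fun x => realSn k x ^ 2 - realCn k x ^ 2 * jacobiSc k (a - x) ^ 2 with hR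
  have hmem : ∀ x : ℝ, a - x ∈ scDomain k := fun x => Or.inl (by simpa using ha)
  have hc1 : Continuous fun x : ℝ => jacobiSc k (a - x) := continuous_iff_continuousAt.2 fun x =>
    ContinuousAt.comp (f := fun x : ℝ => a - (x : ℂ)) (analyticAt_jacobiSc hk (hmem x)).continuousAt
      (by fun_prop)
  have hc2 : Continuous fun x : ℝ => deriv (jacobiSc k) (a - x) :=
    continuous_iff_continuousAt.2 fun x =>
    ContinuousAt.comp (f := fun x : ℝ => a - (x : ℂ))
      (analyticAt_jacobiSc hk (hmem x)).deriv.continuousAt (by fun_prop)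
  have h1 := continuous_realSn hk
  have h2 := continuous_realCn hk
  have h3 := continuous_realDn hk
  have hLc : Continuous L := by fun_prop
  have hRc : Continuous R := by fun_prop
  have heq : ∀ x ∈ Ioo (-ellipticK k) (ellipticK k), L x = R x := fun x hx => by
    have hx' := abs_lt.2 hx
    have hc : (realCn k x : ℂ) ≠ 0 := Complex.ofReal_ne_zero.2 (realCn_pos hk hx').ne'
    have h := jacobiSc_addition hk ha hx'
    rw [jacobiSc_ofReal hk hx', deriv_jacobiSc_ofReal hk hx'] at h
    push_cast at h
    field_simp at h
    simp only [hL, hR]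
    linear_combination h
  have hcl : EqOn L R (closure (Ioo (-ellipticK k) (ellipticK k))) :=
    (show EqOn L R (Ioo (-ellipticK k) (ellipticK k)) from heq).closure hLc hRc
  rw [closure_Ioo (by linarith)] at hcl
  have h := hcl (right_mem_Icc.2 (by linarith))
  have hd : realDn k (ellipticK k) = complModulus k := by
    simp [realDn, realSn_ellipticK hk, complModulus]
  simp only [hL, hR, realSn_ellipticK hk, realCn_ellipticK hk, hd] at h
  push_cast at h
  linear_combination -h

theorem jacobiSc_add_two_mul (hk : k ^ 2 < 1) {u : ℂ} (hu : u.im ∉ scBadIm k) :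
    jacobiSc k (u + 2 * ellipticK k) = jacobiSc k u := by
  have h1 := jacobiSc_mul_jacobiSc_sub hk (a := u + ellipticK k) (by simpa using hu)
  have h2 := jacobiSc_mul_jacobiSc_sub hk (a := u + 2 * ellipticK k) (by simpa using hu)
  rw [add_sub_cancel_right] at h1
  rw [show u + 2 * (ellipticK k : ℂ) - ellipticK k = u + ellipticK k by ring] at h2
  have h3 : jacobiSc k (u + ellipticK k) ≠ 0 := jacobiSc_ne_zero hk (by simpa using hu)
  have h4 : (complModulus k : ℂ) ≠ 0 := Complex.ofReal_ne_zero.2 (complModulus_pos hk).ne'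
  refine mul_left_cancel₀ (mul_ne_zero h4 h3) ?_
  linear_combination h2 - h1

end Addition

/-! ### The integral of `dc²` and the addition theorem for `A`. -/

section Integrals

variable {k : ℝ}

/-- `dc² = 1 + k'² sc²`, expressed through `sc`. -/
noncomputable def dcSq (k : ℝ) (u : ℂ) : ℂ := 1 + complModulus k ^ 2 * jacobiSc k u ^ 2

theorem analyticAt_dcSq (hk : k ^ 2 < 1) {u : ℂ} (hu : u ∈ scDomain k) :
    AnalyticAt ℂ (dcSq k) u :=
  analyticAt_const.add (analyticAt_const.mul ((analyticAt_jacobiSc hk hu).pow 2))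

theorem jacobiDc_sq_ofReal (hk : k ^ 2 < 1) {x : ℝ} (hx : |x| < ellipticK k) :
    jacobiDc k x ^ 2 = dcSq k x := by
  rw [dcSq, jacobiDc_ofReal hk hx, jacobiSc_ofReal hk hx]
  have hc := (realCn_pos hk hx).ne'
  have rd := realDn_sq hk x
  have rc := realCn_sq (k := k) x
  have rk := complModulus_sq hk
  norm_cast
  rw [rk]
  field_simp
  grind

theorem integralDcSq_ofReal (hk : k ^ 2 < 1) {x : ℝ} (hx : |x| < ellipticK k) :
    integralDcSq k x = ∫ s in (0 : ℝ)..x, dcSq k s := by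
  have h : integralDcSq k x = ∫ t in (0 : ℝ)..1, dcSq k ((x * t : ℝ) : ℂ) * x := by
    refine intervalIntegral.integral_congr fun t ht => ?_
    rw [uIcc_of_le zero_le_one] at ht
    have : |x * t| < ellipticK k := by
      rw [abs_mul, abs_of_nonneg ht.1]
      exact (mul_le_of_le_one_right (abs_nonneg _) ht.2).trans_lt hx
    rw [← jacobiDc_sq_ofReal hk this]
    push_cast
    rw [mul_comm (t : ℂ)]
  have h2 := intervalIntegral.smul_integral_comp_mul_left (a := 0) (b := 1)
    (fun s : ℝ => dcSq k s) x
  rw [h, intervalIntegral.integral_mul_const, mul_comm]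
  simpa using h2

theorem continuousOn_dcSq_real (hk : k ^ 2 < 1) :
    ContinuousOn (fun s : ℝ => dcSq k s) {s | |s| < ellipticK k} := fun _ hs =>
  (ContinuousAt.comp (f := fun s : ℝ => (s : ℂ))
    (analyticAt_dcSq hk (ofReal_mem_scDomain hs)).continuousAt
    Complex.continuous_ofReal.continuousAt).continuousWithinAt

theorem continuous_dcSq_sub (hk : k ^ 2 < 1) {a : ℂ} (ha : a.im ∉ scBadIm k) :
    Continuous fun s : ℝ => dcSq k (a - s) := continuous_iff_continuousAt.2 fun s =>
  ContinuousAt.comp (f := fun s : ℝ => a - (s : ℂ))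
    (analyticAt_dcSq hk (Or.inl (by simpa using ha))).continuousAt (by fun_prop)

/-- The addition theorem for the function `A`. -/
theorem ellipticA_add (hk : k ^ 2 < 1) {a : ℂ} (ha : a.im ∉ scBadIm k) {x : ℝ} (hx0 : 0 ≤ x)
    (hx : x < ellipticK k) :
    ellipticA k x + complModulus k * jacobiSc k x * jacobiSc k a * jacobiSc k (a - x) =
      1 / complModulus k * ((∫ s in (0 : ℝ)..x, dcSq k (a - s)) +
        ((ellipticE k : ℂ) - ellipticK k) / ellipticK k * x) := by
  have hxa : |x| < ellipticK k := by rwa [abs_of_nonneg hx0]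
  have hk' : (complModulus k : ℂ) ≠ 0 := Complex.ofReal_ne_zero.2 (complModulus_pos hk).ne'
  have hmem : ∀ s ∈ uIcc 0 x, |s| < ellipticK k := fun s hs => by
    rw [uIcc_of_le hx0] at hs
    rw [abs_of_nonneg hs.1]
    exact hs.2.trans_lt hx
  have hda : ∀ s : ℝ, a - s ∈ scDomain k := fun s => Or.inl (by simpa using ha)
  have hi1 : IntervalIntegrable (fun s : ℝ => dcSq k s) volume 0 x :=
    ((continuousOn_dcSq_real hk).mono hmem).intervalIntegrable
  have hi2 : IntervalIntegrable (fun s : ℝ => dcSq k (a - s)) volume 0 x :=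
    (continuous_dcSq_sub hk ha).intervalIntegrable _ _
  -- The derivative of `k'² sc(a) sc(s) sc(a - s)` in `s` is `dc²(a - s) - dc²(s)`; this is the
  -- addition theorem for `sc` times `-k'²`. Integrating from `0`, where `sc` vanishes, gives the
  -- claim.
  have hder : ∀ s ∈ uIcc 0 x, HasDerivAt (fun s : ℝ => complModulus k ^ 2 * jacobiSc k a *
      (jacobiSc k s * jacobiSc k (a - s))) (dcSq k (a - s) - dcSq k s) s := fun s hs => by
    have h1 := (hasDerivAt_jacobiSc hk (ofReal_mem_scDomain (hmem s hs))).comp_ofReal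
    have h2 : HasDerivAt (fun s : ℂ => jacobiSc k (a - s)) (deriv (jacobiSc k) (a - s) * -1) s :=
      (hasDerivAt_jacobiSc hk (hda s)).comp (s : ℂ) ((hasDerivAt_id (s : ℂ)).const_sub a)
    refine ((h1.mul h2.comp_ofReal).const_mul
      (complModulus k ^ 2 * jacobiSc k a : ℂ)).congr_deriv ?_
    have := jacobiSc_addition hk ha (hmem s hs)
    simp only [dcSq]
    linear_combination -(complModulus k : ℂ) ^ 2 * this
  have hint := intervalIntegral.integral_eq_sub_of_hasDerivAt hder (hi2.sub hi1)
  rw [intervalIntegral.integral_sub hi2 hi1] at hint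
  simp only [Complex.ofReal_zero, jacobiSc_zero hk, zero_mul, mul_zero, sub_zero] at hint
  rw [ellipticA, integralDcSq_ofReal hk hxa]
  field_simp
  linear_combination -hint

theorem dcSq_add_two_mul (hk : k ^ 2 < 1) {u : ℂ} (hu : u.im ∉ scBadIm k) :
    dcSq k (u + 2 * ellipticK k) = dcSq k u := by
  rw [dcSq, jacobiSc_add_two_mul hk hu, dcSq]

theorem dcSq_add_imaginary (hk : k ^ 2 < 1) (hk0 : k ≠ 0) {u : ℂ} (hu : u.im ∉ scBadIm k) :
    dcSq k (u + 2 * Complex.I * ellipticK (complModulus k)) = dcSq k u := by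
  rw [dcSq, jacobiSc_add_imaginary hk hk0 hu, dcSq, neg_sq]

theorem dcSq_add_int_mul_imaginary (hk : k ^ 2 < 1) (hk0 : k ≠ 0) (n : ℤ) {u : ℂ}
    (hu : u.im ∉ scBadIm k) :
    dcSq k (u + n * (2 * Complex.I * ellipticK (complModulus k))) = dcSq k u := by
  set c : ℂ := 2 * Complex.I * ellipticK (complModulus k) with hc
  have him : ∀ m : ℤ, (u + m * c).im = u.im + m * (2 * ellipticK (complModulus k)) := fun m => by
    simp [hc]
  have hgood : ∀ m : ℤ, (u + m * c).im ∉ scBadIm k := fun m h => by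
    rw [mem_scBadIm_iff hk hk0] at h hu
    obtain ⟨j, hj⟩ := h
    refine hu ⟨j - m, ?_⟩
    rw [him] at hj
    push_cast
    linarith
  induction n with
  | zero => simp
  | succ i ih =>
    rw [← ih, ← dcSq_add_imaginary hk hk0 (hgood i)]
    congr 1
    push_cast
    ring
  | pred i ih =>
    rw [← ih, ← dcSq_add_imaginary hk hk0 (hgood (-i - 1))]
    congr 1
    push_cast
    ring

/-- The integral of `dc²` along a horizontal period. -/
theorem integral_dcSq_horizontal (hk : k ^ 2 < 1) {y : ℝ} (hy : y ∉ scBadIm k) :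
    ∫ x in (0 : ℝ)..(2 * ellipticK k), dcSq k (x + y * Complex.I) =
      2 * (ellipticK k - ellipticE k) := by
  by_cases hk0 : k = 0
  · subst hk0
    have hu : ∀ x : ℝ, (x + y * Complex.I : ℂ) ∈ scDomain 0 := fun x => Or.inl (by simpa using hy)
    -- For `k = 0` the integrand is `1/cos²`, with primitive `tan` of period `π = 2K`. The integral
    -- is `0`, in agreement with `E = K`.
    have hder : ∀ x : ℝ, HasDerivAt (fun x : ℝ => Complex.tan (x + y * Complex.I))
        (dcSq 0 (x + y * Complex.I)) x := fun x => by
      have hc := cos_ne_zero_of_mem_scDomain (hu x)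
      have h1 : HasDerivAt (fun x : ℂ => Complex.tan (x + y * Complex.I))
          (1 / Complex.cos (x + y * Complex.I) ^ 2) x :=
        (Complex.hasDerivAt_tan hc).comp_add_const (x : ℂ) _
      refine h1.comp_ofReal.congr_deriv ?_
      rw [dcSq, (jacobiSc_zero_eventuallyEq hc).self_of_nhds, Complex.tan]
      have := Complex.sin_sq_add_cos_sq (x + y * Complex.I)
      simp [complModulus]
      field_simp
      linear_combination -this
    have hcont : Continuous fun x : ℝ => dcSq 0 (x + y * Complex.I) :=
      continuous_iff_continuousAt.2 fun x =>
        ContinuousAt.comp (f := fun x : ℝ => (x + y * Complex.I : ℂ))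
        (analyticAt_dcSq hk (hu x)).continuousAt (by fun_prop)
    rw [intervalIntegral.integral_eq_sub_of_hasDerivAt (fun x _ => hder x)
      (hcont.intervalIntegrable _ _), ellipticK_zero_modulus, ellipticE_zero_modulus]
    have : ((2 * (π / 2) : ℝ) : ℂ) + y * Complex.I = y * Complex.I + π := by push_cast; ring
    rw [this, Complex.tan_add_pi]
    simp
  have hk' := complModulus_sq_lt_one hk hk0
  set K := ellipticK k with hK
  set K' := ellipticK (complModulus k) with hK'
  have hK'0 : 0 < K' := ellipticK_pos hk'
  have hK0 : 0 < K := ellipticK_pos hk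
  -- reduction to the strip `0 < y < 2K'`
  set n : ℤ := ⌊y / (2 * K')⌋ with hn
  set y₀ : ℝ := y - n * (2 * K') with hy₀
  have hgood₀ : y₀ ∉ scBadIm k := fun h => hy (by
    rw [mem_scBadIm_iff hk hk0] at h ⊢
    obtain ⟨m, hm⟩ := h
    exact ⟨m + n, by push_cast; linarith⟩)
  have h1 : 0 ≤ y₀ := by
    have := Int.floor_le (y / (2 * K'))
    rw [le_div_iff₀ (by positivity)] at this
    linarith
  have h2 : y₀ < 2 * K' := by
    have := Int.lt_floor_add_one (y / (2 * K'))
    rw [div_lt_iff₀ (by positivity)] at this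
    linarith
  have h3 : 0 < y₀ := lt_of_le_of_ne h1 fun h => hgood₀ (by
    rw [mem_scBadIm_iff hk hk0]; exact ⟨0, by simp [← h]⟩)
  have hstrip : ∀ t, 0 < t → t < 2 * K' → t ∉ scBadIm k := fun t ht1 ht2 h => by
    obtain ⟨m, hm⟩ := (mem_scBadIm_iff hk hk0).1 h
    rw [← hm] at ht1 ht2
    have e1 : (0 : ℝ) < m := by by_contra h; nlinarith
    have e2 : (m : ℝ) < 1 := by by_contra h; nlinarith
    norm_cast at e1 e2
    omega
  have hshift : ∀ x : ℝ, dcSq k (x + y * Complex.I) = dcSq k (x + y₀ * Complex.I) := fun x => by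
    rw [← dcSq_add_int_mul_imaginary hk hk0 n (u := x + y₀ * Complex.I) (by simpa using hgood₀)]
    congr 1
    rw [hy₀]
    push_cast
    ring
  simp_rw [hshift]
  -- Cauchy's theorem on the rectangle between the heights `y₀` and `K'`, which contains no pole.
  -- The vertical sides cancel by the period `2K`, so the line of integration can be moved to height
  -- `K'`.
  have hcau := Complex.integral_boundary_rect_eq_zero_of_differentiableOn (dcSq k)
    (y₀ * Complex.I) (2 * K + K' * Complex.I) (fun u hu => by
      have : u.im ∈ uIcc y₀ K' := by simpa using hu.2
      refine (analyticAt_dcSq hk (Or.inl (hstrip _ ?_ ?_))).differentiableAt.differentiableWithinAt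
      · exact (lt_min h3 hK'0).trans_le this.1
      · exact this.2.trans_lt (max_lt h2 (by linarith)))
  have hper : ∀ t ∈ uIcc y₀ K', dcSq k (2 * K + t * Complex.I) = dcSq k (t * Complex.I) :=
    fun t ht => by
      rw [← dcSq_add_two_mul hk (u := t * Complex.I), add_comm]
      simpa using hstrip t ((lt_min h3 hK'0).trans_le ht.1)
        (ht.2.trans_lt (max_lt h2 (by linarith)))
  simp at hcau
  rw [intervalIntegral.integral_congr hper, add_sub_cancel_right, sub_eq_zero] at hcau
  rw [hcau]
  -- the integral along the line `Im = K'`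
  have hs1 : realSn (complModulus k) K' = 1 := realSn_ellipticK hk'
  have hc1 : realCn (complModulus k) K' = 0 := realCn_ellipticK hk'
  -- At height `K'` one has `sn(·|k') = 1` and `cn(·|k') = 0`, so `sc` reduces to `i/dn(x)` and
  -- `dc²` to `1 - k'²/dn²`, whose integral is known.
  have hval : ∀ x : ℝ, dcSq k (x + K' * Complex.I) =
      ((1 - (1 - k ^ 2) / realDn k x ^ 2 : ℝ) : ℂ) := fun x => by
    have hu : ((x : ℂ) + K' * Complex.I).im ∉ scBadIm k := by
      simpa using hstrip K' hK'0 (by linarith)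
    have hd := (realDn_pos hk x).ne'
    have rd := realDn_sq hk x
    have rc := realCn_sq (k := k) x
    have rk := complModulus_sq hk
    have hdc : (realDn k x : ℂ) ≠ 0 := Complex.ofReal_ne_zero.2 hd
    have hden : realCn k x ^ 2 + complModulus k ^ 2 * realSn k x ^ 2 = realDn k x ^ 2 := by
      rw [rd, rc, rk]; ring
    have hden' := congrArg Complex.ofReal hden
    push_cast at hden'
    have rk' := congrArg Complex.ofReal rk
    push_cast at rk'
    rw [dcSq, (jacobiSc_eventuallyEq_formula hk hk0 (scDen_ne_zero hk hk0 (Or.inl hu))).self_of_nhds]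
    simp [scFormula, scDen, hs1, hc1, hden']
    rw [rk']
    field_simp
    rw [Complex.I_sq]
    ring
  simp_rw [hval]
  rw [intervalIntegral.integral_ofReal, intervalIntegral.integral_sub (by simp) ?_,
    integral_inv_realDn_sq hk]
  · simp
    ring
  · exact (continuous_const.div ((continuous_realDn hk).pow 2)
      fun x => pow_ne_zero 2 (realDn_pos hk x).ne').intervalIntegrable _ _

theorem integral_dcSq_sub (hk : k ^ 2 < 1) {w : ℂ} (hw : w.im ∉ scBadIm k) :
    ∫ s in (0 : ℝ)..(2 * ellipticK k), dcSq k (w - s) = 2 * (ellipticK k - ellipticE k) := by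
  have hper : Function.Periodic (fun x : ℝ => dcSq k (x + w.im * Complex.I)) (2 * ellipticK k) :=
    fun x => by
      simp only
      rw [← dcSq_add_two_mul hk (u := x + w.im * Complex.I) (by simpa using hw)]
      congr 1
      push_cast
      ring
  have h := intervalIntegral.integral_comp_sub_left (a := 0) (b := 2 * ellipticK k)
    (fun x : ℝ => dcSq k (x + w.im * Complex.I)) w.re
  have h2 : ∀ s : ℝ, dcSq k (((w.re - s : ℝ) : ℂ) + w.im * Complex.I) = dcSq k (w - s) :=
    fun s => by
      congr 1
      conv_rhs => rw [← Complex.re_add_im w]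
      push_cast
      ring
  simp only [h2, sub_zero] at h
  rw [h, ← integral_dcSq_horizontal hk hw]
  have h3 := hper.intervalIntegral_add_eq (w.re - 2 * ellipticK k) 0
  rwa [sub_add_cancel, zero_add] at h3

end Integrals

/-! ## Local systems on the plane are trivial -/

section LocalSystem

variable {A : Type*} [Group A] {g : ℂ → ℂ → A} {S T : Set ℂ} {a b : ℂ → A}

/-- With the discrete topology on the target, the hypothesis is continuity on `S`. This form of
"locally constant implies constant" carries all the later passages from local to global. -/
theorem eq_of_eventually_eq {X B : Type*} [TopologicalSpace X] {S : Set X} (hS : IsPreconnected S)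
    {q : X → B} (hq : ∀ z ∈ S, ∀ᶠ z' in 𝓝[S] z, q z' = q z) {x y : X} (hx : x ∈ S) (hy : y ∈ S) :
    q x = q y := by
  let _ : TopologicalSpace B := ⊥
  have : DiscreteTopology B := ⟨rfl⟩
  refine hS.constant (f := q) (fun z hz => ?_) hx hy
  exact tendsto_nhds_of_eventually_eq (hq z hz)

/-- `a` is a section over `S` of the local system with transition functions `g`. -/
def IsSection (g : ℂ → ℂ → A) (S : Set ℂ) (a : ℂ → A) : Prop :=
  ∀ z ∈ S, ∀ᶠ z' in 𝓝[S] z, a z' = a z * g z z'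

theorem IsSection.mono (h : IsSection g S a) (hT : T ⊆ S) : IsSection g T a := fun z hz =>
  nhdsWithin_mono z hT (h z (hT hz))

theorem IsSection.const_mul (h : IsSection g S a) (c : A) : IsSection g S fun z => c * a z :=
  fun z hz => (h z hz).mono fun z' hz' => by simp only [hz', mul_assoc]

theorem IsSection.mul_inv_eq (ha : IsSection g S a) (hb : IsSection g S b) (hS : IsPreconnected S)
    {x y : ℂ} (hx : x ∈ S) (hy : y ∈ S) : a x * (b x)⁻¹ = a y * (b y)⁻¹ :=
  eq_of_eventually_eq hS (q := fun z => a z * (b z)⁻¹) (fun z hz => by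
    filter_upwards [ha z hz, hb z hz] with z' h1 h2
    rw [h1, h2]
    group) hx hy

/-- On the connected intersection two sections differ by a constant left factor. Rescaling `b` by
this factor makes them agree there, so they glue. -/
theorem exists_isSection_union (hS : IsClosed S) (hT : IsClosed T) (hST : IsPreconnected (S ∩ T))
    (hne : (S ∩ T).Nonempty) (ha : ∃ a, IsSection g S a) (hb : ∃ b, IsSection g T b) :
    ∃ c, IsSection g (S ∪ T) c := by
  classical
  obtain ⟨a, ha⟩ := ha
  obtain ⟨b, hb⟩ := hb
  obtain ⟨o, ho⟩ := hne
  set b' : ℂ → A := fun z => a o * (b o)⁻¹ * b z with hb'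
  have hb'' : IsSection g T b' := hb.const_mul _
  have hab : ∀ z ∈ S ∩ T, a z = b' z := fun z hz => by
    have := (ha.mono inter_subset_left).mul_inv_eq (hb.mono inter_subset_right) hST hz ho
    simp only [hb', ← this]
    group
  set c : ℂ → A := fun z => if z ∈ S then a z else b' z with hc
  have cS : ∀ z ∈ S, c z = a z := fun z hz => by simp [hc, hz]
  have cT : ∀ z ∈ T, c z = b' z := fun z hz => by
    by_cases h : z ∈ S
    · rw [cS z h, hab z ⟨h, hz⟩]
    · simp [hc, h]
  have aux : ∀ {R : Set ℂ} {e : ℂ → A}, IsClosed R → IsSection g R e → (∀ z ∈ R, c z = e z) →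
      ∀ z, ∀ᶠ z' in 𝓝[R] z, c z' = c z * g z z' := by
    intro R e hR he hce z
    by_cases hz : z ∈ R
    · filter_upwards [he z hz, self_mem_nhdsWithin] with z' h1 h2
      rw [hce z' h2, hce z hz, h1]
    -- Here closedness of the pieces matters: a piece imposes no condition near a point outside it.
    · have : 𝓝[R] z = ⊥ := by rwa [← notMem_closure_iff_nhdsWithin_eq_bot, hR.closure_eq]
      simp [this]
  refine ⟨c, fun z _ => ?_⟩
  rw [nhdsWithin_union, eventually_sup]
  exact ⟨aux hS ha cS z, aux hT hb'' cT z⟩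

/-- The closed rectangle with given projections. -/
def rectangle (x x' y y' : ℝ) : Set ℂ := Icc x x' ×ℂ Icc y y'

theorem isClosed_rectangle (x x' y y' : ℝ) : IsClosed (rectangle x x' y y') :=
  isClosed_Icc.reProdIm isClosed_Icc

theorem isPreconnected_rectangle (x x' y y' : ℝ) : IsPreconnected (rectangle x x' y y') :=
  (((convex_Icc x x').linear_preimage Complex.reLm).inter
    ((convex_Icc y y').linear_preimage Complex.imLm)).isPreconnected

theorem mem_rectangle {x x' y y' : ℝ} {z : ℂ} :
    z ∈ rectangle x x' y y' ↔ (x ≤ z.re ∧ z.re ≤ x') ∧ (y ≤ z.im ∧ z.im ≤ y') := Iff.rfl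

theorem exists_isSection_vertical {x x' y y' y'' : ℝ} (hx : x ≤ x') (hy : y ≤ y') (hy' : y' ≤ y'')
    (h1 : ∃ a, IsSection g (rectangle x x' y y') a)
    (h2 : ∃ a, IsSection g (rectangle x x' y' y'') a) :
    ∃ a, IsSection g (rectangle x x' y y'') a := by
  have hi : rectangle x x' y y' ∩ rectangle x x' y' y'' = rectangle x x' y' y' := by
    ext z; simp only [mem_inter_iff, mem_rectangle]; grind
  have hu : rectangle x x' y y' ∪ rectangle x x' y' y'' = rectangle x x' y y'' := by
    ext z; simp only [mem_union, mem_rectangle]; grind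
  rw [← hu]
  refine exists_isSection_union (isClosed_rectangle _ _ _ _) (isClosed_rectangle _ _ _ _) ?_ ?_ h1 h2
  · rw [hi]; exact isPreconnected_rectangle _ _ _ _
  · rw [hi]; exact ⟨⟨x, y'⟩, by simp [mem_rectangle, hx]⟩

theorem exists_isSection_horizontal {x x' x'' y y' : ℝ} (hx : x ≤ x') (hx' : x' ≤ x'') (hy : y ≤ y')
    (h1 : ∃ a, IsSection g (rectangle x x' y y') a)
    (h2 : ∃ a, IsSection g (rectangle x' x'' y y') a) :
    ∃ a, IsSection g (rectangle x x'' y y') a := by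
  have hi : rectangle x x' y y' ∩ rectangle x' x'' y y' = rectangle x' x' y y' := by
    ext z; simp only [mem_inter_iff, mem_rectangle]; grind
  have hu : rectangle x x' y y' ∪ rectangle x' x'' y y' = rectangle x x'' y y' := by
    ext z; simp only [mem_union, mem_rectangle]; grind
  rw [← hu]
  refine exists_isSection_union (isClosed_rectangle _ _ _ _) (isClosed_rectangle _ _ _ _) ?_ ?_ h1 h2
  · rw [hi]; exact isPreconnected_rectangle _ _ _ _
  · rw [hi]; exact ⟨⟨x', y⟩, by simp [mem_rectangle, hy]⟩

/-- The cocycle condition for the transition functions of a local system. -/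
def IsLocalCocycle (g : ℂ → ℂ → A) : Prop :=
  ∀ z, ∀ᶠ z₁ in 𝓝 z, ∀ᶠ z₂ in 𝓝 z₁, g z z₂ = g z z₁ * g z₁ z₂

theorem IsLocalCocycle.exists_isSection_square (hg : IsLocalCocycle g) {r : ℝ} (hr : 0 < r) :
    ∃ a, IsSection g (rectangle (-r) r (-r) r) a := by
  -- On `U z` the cocycle relation says exactly that `g z` is a section, so sections exist locally.
  set U : ℂ → Set ℂ := fun z => interior {z₁ | ∀ᶠ z₂ in 𝓝 z₁, g z z₂ = g z z₁ * g z₁ z₂} with hU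
  have hUs : ∀ z, IsSection g (U z) (g z) := fun z z₁ hz₁ => by
    have h : z₁ ∈ {z₁ | ∀ᶠ z₂ in 𝓝 z₁, g z z₂ = g z z₁ * g z₁ z₂} := interior_subset hz₁
    exact Eventually.filter_mono nhdsWithin_le_nhds h
  have hcomp : IsCompact (rectangle (-r) r (-r) r) := isCompact_Icc.reProdIm isCompact_Icc
  -- The square is cut into cells so small (`2e < δ`) that each lies in a single `U z`. The cells
  -- are glued into columns, and the columns into the square.
  obtain ⟨δ, hδ, hleb⟩ := lebesgue_number_lemma_of_metric hcomp (c := U)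
    (fun z => isOpen_interior) fun z _ => mem_iUnion.2 ⟨z, mem_interior_iff_mem_nhds.2 (hg z)⟩
  obtain ⟨m, hm⟩ := exists_nat_gt (4 * r / δ)
  have hm0 : (0 : ℝ) < m := lt_of_le_of_lt (by positivity) hm
  set e : ℝ := 2 * r / m with he
  have he0 : 0 < e := by positivity
  have hme : m * e = 2 * r := by rw [he]; field_simp
  have he2 : 2 * e < δ := by
    rw [div_lt_iff₀ hδ] at hm
    rw [he, ← mul_div_assoc, div_lt_iff₀ hm0]
    linarith
  have hcell : ∀ x y, x ∈ Icc (-r) r → y ∈ Icc (-r) r →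
      ∃ a, IsSection g (rectangle x (x + e) y (y + e)) a := fun x y hx hy => by
    obtain ⟨z, hz⟩ := hleb ⟨x, y⟩ ⟨hx, hy⟩
    refine ⟨g z, (hUs z).mono (Subset.trans (fun w hw => ?_) hz)⟩
    rw [mem_rectangle] at hw
    rw [mem_ball_iff_norm]
    refine (Complex.norm_le_abs_re_add_abs_im _).trans_lt ?_
    simp only [Complex.sub_re, Complex.sub_im]
    rw [abs_of_nonneg (by linarith [hw.1.1]), abs_of_nonneg (by linarith [hw.2.1])]
    linarith [hw.1.2, hw.2.2]
  have hmem : ∀ i : ℕ, i < m → -r + i * e ∈ Icc (-r) r := fun i hi => by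
    have h1 : (i : ℝ) * e ≤ m * e := by gcongr
    exact ⟨by linarith [(by positivity : 0 ≤ (i : ℝ) * e)], by linarith⟩
  have hm1 : 0 < m := by exact_mod_cast hm0
  have hcol : ∀ x ∈ Icc (-r) r, ∀ j : ℕ, j ≤ m →
      ∃ a, IsSection g (rectangle x (x + e) (-r) (-r + j * e)) a := fun x hx j => by
    induction j with
    | zero =>
      intro _
      obtain ⟨a, ha⟩ := hcell x (-r) hx ⟨le_rfl, by linarith⟩
      refine ⟨a, ha.mono fun w hw => ?_⟩
      rw [mem_rectangle] at hw ⊢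
      refine ⟨hw.1, hw.2.1, ?_⟩
      have := hw.2.2
      simp at this
      linarith
    | succ j ih =>
      intro hj
      have h1 := hcell x _ hx (hmem j (by omega))
      have h2 := exists_isSection_vertical (by linarith)
        (by linarith [(by positivity : 0 ≤ (j : ℝ) * e)]) (by linarith) (ih (by omega)) h1
      rwa [show -r + (j : ℝ) * e + e = -r + ((j + 1 : ℕ) : ℝ) * e by push_cast; ring] at h2
  have hcol' : ∀ x ∈ Icc (-r) r, ∃ a, IsSection g (rectangle x (x + e) (-r) r) a := fun x hx => by
    have := hcol x hx m le_rfl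
    rwa [hme, show -r + 2 * r = r by ring] at this
  have hrow : ∀ j : ℕ, j ≤ m → ∃ a, IsSection g (rectangle (-r) (-r + j * e) (-r) r) a :=
      fun j => by
    induction j with
    | zero =>
      intro _
      obtain ⟨a, ha⟩ := hcol' (-r) ⟨le_rfl, by linarith⟩
      refine ⟨a, ha.mono fun w hw => ?_⟩
      rw [mem_rectangle] at hw ⊢
      refine ⟨⟨hw.1.1, ?_⟩, hw.2⟩
      have := hw.1.2
      simp at this
      linarith
    | succ j ih =>
      intro hj
      have h1 := hcol' _ (hmem j (by omega))
      have h2 := exists_isSection_horizontal (by linarith [(by positivity : 0 ≤ (j : ℝ) * e)])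
        (by linarith) (by linarith) (ih (by omega)) h1
      rwa [show -r + (j : ℝ) * e + e = -r + ((j + 1 : ℕ) : ℝ) * e by push_cast; ring] at h2
  have := hrow m le_rfl
  rwa [hme, show -r + 2 * r = r by ring] at this

/-- Every local system on the plane has a global section. -/
theorem IsLocalCocycle.exists_section (hg : IsLocalCocycle g) :
    ∃ a : ℂ → A, ∀ z, ∀ᶠ z' in 𝓝 z, a z' = a z * g z z' := by
  choose a ha using fun n : ℕ => hg.exists_isSection_square (r := n + 1) (by positivity)
  set Q : ℕ → Set ℂ := fun n => rectangle (-(n + 1)) (n + 1) (-(n + 1)) (n + 1) with hQ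
  -- Normalizing the sections to be `1` at the origin makes those on nested squares agree, so the
  -- union of the squares inherits a section.
  set b : ℕ → ℂ → A := fun n z => (a n 0)⁻¹ * a n z with hb
  have hbs : ∀ n, IsSection g (Q n) (b n) := fun n => (ha n).const_mul _
  have hb0 : ∀ n, b n 0 = 1 := fun n => by simp [hb]
  have h0 : ∀ n, (0 : ℂ) ∈ Q n := fun n => by
    simp only [hQ, mem_rectangle, Complex.zero_re, Complex.zero_im]
    have : (0 : ℝ) ≤ n := Nat.cast_nonneg n
    exact ⟨⟨by linarith, by linarith⟩, by linarith, by linarith⟩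
  have hmono : ∀ m n, m ≤ n → Q m ⊆ Q n := fun m n hmn z hz => by
    have : (m : ℝ) ≤ n := by exact_mod_cast hmn
    simp only [hQ, mem_rectangle] at hz ⊢
    exact ⟨⟨by linarith [hz.1.1], by linarith [hz.1.2]⟩, by linarith [hz.2.1], by linarith [hz.2.2]⟩
  have hball : ∀ (n : ℕ) (z : ℂ), ‖z‖ ≤ n + 1 → z ∈ Q n := fun n z hz => by
    have h1 := abs_le.1 ((Complex.abs_re_le_norm z).trans hz)
    have h2 := abs_le.1 ((Complex.abs_im_le_norm z).trans hz)
    exact ⟨⟨h1.1, h1.2⟩, h2.1, h2.2⟩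
  have hbeq : ∀ m n, m ≤ n → ∀ z ∈ Q m, b m z = b n z := fun m n hmn z hz => by
    have := (hbs m).mul_inv_eq ((hbs n).mono (hmono m n hmn)) (isPreconnected_rectangle _ _ _ _)
      hz (h0 m)
    rw [hb0, hb0, mul_inv_eq_iff_eq_mul] at this
    simpa using this
  set N : ℂ → ℕ := fun z => ⌈‖z‖⌉₊ with hN
  have hzN : ∀ z, z ∈ Q (N z) := fun z => hball _ z ((Nat.le_ceil _).trans (by linarith))
  refine ⟨fun z => b (N z) z, fun z => ?_⟩
  have hnhds : Q (N z + 1) ∈ 𝓝 z := by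
    refine mem_of_superset (Metric.ball_mem_nhds z one_pos) fun w hw => hball _ w ?_
    rw [mem_ball_iff_norm] at hw
    have h1 := norm_sub_norm_le w z
    have h2 := Nat.le_ceil ‖z‖
    push_cast
    simp only [hN]
    linarith
  have hs := hbs (N z + 1) z (mem_of_mem_nhds hnhds)
  rw [nhdsWithin_eq_nhds.2 hnhds] at hs
  filter_upwards [hs, Metric.ball_mem_nhds z one_pos] with w hw hwb
  rw [mem_ball_iff_norm] at hwb
  have h1 := norm_sub_norm_le w z
  have hle : N w ≤ N z + 1 := by
    refine Nat.ceil_le.2 ?_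
    have h2 := Nat.le_ceil ‖z‖
    push_cast
    simp only [hN]
    linarith
  rw [hbeq _ _ hle w (hzN w), hbeq _ _ (Nat.le_succ _) z (hzN z), hw]

end LocalSystem

/-! ## Local structure of an isoradial embedding -/

/-- Two unit circles through two given points: their centers agree or are symmetric. -/
theorem eq_or_add_eq_of_dist_eq_one {a b c c' : ℂ} (hab : a ≠ b) (h1 : dist a c = 1)
    (h2 : dist b c = 1) (h3 : dist a c' = 1) (h4 : dist b c' = 1) : c = c' ∨ c + c' = a + b := by
  have key : ∀ z w : ℂ, dist z w = 1 → (z.re - w.re) ^ 2 + (z.im - w.im) ^ 2 = 1 := fun z w h => by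
    rw [Complex.dist_eq_re_im, Real.sqrt_eq_one] at h
    exact h
  have e1 := key _ _ h1
  have e2 := key _ _ h2
  have e3 := key _ _ h3
  have e4 := key _ _ h4
  -- Measured from the midpoint of `ab`, both centers have the same length, which makes the real
  -- part vanish, and both lie on the perpendicular bisector, which makes the imaginary part vanish.
  have hprod : (c - c') * conj (c + c' - (a + b)) = 0 := by
    have hD : (a.re - b.re) ≠ 0 ∨ (a.im - b.im) ≠ 0 := by
      by_contra! h
      exact hab (Complex.ext (by linarith) (by linarith))
    apply Complex.ext
    · simp
      nlinarith
    · simp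
      rcases hD with h | h
      · apply mul_left_cancel₀ h
        linear_combination (c'.im - (a.im + b.im) / 2) * (e1 - e2) -
          (c.im - (a.im + b.im) / 2) * (e3 - e4)
      · apply mul_left_cancel₀ h
        linear_combination (c.re - (a.re + b.re) / 2) * (e3 - e4) -
          (c'.re - (a.re + b.re) / 2) * (e1 - e2)
  rcases mul_eq_zero.1 hprod with h | h
  · exact Or.inl (sub_eq_zero.1 h)
  · right
    rw [map_eq_zero] at h
    exact sub_eq_zero.1 h

/-- The signed area form `Im ((z - a) (b - a)‾)`, whose sign tells the side of the line `ab` on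
which `z` lies. -/
noncomputable def side (a b z : ℂ) : ℝ := ((z - a) * conj (b - a)).im

theorem continuous_side (a b : ℂ) : Continuous (side a b) := by unfold side; fun_prop

theorem side_combo {a b z w : ℂ} {s t : ℝ} (h : s + t = 1) :
    side a b (s • z + t • w) = s * side a b z + t * side a b w := by
  obtain rfl : t = 1 - s := by linarith
  simp [side]; ring

theorem side_add_I (a b z : ℂ) (e : ℝ) :
    side a b (z + e * (Complex.I * (b - a))) = side a b z + e * Complex.normSq (b - a) := by
  simp [side, Complex.normSq]; ring

theorem side_eq_zero_of_mem_segment {a b z : ℂ} (hz : z ∈ segment ℝ a b) : side a b z = 0 := by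
  obtain ⟨s, t, -, -, h, rfl⟩ := hz
  rw [side_combo h]
  simp [side]
  right; ring

section Planar

variable {V : Type*} {G : SimpleGraph V} {p : V → ℂ}

namespace IsIsoradial

/-- Near a point `z`, the drawing consists of edges through `z` and possibly `z` itself. -/
theorem eventually_mem_drawing (hG : IsIsoradial G p) (z : ℂ) :
    ∀ᶠ w in 𝓝 z, w ∈ drawing G p → (w = z ∧ z ∈ range p) ∨
      ∃ x y, G.Adj x y ∧ z ∈ segment ℝ (p x) (p y) ∧ w ∈ segment ℝ (p x) (p y) := by
  have hb : ∀ᶠ w in 𝓝 z, ‖w‖ ≤ ‖z‖ + 1 :=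
    (continuous_norm.continuousAt.eventually_lt continuousAt_const (by simp)).mono
      fun w hw => le_of_lt hw
  have hv : ∀ᶠ w in 𝓝 z, ∀ v ∈ {v : V | ‖p v‖ ≤ ‖z‖ + 1}, w = p v → p v = z := by
    rw [eventually_all_finite (hG.finite_verts _)]
    intro v _
    by_cases h : p v = z
    · simp [h]
    · filter_upwards [isOpen_ne.mem_nhds (Ne.symm h)] with w hw hw'
      exact absurd hw' hw
  have he : ∀ᶠ w in 𝓝 z, ∀ e ∈ {e : V × V | G.Adj e.1 e.2 ∧
      (segment ℝ (p e.1) (p e.2) ∩ Metric.closedBall 0 (‖z‖ + 1)).Nonempty},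
      w ∈ segment ℝ (p e.1) (p e.2) → z ∈ segment ℝ (p e.1) (p e.2) := by
    rw [eventually_all_finite (hG.finite_edges _)]
    intro e _
    by_cases h : z ∈ segment ℝ (p e.1) (p e.2)
    · simp [h]
    · have hc : IsClosed (segment ℝ (p e.1) (p e.2)) := by
        rw [← convexHull_pair (𝕜 := ℝ)]
        exact ((finite_singleton _).insert _).isClosed_convexHull ℝ
      filter_upwards [hc.isOpen_compl.mem_nhds h] with w hw hw'
      exact absurd hw' hw
  filter_upwards [hb, hv, he] with w h1 h2 h3 hw
  rcases hw with ⟨v, rfl⟩ | ⟨x, y, hxy, hw⟩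
  · have := h2 v h1 rfl
    exact Or.inl ⟨this, v, this⟩
  · exact Or.inr ⟨x, y, hxy, h3 (x, y) ⟨hxy, w, hw, by simpa using h1⟩ hw, hw⟩

theorem isOpen_compl_drawing (hG : IsIsoradial G p) : IsOpen (drawing G p)ᶜ := by
  rw [isOpen_iff_mem_nhds]
  intro z hz
  filter_upwards [hG.eventually_mem_drawing z] with w hw hw'
  rcases hw hw' with ⟨-, h⟩ | ⟨x, y, hxy, h, -⟩
  · exact hz (Or.inl h)
  · exact hz (Or.inr ⟨x, y, hxy, h⟩)

theorem isOpen_face (hG : IsIsoradial G p) (z : ℂ) : IsOpen (face G p z) :=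
  hG.isOpen_compl_drawing.connectedComponentIn

end IsIsoradial

theorem self_mem_face {z : ℂ} (hz : z ∉ drawing G p) : z ∈ face G p z := mem_connectedComponentIn hz

theorem notMem_drawing_of_mem_face {z w : ℂ} (h : w ∈ face G p z) : w ∉ drawing G p :=
  connectedComponentIn_subset _ _ h

theorem face_eq_of_mem {z w : ℂ} (h : w ∈ face G p z) : face G p w = face G p z :=
  (connectedComponentIn_eq h).symm

theorem isPreconnected_face (z : ℂ) : IsPreconnected (face G p z) :=
  isPreconnected_connectedComponentIn

theorem subset_face {S : Set ℂ} (hS : IsPreconnected S) (hd : ∀ z ∈ S, z ∉ drawing G p) {w z : ℂ}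
    (hw : w ∈ S) (hwz : w ∈ face G p z) : S ⊆ face G p z := by
  rw [← face_eq_of_mem hwz]
  exact hS.subset_connectedComponentIn hw hd

theorem faceVerts_eq_of_mem {z w : ℂ} (h : w ∈ face G p z) : faceVerts G p w = faceVerts G p z := by
  simp only [faceVerts, face_eq_of_mem h]

namespace IsIsoradial

theorem mem_face_of_mem_closure (hG : IsIsoradial G p) {z w : ℂ} (h : z ∈ closure (face G p w))
    (hz : z ∉ drawing G p) : z ∈ face G p w := by
  obtain ⟨q, h1, h2⟩ := mem_closure_iff.1 h _ (hG.isOpen_face z) (self_mem_face hz)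
  rw [← face_eq_of_mem h2, face_eq_of_mem h1]
  exact self_mem_face hz

theorem convex_face (hG : IsIsoradial G p) {z : ℂ} (hz : z ∉ drawing G p) :
    Convex ℝ (face G p z) := by
  rw [hG.polygon z hz]
  exact (convex_convexHull ℝ _).interior

/-- Every face contains its circumcenter. -/
theorem exists_circumcenter (hG : IsIsoradial G p) {z : ℂ} (hz : z ∉ drawing G p) :
    ∃ c, IsCircumcenter G p c ∧ c ∈ face G p z ∧ face G p c = face G p z := by
  obtain ⟨c, h1, h2⟩ := hG.inscribed z hz
  exact ⟨c, h2, h1, face_eq_of_mem h1⟩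

theorem closure_face_subset (hG : IsIsoradial G p) {c : ℂ} (hc : IsCircumcenter G p c) :
    closure (face G p c) ⊆ Metric.closedBall c 1 := by
  refine closure_minimal ?_ Metric.isClosed_closedBall
  rw [hG.polygon c hc.1]
  refine interior_subset.trans (convexHull_min ?_ (convex_closedBall c 1))
  rintro _ ⟨v, hv, rfl⟩
  exact (hc.2 v hv).le

/-- With at most one vertex the convex hull would have empty interior, whereas the face is that
interior and is nonempty. -/
theorem nontrivial_faceVerts (hG : IsIsoradial G p) {z : ℂ} (hz : z ∉ drawing G p) :
    (faceVerts G p z).Nontrivial := by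
  by_contra h
  rw [not_nontrivial_iff] at h
  have h1 : (p '' faceVerts G p z).Subsingleton := h.image p
  have h2 := self_mem_face hz
  rw [hG.polygon z hz, h1.convex.convexHull_eq] at h2
  rcases h1.eq_empty_or_singleton with h3 | ⟨a, h3⟩ <;> simp [h3] at h2

/-- A circumcenter is at distance `1` from two distinct vertices. Each such pair admits at most two
centers, and only finitely many pairs lie within distance `r + 1` of the origin. -/
theorem finite_circumcenters (hG : IsIsoradial G p) (r : ℝ) :
    {c | IsCircumcenter G p c ∧ ‖c‖ ≤ r}.Finite := by
  have hf := hG.finite_verts (r + 1)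
  refine (((hf.prod hf).biUnion (t := fun q : V × V =>
    {c | p q.1 ≠ p q.2 ∧ dist (p q.1) c = 1 ∧ dist (p q.2) c = 1}) fun q _ => ?_)).subset ?_
  · by_cases h : ∃ c₀, p q.1 ≠ p q.2 ∧ dist (p q.1) c₀ = 1 ∧ dist (p q.2) c₀ = 1
    · obtain ⟨c₀, h0, h1, h2⟩ := h
      refine (toFinite {c₀, p q.1 + p q.2 - c₀}).subset ?_
      rintro c ⟨-, h3, h4⟩
      rcases eq_or_add_eq_of_dist_eq_one h0 h1 h2 h3 h4 with h | h
      · simp [h]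
      · simp [← h]
    · convert finite_empty
      rw [eq_empty_iff_forall_notMem]
      exact fun c hc => h ⟨c, hc⟩
  · rintro c ⟨hc, hcr⟩
    obtain ⟨v, hv, w, hw, hvw⟩ := hG.nontrivial_faceVerts hc.1
    have hn : ∀ v ∈ faceVerts G p c, ‖p v‖ ≤ r + 1 := fun v hv => by
      have h1 := hc.2 v hv
      rw [dist_eq_norm] at h1
      linarith [norm_sub_norm_le (p v) c]
    simp only [mem_iUnion]
    exact ⟨(v, w), ⟨hn v hv, hn w hw⟩, hG.injective.ne hvw, hc.2 v hv, hc.2 w hw⟩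

/-- The faces near `z` are adjacent to `z`. -/
theorem eventually_mem_closure_face (hG : IsIsoradial G p) (z : ℂ) :
    ∀ᶠ w in 𝓝 z, ∀ c, IsCircumcenter G p c → w ∈ closure (face G p c) →
      z ∈ closure (face G p c) := by
  have hb : ∀ᶠ w in 𝓝 z, ‖w‖ ≤ ‖z‖ + 1 :=
    (continuous_norm.continuousAt.eventually_lt continuousAt_const (by simp)).mono
      fun w hw => le_of_lt hw
  have hf : ∀ᶠ w in 𝓝 z, ∀ c ∈ {c | IsCircumcenter G p c ∧ ‖c‖ ≤ ‖z‖ + 2},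
      w ∈ closure (face G p c) → z ∈ closure (face G p c) := by
    rw [eventually_all_finite (hG.finite_circumcenters _)]
    intro c _
    by_cases h : z ∈ closure (face G p c)
    · simp [h]
    · filter_upwards [isClosed_closure.isOpen_compl.mem_nhds h] with w hw hw'
      exact absurd hw' hw
  filter_upwards [hb, hf] with w h1 h2 c hc hw
  refine h2 c ⟨hc, ?_⟩ hw
  have h3 := hG.closure_face_subset hc hw
  rw [Metric.mem_closedBall, dist_comm, dist_eq_norm] at h3
  linarith [norm_sub_norm_le c w]

end IsIsoradial

theorem ne_of_mem_openSegment {a b m : ℂ} (hab : a ≠ b) (hm : m ∈ openSegment ℝ a b) :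
    m ≠ a ∧ m ≠ b := by
  constructor <;> rintro rfl
  · rw [left_mem_openSegment_iff] at hm
    exact hab hm
  · rw [right_mem_openSegment_iff] at hm
    exact hab hm

namespace IsIsoradial

/-- Near an inner point of an edge, the two sides of the edge belong to faces. -/
theorem exists_half_ball (hG : IsIsoradial G p) {x y : V} (hxy : G.Adj x y) {m : ℂ}
    (hm : m ∈ openSegment ℝ (p x) (p y)) :
    ∃ r > 0, ∀ w ∈ Metric.ball m r, side (p x) (p y) w ≠ 0 → w ∉ drawing G p ∧
      ∀ z ∈ Metric.ball m r, 0 < side (p x) (p y) z * side (p x) (p y) w → z ∈ face G p w := by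
  have hne := hG.injective.ne hxy.ne
  obtain ⟨hm1, hm2⟩ := ne_of_mem_openSegment hne hm
  have hms := openSegment_subset_segment ℝ _ _ hm
  obtain ⟨r, hr, hball⟩ := Metric.eventually_nhds_iff_ball.1 (hG.eventually_mem_drawing m)
  have hoff : ∀ w ∈ Metric.ball m r, side (p x) (p y) w ≠ 0 → w ∉ drawing G p := by
    intro w hw hs hd
    rcases hball w hw hd with ⟨-, v, hv⟩ | ⟨x', y', hxy', h1, h2⟩
    · rcases hG.vertex_edge v x y hxy (hv ▸ hms) with rfl | rfl
      · exact hm1 hv.symm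
      · exact hm2 hv.symm
    · by_cases he : s(x, y) = s(x', y')
      · refine hs (side_eq_zero_of_mem_segment ?_)
        rw [Sym2.eq_iff] at he
        rcases he with ⟨rfl, rfl⟩ | ⟨rfl, rfl⟩
        · exact h2
        · rwa [segment_symm]
      · have := (hG.edge_edge x y x' y' hxy hxy' he ⟨hms, h1⟩).1
        rcases this with h | h
        · exact hm1 h
        · exact hm2 h
  refine ⟨r, hr, fun w hw hs => ⟨hoff w hw hs, fun z hz hzw => ?_⟩⟩
  have hconv : Convex ℝ (Metric.ball m r ∩ {z | 0 < side (p x) (p y) z * side (p x) (p y) w}) := by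
    refine (convex_ball m r).inter fun u hu v hv s t hs ht hst => ?_
    simp only [mem_ofPred_eq] at hu hv ⊢
    rw [side_combo hst]
    rcases hs.eq_or_lt with rfl | hs
    · obtain rfl : t = 1 := by linarith
      simpa using hv
    · nlinarith [mul_pos hs hu, mul_nonneg ht hv.le]
  refine subset_face hconv.isPreconnected (fun u hu => hoff u hu.1 fun h => ?_)
    (w := w) ⟨hw, mul_self_pos.2 hs⟩ (self_mem_face (hoff w hw hs)) ⟨hz, hzw⟩
  have := hu.2
  simp [h] at this

/-- A point on the line of an edge near an inner point of the edge is adjacent to the faces on both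
sides. -/
theorem exists_half_ball_closure (hG : IsIsoradial G p) {x y : V} (hxy : G.Adj x y) {m : ℂ}
    (hm : m ∈ openSegment ℝ (p x) (p y)) :
    ∃ r > 0, ∀ w ∈ Metric.ball m r, side (p x) (p y) w ≠ 0 → w ∉ drawing G p ∧
      ∀ z ∈ Metric.ball m r, 0 ≤ side (p x) (p y) z * side (p x) (p y) w →
        z ∈ closure (face G p w) := by
  obtain ⟨r, hr, h⟩ := hG.exists_half_ball hxy hm
  refine ⟨r, hr, fun w hw hs => ⟨(h w hw hs).1, fun z hz hzw => ?_⟩⟩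
  have hne : p y - p x ≠ 0 := sub_ne_zero.2 (hG.injective.ne hxy.ne')
  have hpos : 0 < Complex.normSq (p y - p x) := Complex.normSq_pos.2 hne
  set σ := side (p x) (p y) w with hσ
  have hcont : Continuous fun e : ℝ => z + ((e * σ : ℝ) : ℂ) * (Complex.I * (p y - p x)) := by
    fun_prop
  have ht : Tendsto (fun e : ℝ => z + ((e * σ : ℝ) : ℂ) * (Complex.I * (p y - p x))) (𝓝[>] 0)
      (𝓝 z) := by
    have := hcont.tendsto 0
    simp only [zero_mul, Complex.ofReal_zero, add_zero] at this
    exact this.mono_left nhdsWithin_le_nhds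
  refine mem_closure_of_tendsto ht ?_
  filter_upwards [ht.eventually (Metric.isOpen_ball.mem_nhds hz), self_mem_nhdsWithin] with e h1 h2
  refine (h w hw hs).2 _ h1 ?_
  rw [side_add_I]
  have h2' : (0 : ℝ) < e := h2
  have : 0 < e * (σ * σ) * Complex.normSq (p y - p x) :=
    mul_pos (mul_pos h2' (mul_self_pos.2 hs)) hpos
  nlinarith

/-- If a face is adjacent to an inner point of an edge, it is adjacent to the endpoints. -/
theorem mem_closure_face_of_edge (hG : IsIsoradial G p) {x y : V} (hxy : G.Adj x y) {m w : ℂ}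
    (hm : m ∈ openSegment ℝ (p x) (p y)) (hmw : m ∈ closure (face G p w)) :
    p x ∈ closure (face G p w) ∧ p y ∈ closure (face G p w) := by
  have hne : p y - p x ≠ 0 := sub_ne_zero.2 (hG.injective.ne hxy.ne')
  have hpos : 0 < Complex.normSq (p y - p x) := Complex.normSq_pos.2 hne
  set γ : ℝ → ℂ := fun s => (1 - s) • p x + s • p y with hγ
  have hγc : Continuous γ := by simp only [hγ]; fun_prop
  have hγm : ∀ s ∈ Ioo (0 : ℝ) 1, γ s ∈ openSegment ℝ (p x) (p y) := fun s hs =>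
    ⟨1 - s, s, by linarith [hs.2], hs.1, by ring, rfl⟩
  have hγs : ∀ s, side (p x) (p y) (γ s) = 0 := fun s => by
    rw [hγ, side_combo (by ring)]
    simp [side]
    right; ring
  -- The set of parameters of points of the open edge that touch the face is both open and closed,
  -- hence everything; the endpoints follow by closure.
  have hloc : ∀ s ∈ Ioo (0 : ℝ) 1, ∀ᶠ s' in 𝓝[Ioo 0 1] s,
      (γ s' ∈ closure (face G p w)) = (γ s ∈ closure (face G p w)) := fun s hs => by
    by_cases h : γ s ∈ closure (face G p w)
    swap
    · have := (isClosed_closure.isOpen_compl.preimage hγc).mem_nhds h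
      filter_upwards [nhdsWithin_le_nhds this] with s' hs'
      simp only [h, eq_iff_iff, iff_false]
      exact hs'
    obtain ⟨r, hr, hball⟩ := hG.exists_half_ball_closure hxy (hγm s hs)
    obtain ⟨f, hf1, hf2⟩ := mem_closure_iff.1 h _ Metric.isOpen_ball (Metric.mem_ball_self hr)
    -- The face is open, so a point of it near the edge can be pushed off the line of the edge. The
    -- face then fills a half-disc, whose closure contains a neighbourhood in the edge.
    obtain ⟨f', ⟨hf1', hf2'⟩, hf'⟩ : ∃ f' ∈ Metric.ball (γ s) r ∩ face G p w,
        side (p x) (p y) f' ≠ 0 := by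
      have ho : IsOpen (Metric.ball (γ s) r ∩ face G p w) :=
        Metric.isOpen_ball.inter (hG.isOpen_face w)
      by_cases hf0 : side (p x) (p y) f = 0
      · have ht : ContinuousAt (fun e : ℝ => f + (e : ℂ) * (Complex.I * (p y - p x))) 0 := by
          fun_prop
        have ht' : Tendsto (fun e : ℝ => f + (e : ℂ) * (Complex.I * (p y - p x))) (𝓝[>] 0)
            (𝓝 f) := by
          have := ht.tendsto
          simp only [Complex.ofReal_zero, zero_mul, add_zero] at this
          exact this.mono_left nhdsWithin_le_nhds
        obtain ⟨e, he1, he2⟩ := ((ht'.eventually (ho.mem_nhds ⟨hf1, hf2⟩)).and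
          self_mem_nhdsWithin).exists
        refine ⟨_, he1, ?_⟩
        rw [side_add_I, hf0, zero_add]
        have he2' : (0 : ℝ) < e := he2
        positivity
      · exact ⟨f, ⟨hf1, hf2⟩, hf0⟩
    rw [← face_eq_of_mem hf2']
    filter_upwards [nhdsWithin_le_nhds (hγc.continuousAt.eventually
      (Metric.ball_mem_nhds _ hr))] with s' hs'
    have h1 : γ s' ∈ closure (face G p f') :=
      (hball f' hf1' hf').2 _ hs' (by rw [hγs, zero_mul])
    rw [← face_eq_of_mem hf2'] at h
    simp only [h1, h]
  obtain ⟨s₀, t₀, h1, h2, h3, rfl⟩ := hm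
  obtain rfl : s₀ = 1 - t₀ := by linarith
  have hall : ∀ s ∈ Ioo (0 : ℝ) 1, γ s ∈ closure (face G p w) := fun s hs => by
    have := eq_of_eventually_eq isPreconnected_Ioo hloc hs
      (show t₀ ∈ Ioo (0 : ℝ) 1 from ⟨h2, by linarith⟩)
    exact this.mpr hmw
  have hcl : ∀ s ∈ Icc (0 : ℝ) 1, γ s ∈ closure (face G p w) := fun s hs => by
    rw [← closure_Ioo zero_ne_one] at hs
    have := map_mem_closure hγc hs (t := closure (face G p w)) hall
    rwa [closure_closure] at this
  have e0 := hcl 0 (by simp)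
  have e1 := hcl 1 (by simp)
  simp [hγ] at e0 e1
  exact ⟨e0, e1⟩

/-- The drawing is covered by countably many points and segments, hence has measure zero. -/
theorem dense_compl_drawing (hG : IsIsoradial G p) : Dense (drawing G p)ᶜ := by
  rw [← interior_eq_empty_iff_dense_compl]
  apply MeasureTheory.Measure.interior_eq_empty_of_null (μ := MeasureTheory.volume)
  have hcV : Countable V := by
    rw [← countable_univ_iff]
    refine (countable_iUnion fun n : ℕ => (hG.finite_verts n).countable).mono fun v _ => ?_
    obtain ⟨n, hn⟩ := exists_nat_ge ‖p v‖
    exact mem_iUnion.2 ⟨n, hn⟩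
  have hsub : drawing G p ⊆ range p ∪ ⋃ q : V × V, segment ℝ (p q.1) (p q.2) := by
    rintro z (hz | ⟨x, y, -, hz⟩)
    · exact Or.inl hz
    · exact Or.inr (mem_iUnion.2 ⟨(x, y), hz⟩)
  refine MeasureTheory.measure_mono_null hsub (MeasureTheory.measure_union_null
    ((countable_range p).measure_zero _) (MeasureTheory.measure_iUnion_null fun q => ?_))
  refine MeasureTheory.measure_mono_null (t := (affineSpan ℝ {p q.1, p q.2} : Set ℂ)) ?_
    (MeasureTheory.Measure.addHaar_affineSubspace _ _ fun htop => ?_)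
  · rw [← convexHull_pair]
    exact convexHull_subset_affineSpan _
  · have h1 : Module.finrank ℝ (vectorSpan ℝ {p q.1, p q.2}) ≤ 1 :=
      (collinear_iff_finrank_le_one).1 (collinear_pair ℝ _ _)
    rw [← direction_affineSpan, htop, AffineSubspace.direction_top, finrank_top,
      Complex.finrank_real_complex] at h1
    omega

/-- Every point of the plane is adjacent to some face. -/
theorem exists_mem_closure_face (hG : IsIsoradial G p) (z : ℂ) :
    ∃ c, IsCircumcenter G p c ∧ z ∈ closure (face G p c) := by
  obtain ⟨U, hU, hUo, hzU⟩ := eventually_nhds_iff.1 (hG.eventually_mem_closure_face z)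
  obtain ⟨w, hwU, hw⟩ := hG.dense_compl_drawing.inter_open_nonempty U hUo ⟨z, hzU⟩
  obtain ⟨c, hc, -, hcw⟩ := hG.exists_circumcenter hw
  exact ⟨c, hc, hU w hwU c hc (hcw ▸ subset_closure (self_mem_face hw))⟩

/-- The faces near a given point have a common vertex. -/
theorem exists_common_vertex (hG : IsIsoradial G p) (z : ℂ) :
    ∃ v, (∀ x, p x = z → v = x) ∧ ∀ᶠ w in 𝓝 z, ∀ c, IsCircumcenter G p c →
      w ∈ closure (face G p c) → v ∈ faceVerts G p c := by
  -- At a vertex, the vertex itself serves; at an inner point of an edge, an endpoint, since a face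
  -- touching the open edge touches its endpoints; inside a face, any of its vertices.
  by_cases hv : z ∈ range p
  · obtain ⟨x, rfl⟩ := hv
    exact ⟨x, fun y hy => hG.injective hy.symm, hG.eventually_mem_closure_face _⟩
  have hnv : ∀ (v : V) x, p x = z → v = x := fun v x hx => absurd ⟨x, hx⟩ hv
  by_cases hd : z ∈ drawing G p
  · rcases hd with h | ⟨x, y, hxy, hz⟩
    · exact absurd h hv
    · refine ⟨x, hnv x, ?_⟩
      have hzo : z ∈ openSegment ℝ (p x) (p y) := by
        refine mem_openSegment_of_ne_left_right ?_ ?_ hz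
        · exact fun h => hv ⟨x, h⟩
        · exact fun h => hv ⟨y, h⟩
      filter_upwards [hG.eventually_mem_closure_face z] with w hw c hc hwc
      exact (hG.mem_closure_face_of_edge hxy hzo (hw c hc hwc)).1
  · obtain ⟨v, hv⟩ := (hG.nontrivial_faceVerts hd).nonempty
    refine ⟨v, hnv v, ?_⟩
    filter_upwards [hG.eventually_mem_closure_face z] with w hw c hc hwc
    rwa [← faceVerts_eq_of_mem (hG.mem_face_of_mem_closure (hw c hc hwc) hd)]

end IsIsoradial

end Planar

/-! ### Connectedness of the diamond graph and multiplicative potentials. -/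

section Potential

variable {V : Type*} {G : SimpleGraph V} {p : V → ℂ}

/-- Opposite steps in the rhombi of the diamond graph are inverse to each other. -/
theorem rhombus_relation {A : Type*} [CommGroup A] {φ : ℂ → A}
    (hφ : ∀ d, ‖d‖ = 1 → φ (-d) = (φ d)⁻¹) {c c' a b : ℂ} (h1 : dist a c = 1) (h2 : dist b c = 1)
    (h3 : dist a c' = 1) (h4 : dist b c' = 1) :
    φ (b - c) * (φ (a - c))⁻¹ = φ (b - c') * (φ (a - c'))⁻¹ := by
  by_cases hab : a = b
  · subst hab; simp
  rcases eq_or_add_eq_of_dist_eq_one hab h1 h2 h3 h4 with rfl | h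
  · rfl
  · rw [show b - c' = -(a - c) by linear_combination -h,
      show a - c' = -(b - c) by linear_combination -h, hφ _ (by rwa [← dist_eq_norm]),
      hφ _ (by rwa [← dist_eq_norm]), inv_inv, mul_comm]

namespace IsIsoradial

/-- The diamond graph is connected. -/
theorem reachable_diamondGraph (hG : IsIsoradial G p) (a b : V ⊕ DualVertex G p) :
    (diamondGraph G p).Reachable a b := by
  choose v hv1 hv2 using hG.exists_common_vertex
  have hadj : ∀ (x : V) (c : DualVertex G p), x ∈ faceVerts G p c.1 →
      (diamondGraph G p).Adj (Sum.inl x) (Sum.inr c) := fun x c h => h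
  have hcomm : ∀ (x y : V) (c : DualVertex G p), x ∈ faceVerts G p c.1 → y ∈ faceVerts G p c.1 →
      (diamondGraph G p).connectedComponentMk (Sum.inl x) =
        (diamondGraph G p).connectedComponentMk (Sum.inl y) := fun x y c hx hy =>
    SimpleGraph.ConnectedComponent.eq.2 ((hadj x c hx).reachable.trans (hadj y c hy).reachable.symm)
  -- The connected component of `v z` is locally constant in `z`: for `w` near `z`, a face touching
  -- `w` has both `v z` and `v w` among its vertices.
  have hconst := fun z w => eq_of_eventually_eq isPreconnected_univ
    (q := fun z => (diamondGraph G p).connectedComponentMk (Sum.inl (v z)))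
    (fun z _ => by
      rw [nhdsWithin_univ]
      filter_upwards [hv2 z] with w hw
      obtain ⟨c, hc, hwc⟩ := hG.exists_mem_closure_face w
      exact hcomm _ _ ⟨c, hc⟩ ((hv2 w).self_of_nhds c hc hwc) (hw c hc hwc))
    (mem_univ z) (mem_univ w)
  have hpoint : ∀ a : V ⊕ DualVertex G p, ∃ z, (diamondGraph G p).connectedComponentMk a =
      (diamondGraph G p).connectedComponentMk (Sum.inl (v z)) := by
    rintro (x | c)
    · exact ⟨p x, by rw [hv1 (p x) x rfl]⟩
    · refine ⟨c.1, SimpleGraph.ConnectedComponent.eq.2 (hadj _ c ?_).reachable.symm⟩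
      exact (hv2 c.1).self_of_nhds c.1 c.2 (subset_closure (self_mem_face c.2.1))
  obtain ⟨z, hz⟩ := hpoint a
  obtain ⟨w, hw⟩ := hpoint b
  exact SimpleGraph.ConnectedComponent.eq.1 (hz.trans ((hconst z w).trans hw.symm))

/-- A function of the directions of the steps which is inverted by the reversal of the step is the
multiplicative gradient of a function on the diamond graph. -/
theorem exists_potential (hG : IsIsoradial G p) {A : Type*} [CommGroup A] {φ : ℂ → A}
    (hφ : ∀ d, ‖d‖ = 1 → φ (-d) = (φ d)⁻¹) :
    ∃ h : V ⊕ DualVertex G p → A, ∀ a b, (diamondGraph G p).Adj a b →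
      h b = h a * φ (diamondPos G p b - diamondPos G p a) := by
  choose v hv1 hv2 using hG.exists_common_vertex
  choose c hc1 hc2 using hG.exists_mem_closure_face
  have hself : ∀ z c, IsCircumcenter G p c → z ∈ closure (face G p c) → v z ∈ faceVerts G p c :=
    fun z => (hv2 z).self_of_nhds
  -- `g z w` is the product of the two steps from `v z` to `v w` through the center of a face
  -- touching `w`. By the rhombus relation it does not depend on the face as long as both are
  -- vertices of it; this makes `g` a local cocycle.
  set g : ℂ → ℂ → A := fun z w => φ (p (v w) - c w) * (φ (p (v z) - c w))⁻¹ with hg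
  have hrel : ∀ {c c' : ℂ} {x y : V}, IsCircumcenter G p c → IsCircumcenter G p c' →
      x ∈ faceVerts G p c → y ∈ faceVerts G p c → x ∈ faceVerts G p c' → y ∈ faceVerts G p c' →
      φ (p y - c) * (φ (p x - c))⁻¹ = φ (p y - c') * (φ (p x - c'))⁻¹ :=
    fun hc hc' h1 h2 h3 h4 =>
      rhombus_relation hφ (hc.2 _ h1) (hc.2 _ h2) (hc'.2 _ h3) (hc'.2 _ h4)
  have hcoc : IsLocalCocycle g := fun z => by
    filter_upwards [(hv2 z).eventually_nhds] with z₁ h1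
    filter_upwards [h1, hv2 z₁] with z₂ h2 h3
    have e : g z z₁ = φ (p (v z₁) - c z₂) * (φ (p (v z) - c z₂))⁻¹ :=
      hrel (hc1 z₁) (hc1 z₂) (h1.self_of_nhds _ (hc1 z₁) (hc2 z₁)) (hself _ _ (hc1 z₁) (hc2 z₁))
        (h2 _ (hc1 z₂) (hc2 z₂)) (h3 _ (hc1 z₂) (hc2 z₂))
    rw [e]
    simp only [hg, ← div_eq_mul_inv]
    rw [mul_comm, div_mul_div_cancel]
  obtain ⟨a, ha⟩ := hcoc.exists_section
  -- On the closure of the face of `d`, the function `a z * (φ (p (v z) - d))⁻¹` is locally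
  -- constant. Its value is the potential at `d`, while `a (p x)` is the potential at a vertex `x`.
  have key : ∀ (d : DualVertex G p) (x : V), x ∈ faceVerts G p d.1 →
      a (p x) * (φ (p x - d.1))⁻¹ = a d.1 * (φ (p (v d.1) - d.1))⁻¹ := by
    rintro ⟨d, hd⟩ x hx
    have := eq_of_eventually_eq (isPreconnected_face d).closure
      (q := fun z => a z * (φ (p (v z) - d))⁻¹) (fun z hz => by
        filter_upwards [nhdsWithin_le_nhds (ha z), nhdsWithin_le_nhds (hv2 z),
          self_mem_nhdsWithin] with w h1 h2 h3
        have e : g z w = φ (p (v w) - d) * (φ (p (v z) - d))⁻¹ :=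
          hrel (hc1 w) hd (h2 _ (hc1 w) (hc2 w)) (hself _ _ (hc1 w) (hc2 w))
            (hself _ _ hd hz) (hself _ _ hd h3)
        rw [h1, e]
        rw [mul_assoc, mul_right_comm, mul_inv_cancel, one_mul])
      (x := p x) (y := d) hx (subset_closure (self_mem_face hd.1))
    simpa only [hv1 (p x) x rfl] using this
  refine ⟨Sum.elim (fun x => a (p x)) fun d => a d.1 * (φ (p (v d.1) - d.1))⁻¹, ?_⟩
  rintro (x | d) (y | e) hadj
  · exact hadj.elim
  · have := key e x hadj
    change a e.1 * (φ (p (v e.1) - e.1))⁻¹ = a (p x) * φ (e.1 - p x)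
    rw [← this, ← neg_sub (p x) e.1, hφ _ (by rw [← dist_eq_norm]; exact e.2.2 x hadj)]
  · have := key d y hadj
    change a (p y) = a d.1 * (φ (p (v d.1) - d.1))⁻¹ * φ (p y - d.1)
    rw [← this, inv_mul_cancel_right]
  · exact hadj.elim

/-- The product of the steps along a walk depends only on the endpoints. -/
theorem exists_potential_walk (hG : IsIsoradial G p) {A : Type*} [CommGroup A] {φ : ℂ → A}
    (hφ : ∀ d, ‖d‖ = 1 → φ (-d) = (φ d)⁻¹) :
    ∃ h : V ⊕ DualVertex G p → A, ∀ a b, ∀ w : (diamondGraph G p).Walk a b,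
      (w.darts.map fun d => φ (diamondPos G p d.snd - diamondPos G p d.fst)).prod =
        (h a)⁻¹ * h b := by
  obtain ⟨h, hh⟩ := hG.exists_potential hφ
  refine ⟨h, fun a b w => ?_⟩
  induction w with
  | nil => simp
  | cons hadj w ih =>
    rw [SimpleGraph.Walk.darts_cons, List.map_cons, List.prod_cons, ih, hh _ _ hadj]
    simp [mul_assoc]

end IsIsoradial

end Potential

/-! ### The rhombi at a vertex do not overlap. -/

section Rhombi

variable {V : Type*} {G : SimpleGraph V} {p : V → ℂ}

/-- The points of the line `ab` are given by an affine parameter. -/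
theorem exists_param_of_side_eq_zero {a b z : ℂ} (hab : a ≠ b) (h : side a b z = 0) :
    ∃ s : ℝ, z = a + s * (b - a) := by
  have hne : b - a ≠ 0 := sub_ne_zero.2 hab.symm
  refine ⟨((z - a) / (b - a)).re, ?_⟩
  have him : ((z - a) / (b - a)).im = 0 := by
    have h' : (z - a) / (b - a) = (z - a) * conj (b - a) * ((Complex.normSq (b - a))⁻¹ : ℝ) := by
      rw [div_eq_mul_inv, Complex.inv_def, mul_assoc]
    rw [h', Complex.im_mul_ofReal]
    rw [side] at h
    rw [h, zero_mul]
  have : (z - a) / (b - a) = (((z - a) / (b - a)).re : ℂ) := Complex.ext rfl (by simpa using him)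
  rw [← this]
  field_simp
  ring

namespace IsIsoradial

/-- Each edge is a diagonal of a rhombus of the diamond graph. -/
theorem exists_face_of_adj (hG : IsIsoradial G p) {x y : V} (hxy : G.Adj x y) :
    ∃ c, IsCircumcenter G p c ∧ x ∈ faceVerts G p c ∧ y ∈ faceVerts G p c := by
  obtain ⟨c, hc, hm⟩ := hG.exists_mem_closure_face (midpoint ℝ (p x) (p y))
  have hmid : midpoint ℝ (p x) (p y) ∈ openSegment ℝ (p x) (p y) :=
    ⟨1 / 2, 1 / 2, by norm_num, by norm_num, by norm_num, by
      rw [midpoint_eq_smul_add, smul_add]; norm_num⟩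
  obtain ⟨h1, h2⟩ := hG.mem_closure_face_of_edge hxy hmid hm
  exact ⟨c, hc, h1, h2⟩

/-- An edge of length `2` would be a diameter, so the circumcenter, which is off the drawing, would
lie on the edge. -/
theorem dist_lt_two (hG : IsIsoradial G p) {x y : V} (hxy : G.Adj x y) : dist (p x) (p y) < 2 := by
  obtain ⟨c, hc, hx, hy⟩ := hG.exists_face_of_adj hxy
  have h1 := hc.2 x hx
  have h2 := hc.2 y hy
  rw [dist_comm] at h2
  refine lt_of_le_of_ne ?_ fun h => hc.1 (Or.inr ⟨x, y, hxy, ?_⟩)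
  · linarith [dist_triangle (p x) c (p y)]
  · rw [mem_segment_iff_wbtw, ← dist_add_dist_eq_iff]
    linarith

/-- A face adjacent to both endpoints of an edge does not meet the line of the edge. -/
theorem side_ne_zero (hG : IsIsoradial G p) {x y : V} (hxy : G.Adj x y) {w z : ℂ}
    (hw : w ∉ drawing G p) (hx : p x ∈ closure (face G p w)) (hy : p y ∈ closure (face G p w))
    (hz : z ∈ face G p w) : side (p x) (p y) z ≠ 0 := by
  intro h0
  obtain ⟨s, hs⟩ := exists_param_of_side_eq_zero (hG.injective.ne hxy.ne) h0
  have hzd := notMem_drawing_of_mem_face hz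
  have hint : z ∈ interior (face G p w) := by rwa [(hG.isOpen_face w).interior_eq]
  have hcv := hG.convex_face hw
  rcases lt_trichotomy s 0 with h | rfl | h
  -- For `s < 0` the vertex `p x` lies strictly between the closure point `p y` and the interior
  -- point `z` of a convex set, so it would be inside the face. The case `s > 1` is symmetric, and
  -- for `0 < s ≤ 1` the point `z` is on the edge.
  · refine notMem_drawing_of_mem_face (interior_subset
      (hcv.openSegment_closure_interior_subset_interior hy hint
      (show p x ∈ openSegment ℝ (p y) z from ⟨-s / (1 - s), 1 / (1 - s), by
        apply div_pos <;> linarith, by apply div_pos <;> linarith, by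
        rw [← add_div, div_eq_one_iff_eq] <;> linarith, ?_⟩))) (Or.inl ⟨x, rfl⟩)
    have : (1 - s : ℂ) ≠ 0 := by
      have : (1 - s : ℝ) ≠ 0 := by linarith
      exact_mod_cast this
    rw [hs]
    simp only [Complex.real_smul]
    push_cast
    field_simp
    ring
  · exact hzd (Or.inl ⟨x, by simp [hs]⟩)
  · rcases le_or_gt s 1 with h1 | h1
    · refine hzd (Or.inr ⟨x, y, hxy, 1 - s, s, by linarith, h.le, by ring, ?_⟩)
      rw [hs]
      simp only [Complex.real_smul]
      push_cast
      ring
    · refine notMem_drawing_of_mem_face (interior_subset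
        (hcv.openSegment_closure_interior_subset_interior hx hint
        (show p y ∈ openSegment ℝ (p x) z from ⟨(s - 1) / s, 1 / s, by
          apply div_pos <;> linarith, by positivity, by
          field_simp; ring, ?_⟩))) (Or.inl ⟨y, rfl⟩)
      have : (s : ℂ) ≠ 0 := by exact_mod_cast h.ne'
      rw [hs]
      simp only [Complex.real_smul]
      push_cast
      field_simp
      ring

/-- A face adjacent to both endpoints of an edge lies on one side of it. -/
theorem side_mul_side_nonneg (hG : IsIsoradial G p) {x y : V} (hxy : G.Adj x y) {w z z' : ℂ}
    (hw : w ∉ drawing G p) (hx : p x ∈ closure (face G p w)) (hy : p y ∈ closure (face G p w))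
    (hz : z ∈ face G p w) (hz' : z' ∈ closure (face G p w)) :
    0 ≤ side (p x) (p y) z' * side (p x) (p y) z := by
  have hc : IsClosed {z' | 0 ≤ side (p x) (p y) z' * side (p x) (p y) z} :=
    isClosed_le continuous_const ((continuous_side _ _).mul continuous_const)
  refine closure_minimal (fun u hu => ?_) hc hz'
  by_contra! hneg
  simp only [mem_ofPred_eq, not_le] at hneg
  set A := side (p x) (p y) u
  set B := side (p x) (p y) z
  have hAB : A - B ≠ 0 := fun h => by
    rw [sub_eq_zero] at h
    rw [h] at hneg
    nlinarith [mul_self_nonneg B]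
  -- If `u` and `z` were on opposite sides, the segment joining them would cross the line of the
  -- edge at the point with these weights, inside the convex face.
  have hsum : -B / (A - B) + A / (A - B) = 1 := by field_simp; ring
  refine hG.side_ne_zero hxy hw hx hy (hG.convex_face hw hu hz (a := -B / (A - B))
    (b := A / (A - B)) ?_ ?_ hsum) ?_
  · rw [div_nonneg_iff]
    rcases lt_or_ge 0 A with h | h
    · exact Or.inl ⟨by nlinarith, by nlinarith⟩
    · exact Or.inr ⟨by nlinarith, by nlinarith⟩
  · rw [div_nonneg_iff]
    rcases lt_or_ge 0 A with h | h
    · exact Or.inl ⟨h.le, by nlinarith⟩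
    · exact Or.inr ⟨h, by nlinarith⟩
  · rw [side_combo hsum]
    change -B / (A - B) * A + A / (A - B) * B = 0
    ring

end IsIsoradial

/-- These are coordinates along and across `Y`, scaled by `|Y|`, for `d` (the `D`s) and `C` (the
`E`s). `2 * E₁ = N` says that `C` is equidistant from `0` and `Y`, and `E₁ < D₁` that `d` is nearer
to `Y`. The coefficient `t = D₂ / E₂` is below `1` because the lengths agree and `D₁ > E₁ > 0`,
which leaves a positive multiple of `Y`. -/
theorem exists_pos_combo_coordinates {N D₁ D₂ E₁ E₂ : ℝ} (hE₁ : 2 * E₁ = N) (hD₁ : E₁ < D₁)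
    (hN : 0 < N) (nD : D₁ ^ 2 + D₂ ^ 2 = N) (nE : E₁ ^ 2 + E₂ ^ 2 = N) (h : 0 < D₂ * E₂) :
    ∃ s t : ℝ, 0 < s ∧ 0 < t ∧ D₁ = s * N + t * E₁ ∧ D₂ = t * E₂ := by
  have hE₂ : E₂ ≠ 0 := right_ne_zero_of_mul h.ne'
  have hsq : 0 < E₂ ^ 2 := by positivity
  have ht : 0 < D₂ / E₂ := by
    have : D₂ / E₂ = D₂ * E₂ / E₂ ^ 2 := by field_simp
    rw [this]
    positivity
  have hE₁0 : 0 < E₁ := by linarith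
  have ht1 : D₂ / E₂ < 1 := by
    have h1 : E₁ ^ 2 < D₁ ^ 2 := by gcongr
    have h2 : (D₂ / E₂) ^ 2 < 1 := by
      rw [div_pow, div_lt_one hsq]
      linarith
    exact (sq_lt_one_iff₀ ht.le).1 h2
  have h3 : D₂ / E₂ * E₁ < E₁ := mul_lt_of_lt_one_left hE₁0 ht1
  refine ⟨(D₁ - D₂ / E₂ * E₁) / N, D₂ / E₂, div_pos (by linarith) hN, ht, ?_, ?_⟩
  · field_simp
    ring
  · field_simp

/-- A unit vector at distance less than `1` from `Y` lies in the sector between `Y` and the center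
of a unit circle through `0` and `Y`. -/
theorem exists_pos_combo {Y C d : ℂ} (hY : Y ≠ 0) (hC : ‖C‖ = 1) (hCY : ‖C - Y‖ = 1) (hd : ‖d‖ = 1)
    (hdY : ‖d - Y‖ < 1) (hs : 0 < (d * conj Y).im * (C * conj Y).im) :
    ∃ s t : ℝ, 0 < s ∧ 0 < t ∧ d = s * Y + t * C := by
  have sq : ∀ z : ℂ, ‖z‖ ^ 2 = z.re ^ 2 + z.im ^ 2 := fun z => by
    rw [Complex.sq_norm, Complex.normSq_apply]; ring
  have e1 := sq C
  have e2 := sq (C - Y)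
  have e3 := sq d
  have e4 : (d - Y).re ^ 2 + (d - Y).im ^ 2 < 1 := by
    rw [← sq, sq_lt_one_iff₀ (norm_nonneg _)]
    exact hdY
  rw [hC] at e1
  rw [hCY] at e2
  rw [hd] at e3
  have hN : 0 < Complex.normSq Y := Complex.normSq_pos.2 hY
  have hNe : Complex.normSq Y = Y.re ^ 2 + Y.im ^ 2 := by rw [Complex.normSq_apply]; ring
  have im_eq : ∀ z : ℂ, (z * conj Y).im = z.im * Y.re - z.re * Y.im := fun z => by simp; ring
  have re_eq : ∀ z : ℂ, (z * conj Y).re = z.re * Y.re + z.im * Y.im := fun z => by simp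
  simp only [Complex.sub_re, Complex.sub_im] at e2 e4
  obtain ⟨s, t, h1, h2, h3, h4⟩ := exists_pos_combo_coordinates (N := Complex.normSq Y)
    (D₁ := (d * conj Y).re) (E₁ := (C * conj Y).re) (by rw [re_eq, hNe]; linarith)
    (by rw [re_eq, re_eq]; linarith) hN
    (by rw [re_eq, im_eq, hNe]; linear_combination -(Y.re ^ 2 + Y.im ^ 2) * e3)
    (by rw [re_eq, im_eq, hNe]; linear_combination -(Y.re ^ 2 + Y.im ^ 2) * e1) hs
  refine ⟨s, t, h1, h2, ?_⟩
  have hd' : d * conj Y = s * Complex.normSq Y + t * (C * conj Y) :=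
    Complex.ext (by rw [h3]; simp) (by rw [h4]; simp)
  have hYc : conj Y ≠ 0 := by simpa using hY
  apply mul_right_cancel₀ hYc
  rw [hd', ← Complex.mul_conj]
  ring

/-- The two expressions of `d` put `b` and `b'` on the same side of the line `ac`, so `side a b c`
and `side a b' c` have the same sign. As `side a b' b = -side a b b'`, the two sign hypotheses then
contradict each other unless this quantity is zero. -/
theorem side_eq_zero_of_sides {a b b' c d : ℂ} {s t s' t' : ℝ} (hs : 0 < s) (hs' : 0 < s')
    (h : d = s * (b - a) + t * (c - a)) (h' : d = s' * (b' - a) + t' * (c - a))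
    (k1 : 0 ≤ side a b b' * side a b c) (k2 : 0 ≤ side a b' b * side a b' c)
    (k3 : side a b c ≠ 0) : side a b b' = 0 := by
  have e : ∀ b, side a b c = -((b - a) * conj (c - a)).im := fun b => by
    simp [side]; ring
  have e1 : (d * conj (c - a)).im = s * ((b - a) * conj (c - a)).im := by
    rw [h, add_mul, Complex.add_im, mul_assoc, mul_assoc, Complex.im_ofReal_mul,
      Complex.im_ofReal_mul, Complex.mul_conj, Complex.ofReal_im, mul_zero, add_zero]
  have e2 : (d * conj (c - a)).im = s' * ((b' - a) * conj (c - a)).im := by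
    rw [h', add_mul, Complex.add_im, mul_assoc, mul_assoc, Complex.im_ofReal_mul,
      Complex.im_ofReal_mul, Complex.mul_conj, Complex.ofReal_im, mul_zero, add_zero]
  have hss : s * side a b c = s' * side a b' c := by rw [e, e]; linarith
  have hanti : side a b' b = -side a b b' := by simp [side]; ring
  rw [hanti] at k2
  generalize side a b c = A at *
  generalize side a b' c = B at *
  generalize side a b b' = T at *
  clear e e1 e2 h h' hanti
  have hsame : 0 < A * B := by
    have h1 : s' * (A * B) = s * (A * A) := by linear_combination -A * hss
    have h2 : 0 < s' * (A * B) := h1 ▸ mul_pos hs (mul_self_pos.2 k3)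
    exact pos_of_mul_pos_right h2 hs'.le
  by_contra hT
  have h1 : 0 < T ^ 2 * (A * B) := mul_pos (by positivity) hsame
  have h2 := mul_nonneg k1 k2
  linarith

/-- Two chords from a point of a unit circle in the same direction have the same endpoint. -/
theorem eq_of_side_eq_zero {a b b' c : ℂ} (hab : a ≠ b) (hab' : a ≠ b') (hcx : dist a c = 1)
    (hcy : dist b c = 1) (hcy' : dist b' c = 1) (h0 : side a b b' = 0) : b = b' := by
  obtain ⟨l, hl⟩ := exists_param_of_side_eq_zero hab h0
  have sq : ∀ a b : ℂ, dist a b = 1 → (a.re - b.re) ^ 2 + (a.im - b.im) ^ 2 = 1 := fun a b h => by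
    rw [Complex.dist_eq_re_im, Real.sqrt_eq_one] at h
    exact h
  have q1 := sq _ _ hcx
  have q2 := sq _ _ hcy
  have q3 := sq _ _ hcy'
  have hre : b'.re = a.re + l * (b.re - a.re) := by rw [hl]; simp
  have him : b'.im = a.im + l * (b.im - a.im) := by rw [hl]; simp
  rw [hre, him] at q3
  have hN : (b.re - a.re) ^ 2 + (b.im - a.im) ^ 2 ≠ 0 := fun h => by
    apply hab
    apply Complex.ext <;> nlinarith [sq_nonneg (b.re - a.re),
      sq_nonneg (b.im - a.im)]
  have hl2 : l * (l - 1) * ((b.re - a.re) ^ 2 + (b.im - a.im) ^ 2) = 0 := by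
    linear_combination q3 - q1 - l * (q2 - q1)
  rcases mul_eq_zero.1 ((mul_eq_zero.1 hl2).resolve_right hN) with h | h
  · exact absurd (by rw [hl, h]; simp) hab'
  · rw [hl, sub_eq_zero.1 h]; simp

namespace IsIsoradial

/-- For small `e` the point is the convex combination of `a`, `b`, `c` with weights `1 - es - et`,
`es`, `et`. The interior point `c` has positive weight. -/
theorem mem_face_of_pos_combo (hG : IsIsoradial G p) {w c a b : ℂ} (hw : w ∉ drawing G p)
    (ha : a ∈ closure (face G p w)) (hb : b ∈ closure (face G p w)) (hc : c ∈ face G p w)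
    {s t : ℝ} (hs : 0 < s) (ht : 0 < t) :
    ∀ᶠ e : ℝ in 𝓝[>] 0, a + e * (s * (b - a) + t * (c - a)) ∈ face G p w := by
  have h1 : ∀ᶠ e : ℝ in 𝓝 0, e * (s + t) < 1 :=
    (continuous_id.mul continuous_const).continuousAt.eventually_lt continuousAt_const (by simp)
  filter_upwards [nhdsWithin_le_nhds h1, self_mem_nhdsWithin] with e h1 he
  have he : (0 : ℝ) < e := he
  have hes := mul_pos he hs
  have het := mul_pos he ht
  have hpos : 0 < 1 - e * t := by nlinarith
  have hcv := hG.convex_face hw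
  have hq := hcv.closure ha hb (a := (1 - e * s - e * t) / (1 - e * t))
    (b := e * s / (1 - e * t)) (div_nonneg (by linarith) hpos.le) (by positivity)
    (by rw [← add_div, div_eq_one_iff_eq] <;> linarith)
  have hc' : c ∈ interior (face G p w) := by rwa [(hG.isOpen_face w).interior_eq]
  have := interior_subset (hcv.combo_closure_interior_mem_interior hq hc' hpos.le het (by ring))
  convert this using 1
  have hpc : (1 - e * t : ℂ) ≠ 0 := by exact_mod_cast hpos.ne'
  simp only [Complex.real_smul]
  push_cast
  field_simp
  ring

/-- The face on the side of `d` of the edge `xy`, when `d` points into the rhombus of `xy`. -/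
theorem exists_face_of_dist_lt (hG : IsIsoradial G p) {x y : V} (hxy : G.Adj x y) {d : ℂ}
    (hd : ‖d‖ = 1) (hdy : dist (p x + d) (p y) < 1) (hs : side (p x) (p y) (p x + d) ≠ 0) :
    ∃ w, w ∉ drawing G p ∧ p x ∈ closure (face G p w) ∧ p y ∈ closure (face G p w) ∧
      ∀ c, IsCircumcenter G p c → c ∈ face G p w →
        ∃ s t : ℝ, 0 < s ∧ 0 < t ∧ d = s * (p y - p x) + t * (c - p x) := by
  have hmid : midpoint ℝ (p x) (p y) ∈ openSegment ℝ (p x) (p y) :=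
    ⟨1 / 2, 1 / 2, by norm_num, by norm_num, by norm_num, by
      rw [midpoint_eq_smul_add, smul_add]; norm_num⟩
  have hne : p y - p x ≠ 0 := sub_ne_zero.2 (hG.injective.ne hxy.ne')
  have hpos : 0 < Complex.normSq (p y - p x) := Complex.normSq_pos.2 hne
  set m := midpoint ℝ (p x) (p y)
  have hm0 := side_eq_zero_of_mem_segment (openSegment_subset_segment ℝ _ _ hmid)
  obtain ⟨r, hr, hball⟩ := hG.exists_half_ball_closure hxy hmid
  set σ := side (p x) (p y) (p x + d) with hσ
  -- The face is found by pushing the midpoint of the edge slightly towards the side of `d`.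
  have ht : Tendsto (fun e : ℝ => m + ((e * σ : ℝ) : ℂ) * (Complex.I * (p y - p x))) (𝓝[>] 0)
      (𝓝 m) := by
    have hcont : Continuous fun e : ℝ => m + ((e * σ : ℝ) : ℂ) * (Complex.I * (p y - p x)) := by
      fun_prop
    have := hcont.tendsto 0
    simp only [zero_mul, Complex.ofReal_zero, add_zero] at this
    exact this.mono_left nhdsWithin_le_nhds
  obtain ⟨e, he1, he2⟩ := ((ht.eventually (Metric.ball_mem_nhds m hr)).and
    self_mem_nhdsWithin).exists
  have he2 : (0 : ℝ) < e := he2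
  set w := m + ((e * σ : ℝ) : ℂ) * (Complex.I * (p y - p x)) with hw
  have hsw : side (p x) (p y) w = e * σ * Complex.normSq (p y - p x) := by
    rw [hw, side_add_I, hm0, zero_add]
  have hswσ : 0 < side (p x) (p y) w * σ := by
    rw [hsw]
    have := mul_pos (mul_pos he2 (mul_self_pos.2 hs)) hpos
    nlinarith
  obtain ⟨hwd, hwc⟩ := hball w he1 (left_ne_zero_of_mul hswσ.ne')
  obtain ⟨hx, hy⟩ := hG.mem_closure_face_of_edge hxy hmid
    (hwc m (Metric.mem_ball_self hr) (by rw [hm0, zero_mul]))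
  refine ⟨w, hwd, hx, hy, fun c hc hcw => ?_⟩
  have hcf := face_eq_of_mem hcw
  have hcx : dist (p x) c = 1 := hc.2 x (by rw [faceVerts, hcf]; exact hx)
  have hcy : dist (p y) c = 1 := hc.2 y (by rw [faceVerts, hcf]; exact hy)
  have h1 := hG.side_mul_side_nonneg hxy hwd hx hy hcw (subset_closure (self_mem_face hwd))
  have h2 := hG.side_ne_zero hxy hwd hx hy hcw
  have h3 : 0 < side (p x) (p y) w * side (p x) (p y) c :=
    lt_of_le_of_ne h1 (mul_ne_zero (left_ne_zero_of_mul hswσ.ne') h2).symm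
  refine exists_pos_combo hne ?_ ?_ hd ?_ ?_
  · rwa [← dist_eq_norm, dist_comm]
  · rwa [sub_sub_sub_cancel_right, ← dist_eq_norm, dist_comm]
  · rw [dist_eq_norm] at hdy
    rwa [show d - (p y - p x) = p x + d - p y by ring]
  · have h4 : (d * conj (p y - p x)).im = σ := by rw [hσ, side, add_sub_cancel_left]
    change 0 < _ * side (p x) (p y) c
    rw [h4]
    have : 0 < (side (p x) (p y) w) ^ 2 * (σ * side (p x) (p y) c) := by nlinarith
    exact pos_of_mul_pos_right this (sq_nonneg _)

/-- The rhombi at a vertex do not overlap. -/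
theorem eq_of_dist_lt (hG : IsIsoradial G p) {x y y' : V} (hxy : G.Adj x y) (hxy' : G.Adj x y')
    {d : ℂ} (hd : ‖d‖ = 1) (hdy : dist (p x + d) (p y) < 1) (hdy' : dist (p x + d) (p y') < 1)
    (hs : side (p x) (p y) (p x + d) ≠ 0) (hs' : side (p x) (p y') (p x + d) ≠ 0) : y = y' := by
  obtain ⟨w, hw, hx, hy, hW⟩ := hG.exists_face_of_dist_lt hxy hd hdy hs
  obtain ⟨w', hw', hx', hy', hW'⟩ := hG.exists_face_of_dist_lt hxy' hd hdy' hs'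
  -- Points at small distance from `p x` in the direction `d` belong to both faces, so the faces
  -- coincide. Both edges are then chords of one circle, with `d` in both sectors.
  have hface : face G p w = face G p w' := by
    obtain ⟨c, hc, hcw, -⟩ := hG.exists_circumcenter hw
    obtain ⟨c', hc', hcw', -⟩ := hG.exists_circumcenter hw'
    obtain ⟨s, t, h1, h2, h3⟩ := hW c hc hcw
    obtain ⟨s', t', h1', h2', h3'⟩ := hW' c' hc' hcw'
    obtain ⟨e, he, he'⟩ := ((hG.mem_face_of_pos_combo hw hx hy hcw h1 h2).and
      (hG.mem_face_of_pos_combo hw' hx' hy' hcw' h1' h2')).exists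
    rw [← h3] at he
    rw [← h3'] at he'
    rw [← face_eq_of_mem he, face_eq_of_mem he']
  obtain ⟨c, hc, hcw, hcf⟩ := hG.exists_circumcenter hw
  rw [← hface] at hx' hy' hW'
  obtain ⟨s, t, h1, h2, h3⟩ := hW c hc hcw
  obtain ⟨s', t', h1', h2', h3'⟩ := hW' c hc hcw
  have hcx : dist (p x) c = 1 := hc.2 x (by rw [faceVerts, hcf]; exact hx)
  have hcy : dist (p y) c = 1 := hc.2 y (by rw [faceVerts, hcf]; exact hy)
  have hcy' : dist (p y') c = 1 := hc.2 y' (by rw [faceVerts, hcf]; exact hy')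
  have k1 := hG.side_mul_side_nonneg hxy hw hx hy hcw hy'
  have k2 := hG.side_mul_side_nonneg hxy' hw hx hy' hcw hy
  have k3 := hG.side_ne_zero hxy hw hx hy hcw
  apply hG.injective
  have hne : p x ≠ p y := hG.injective.ne hxy.ne
  have hne' : p x ≠ p y' := hG.injective.ne hxy'.ne
  have hzero := side_eq_zero_of_sides h1 h1' h3 h3' k1 k2 k3
  exact eq_of_side_eq_zero hne hne' hcx hcy hcy' hzero

end IsIsoradial

end Rhombi

/-! ### The rhombi at a vertex cover almost all directions. -/

section Tiling

variable {V : Type*} {G : SimpleGraph V} {p : V → ℂ}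

theorem normSq_exp_sub (α β κ : ℝ) :
    Complex.normSq (Complex.exp (α * Complex.I) - κ * Complex.exp (β * Complex.I)) =
      1 + κ ^ 2 - 2 * κ * Real.cos (α - β) := by
  rw [Complex.normSq_apply]
  simp only [Complex.sub_re, Complex.sub_im, Complex.re_ofReal_mul, Complex.im_ofReal_mul,
    Complex.exp_ofReal_mul_I_re, Complex.exp_ofReal_mul_I_im, Real.cos_sub]
  have h1 := Real.sin_sq_add_cos_sq α
  have h2 := Real.sin_sq_add_cos_sq β
  linear_combination h1 + κ ^ 2 * h2

theorem side_add_smul (a b d : ℂ) (r : ℝ) :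
    side a b (a + r * d) = r * side a b (a + d) := by
  simp [side]; ring

namespace IsIsoradial

/-- Near a vertex, the drawing consists of the edges at this vertex. -/
theorem exists_ball_vertex (hG : IsIsoradial G p) (x : V) :
    ∃ r > 0, ∀ w ∈ Metric.ball (p x) r, w ∈ drawing G p → w = p x ∨
      ∃ y, G.Adj x y ∧ w ∈ segment ℝ (p x) (p y) := by
  obtain ⟨r, hr, hball⟩ := Metric.eventually_nhds_iff_ball.1 (hG.eventually_mem_drawing (p x))
  refine ⟨r, hr, fun w hw hd => ?_⟩
  rcases hball w hw hd with ⟨h, -⟩ | ⟨a, b, hab, h1, h2⟩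
  · exact Or.inl h
  · rcases hG.vertex_edge x a b hab h1 with rfl | rfl
    · exact Or.inr ⟨b, hab, h2⟩
    · exact Or.inr ⟨a, hab.symm, by rwa [segment_symm]⟩

/-- Every generic direction at a vertex points into the rhombus of some edge. -/
theorem exists_dist_lt (hG : IsIsoradial G p) {x : V} {d : ℂ} (hd : ‖d‖ = 1)
    (h1 : ∀ y, G.Adj x y → side (p x) (p y) (p x + d) ≠ 0)
    (h2 : ∀ y, G.Adj x y → dist (p x + d) (p y) ≠ 1) :
    ∃ y, G.Adj x y ∧ dist (p x + d) (p y) < 1 := by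
  obtain ⟨r, hr, hball⟩ := hG.exists_ball_vertex x
  -- `ρ < r` keeps the circle of radius `ρ` about `p x` where only edges at `x` are drawn; `ρ < 1`
  -- puts `p x + ρ C` between `p x` and the center `c`.
  set ρ : ℝ := min (r / 2) (1 / 2) with hρ
  have hρ0 : 0 < ρ := by positivity
  have hρr : ρ < r := (min_le_left _ _).trans_lt (by linarith)
  have hρ1 : ρ < 1 := (min_le_right _ _).trans_lt (by norm_num)
  have hxd : p x ∈ drawing G p := Or.inl ⟨x, rfl⟩
  -- the face in the direction `d`
  have hoff : ∀ e ∈ Ioc 0 ρ, p x + (e : ℝ) * d ∉ drawing G p := fun e he hdr => by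
    have hb : p x + (e : ℝ) * d ∈ Metric.ball (p x) r := by
      rw [mem_ball_iff_norm, add_sub_cancel_left, norm_mul, hd, mul_one, Complex.norm_real,
        Real.norm_eq_abs, abs_of_pos he.1]
      exact he.2.trans_lt hρr
    rcases hball _ hb hdr with h | ⟨y, hy, h⟩
    · rw [add_eq_left, mul_eq_zero] at h
      rcases h with h | h
      · exact he.1.ne' (by exact_mod_cast h)
      · simp [h] at hd
    · have := side_eq_zero_of_mem_segment h
      rw [side_add_smul, mul_eq_zero] at this
      exact this.elim he.1.ne' (h1 y hy)
  set w := p x + (ρ : ℝ) * d with hw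
  have hwd : w ∉ drawing G p := hoff ρ ⟨hρ0, le_rfl⟩
  have hcont : Continuous fun e : ℝ => p x + (e : ℂ) * d := by fun_prop
  have hF : ∀ e ∈ Ioc 0 ρ, p x + (e : ℝ) * d ∈ face G p w := fun e he =>
    subset_face (isPreconnected_Ioc.image _ hcont.continuousOn)
      (by rintro _ ⟨e, he, rfl⟩; exact hoff e he) ⟨ρ, ⟨hρ0, le_rfl⟩, rfl⟩ (self_mem_face hwd)
      ⟨e, he, rfl⟩
  have hxcl : p x ∈ closure (face G p w) := by
    have ht : Tendsto (fun e : ℝ => p x + (e : ℂ) * d) (𝓝[>] 0) (𝓝 (p x)) := by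
      have := hcont.tendsto 0
      simp only [Complex.ofReal_zero, zero_mul, add_zero] at this
      exact this.mono_left nhdsWithin_le_nhds
    refine mem_closure_of_tendsto ht ?_
    filter_upwards [Ioc_mem_nhdsGT hρ0] with e he using hF e he
  obtain ⟨c, hc, hcw, hcf⟩ := hG.exists_circumcenter hwd
  have hcx : ‖c - p x‖ = 1 := by
    rw [← dist_eq_norm, dist_comm]
    exact hc.2 x (by rw [faceVerts, hcf]; exact hxcl)
  set C := c - p x with hC
  have hC0 : C ≠ 0 := fun h => by simp [h] at hcx
  -- rotation from `d` away from the center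
  set α := Complex.arg (d / C) with hα
  have hdC : d = Complex.exp (α * Complex.I) * C := by
    have := Complex.norm_mul_exp_arg_mul_I (d / C)
    rw [norm_div, hd, hcx, div_one, Complex.ofReal_one, one_mul] at this
    rw [hα, this]
    field_simp
  obtain ⟨σ, hσ, hσα⟩ : ∃ σ : ℝ, (σ = 1 ∨ σ = -1) ∧ σ * |α| = α := by
    rcases le_or_gt 0 α with h | h
    · exact ⟨1, Or.inl rfl, by rw [abs_of_nonneg h, one_mul]⟩
    · exact ⟨-1, Or.inr rfl, by rw [abs_of_neg h]; ring⟩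
  have hcosσ : ∀ t, Real.cos (σ * t) = Real.cos t := fun t => by
    rcases hσ with rfl | rfl <;> simp
  set q : ℝ → ℂ := fun ψ => p x + ρ * (Complex.exp ((σ * ψ : ℝ) * Complex.I) * C) with hq
  have hqc : Continuous q := by simp only [hq]; fun_prop
  have hq0 : q |α| = w := by simp only [hq, hσα, hw, ← hdC]
  have hqC : p x + ρ * C ∈ face G p w := by
    have hint : c ∈ interior (face G p w) := by rwa [(hG.isOpen_face w).interior_eq]
    refine interior_subset ((hG.convex_face hwd).openSegment_closure_interior_subset_interior hxcl
      hint ⟨1 - ρ, ρ, by linarith, hρ0, by ring, ?_⟩)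
    simp only [hC, Complex.real_smul]
    push_cast
    ring
  -- The direction opposite to the center leaves the face: otherwise, by convexity, the face would
  -- contain `p x`, the midpoint of two opposite points of the circle.
  have hqπ : q π ∉ face G p w := fun h => by
    have hexp : Complex.exp ((σ * π : ℝ) * Complex.I) = -1 := by
      rcases hσ with rfl | rfl
      · simp
      · simp [Complex.exp_neg]
    have := hG.convex_face hwd h hqC (a := 1 / 2) (b := 1 / 2) (by norm_num) (by norm_num)
      (by norm_num)
    refine notMem_drawing_of_mem_face this ?_
    convert hxd using 1
    simp only [hq, hexp, Complex.real_smul]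
    push_cast
    ring
  have hαπ : |α| ≤ π := Complex.abs_arg_le_pi _
  -- `ψ` is the first angle at which the rotating point leaves the face. The exit point is on the
  -- drawing and close to `p x`, hence on an edge `xy`, and this edge bounds the face.
  have hcomp : IsCompact (Icc |α| π ∩ q ⁻¹' (face G p w)ᶜ) :=
    isCompact_Icc.inter_right ((hG.isOpen_face w).isClosed_compl.preimage hqc)
  obtain ⟨ψ, ⟨hψI, hψF⟩, hmin⟩ := hcomp.exists_isLeast ⟨π, ⟨hαπ, le_rfl⟩, hqπ⟩
  have hψα : |α| < ψ := lt_of_le_of_ne hψI.1 fun h => hψF (by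
    rw [← h, hq0]; exact self_mem_face hwd)
  have hψcl : q ψ ∈ closure (face G p w) := by
    have hmem : ∀ t ∈ Ico |α| ψ, q t ∈ face G p w := fun t ht => by
      by_contra h
      exact absurd (hmin ⟨⟨ht.1, ht.2.le.trans hψI.2⟩, h⟩) (not_le.2 ht.2)
    refine mem_closure_of_tendsto (b := 𝓝[<] ψ) (f := q)
      (hqc.continuousAt.tendsto.mono_left nhdsWithin_le_nhds) ?_
    filter_upwards [Ico_mem_nhdsLT hψα] with t ht using hmem t ht
  have hψd : q ψ ∈ drawing G p := by
    by_contra h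
    exact hψF (hG.mem_face_of_mem_closure hψcl h)
  have hqn : ‖q ψ - p x‖ = ρ := by
    simp only [hq, add_sub_cancel_left, norm_mul, Complex.norm_exp_ofReal_mul_I, hcx, mul_one,
      Complex.norm_real, Real.norm_eq_abs, abs_of_pos hρ0]
  have hqx : q ψ ≠ p x := fun h => by rw [h, sub_self, norm_zero] at hqn; exact hρ0.ne hqn
  obtain ⟨y, hxy, hqy⟩ := (hball (q ψ) (by rw [mem_ball_iff_norm, hqn]; exact hρr) hψd).resolve_left
    hqx
  have hycl : p y ∈ closure (face G p w) := by
    by_cases hyq : p y = q ψ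
    · rwa [hyq]
    · exact (hG.mem_closure_face_of_edge hxy
        (mem_openSegment_of_ne_left_right (Ne.symm hqx) hyq hqy) hψcl).2
  have hyc : dist (p y) c = 1 := hc.2 y (by rw [faceVerts, hcf]; exact hycl)
  -- the edge has the direction `ψ` and the length `2 cos ψ`
  obtain ⟨τ, hτ⟩ : ∃ τ : ℝ, 0 < τ ∧ q ψ = p x + τ * (p y - p x) := by
    obtain ⟨a, b, ha, hb, hab, h⟩ := hqy
    have h' : q ψ = p x + b * (p y - p x) := by
      rw [← h, ← sub_eq_zero]
      simp only [Complex.real_smul]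
      have : (a : ℂ) = 1 - b := by
        rw [eq_sub_iff_add_eq]; exact_mod_cast hab
      rw [this]
      ring
    refine ⟨b, lt_of_le_of_ne hb fun h0 => hqx ?_, h'⟩
    rw [h', ← h0]
    simp
  obtain ⟨hτ0, hτ⟩ := hτ
  set κ : ℝ := ρ / τ with hκ
  have hκ0 : 0 < κ := by positivity
  have hy : p y = p x + κ * (Complex.exp ((σ * ψ : ℝ) * Complex.I) * C) := by
    have hτc : (τ : ℂ) ≠ 0 := by exact_mod_cast hτ0.ne'
    have : (τ : ℂ) * (p y - p x) = ρ * (Complex.exp ((σ * ψ : ℝ) * Complex.I) * C) := by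
      simp only [hq] at hτ
      linear_combination -hτ
    rw [hκ, Complex.ofReal_div, div_mul_eq_mul_div, ← this]
    field_simp
    ring
  have hnC : Complex.normSq C = 1 := by rw [Complex.normSq_eq_norm_sq, hcx]; norm_num
  have hκc : κ = 2 * Real.cos ψ := by
    have h3 := normSq_exp_sub 0 (σ * ψ) κ
    have h4 : Complex.normSq (c - p y) = 1 := by
      rw [Complex.normSq_eq_norm_sq, ← dist_eq_norm, dist_comm, hyc]; norm_num
    have h5 : c - p y = (Complex.exp ((0 : ℝ) * Complex.I) -
        κ * Complex.exp ((σ * ψ : ℝ) * Complex.I)) * C := by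
      rw [hy, hC]; simp; ring
    rw [h5, map_mul, h3, hnC, zero_sub, Real.cos_neg, hcosσ] at h4
    apply mul_left_cancel₀ hκ0.ne'
    linarith
  refine ⟨y, hxy, lt_of_le_of_ne ?_ (h2 y hxy)⟩
  have h3 := normSq_exp_sub α (σ * ψ) κ
  have h4 : p x + d - p y = (Complex.exp (α * Complex.I) -
      κ * Complex.exp ((σ * ψ : ℝ) * Complex.I)) * C := by
    rw [hy]; nth_rewrite 1 [hdC]; ring
  have h5 : Complex.normSq (p x + d - p y) ≤ 1 := by
    rw [h4, map_mul, h3, hnC, mul_one, ← hσα, ← mul_sub, hcosσ]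
    -- Since `0 ≤ ψ - |α| ≤ ψ ≤ π` and `κ = 2 cos ψ`, the squared distance `1 + κ² - 2 κ cos(|α| -
    -- ψ)` is at most `1`.
    have hcos : Real.cos ψ ≤ Real.cos (|α| - ψ) := by
      rw [← Real.cos_neg (|α| - ψ), neg_sub]
      exact Real.cos_le_cos_of_nonneg_of_le_pi (by linarith) hψI.2 (by linarith [abs_nonneg α])
    have := mul_le_mul_of_nonneg_left hcos hκ0.le
    nlinarith
  rw [dist_eq_norm]
  rw [Complex.normSq_eq_norm_sq] at h5
  exact (sq_le_one_iff₀ (norm_nonneg _)).1 h5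

end IsIsoradial

end Tiling

/-! ### Integrals over the directions at a vertex. -/

section TilingIntegral

variable {V : Type*} {G : SimpleGraph V} {p : V → ℂ}

theorem sub_eq_dist_mul_exp (a b : ℂ) :
    b - a = (dist a b : ℝ) * Complex.exp ((Complex.arg (b - a) : ℝ) * Complex.I) := by
  rw [dist_comm, dist_eq_norm, Complex.norm_mul_exp_arg_mul_I]

theorem normSq_add_exp_sub (a b : ℂ) (t : ℝ) :
    Complex.normSq (a + Complex.exp (t * Complex.I) - b) =
      1 + dist a b ^ 2 - 2 * dist a b * Real.cos (t - Complex.arg (b - a)) := by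
  rw [← normSq_exp_sub, ← sub_eq_dist_mul_exp]
  congr 1
  ring

theorem dist_add_exp_lt_one_iff {a b : ℂ} (hab : a ≠ b) (t : ℝ) :
    dist (a + Complex.exp (t * Complex.I)) b < 1 ↔
      dist a b / 2 < Real.cos (t - Complex.arg (b - a)) := by
  have h0 : 0 < dist a b := dist_pos.2 hab
  have h := normSq_add_exp_sub a b t
  rw [Complex.normSq_eq_norm_sq, ← dist_eq_norm] at h
  rw [← sq_lt_one_iff₀ dist_nonneg, h, ← sub_pos, ← sub_pos (b := dist a b / 2)]
  rw [show 1 - (1 + dist a b ^ 2 - 2 * dist a b * Real.cos (t - Complex.arg (b - a))) =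
    2 * dist a b * (Real.cos (t - Complex.arg (b - a)) - dist a b / 2) by ring]
  exact mul_pos_iff_of_pos_left (by positivity)

theorem dist_add_exp_eq_one_iff {a b : ℂ} (hab : a ≠ b) (t : ℝ) :
    dist (a + Complex.exp (t * Complex.I)) b = 1 ↔
      Real.cos (t - Complex.arg (b - a)) = dist a b / 2 := by
  have h0 : 0 < dist a b := dist_pos.2 hab
  have h := normSq_add_exp_sub a b t
  rw [Complex.normSq_eq_norm_sq, ← dist_eq_norm] at h
  rw [← pow_eq_one_iff_of_nonneg dist_nonneg two_ne_zero, h,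
    ← sub_eq_zero, ← sub_eq_zero (b := dist a b / 2)]
  rw [show 1 + dist a b ^ 2 - 2 * dist a b * Real.cos (t - Complex.arg (b - a)) - 1 =
    -(2 * dist a b) * (Real.cos (t - Complex.arg (b - a)) - dist a b / 2) by ring]
  rw [mul_eq_zero_iff_left (by linarith)]

theorem side_add_exp (a b : ℂ) (t : ℝ) :
    side a b (a + Complex.exp (t * Complex.I)) =
      dist a b * Real.sin (t - Complex.arg (b - a)) := by
  rw [side, sub_eq_dist_mul_exp a b, add_sub_cancel_left, map_mul, Complex.conj_ofReal,
    ← Complex.exp_conj, mul_left_comm, ← Complex.exp_add, map_mul, Complex.conj_I,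
    Complex.conj_ofReal, Complex.im_ofReal_mul, ← sub_eq_dist_mul_exp a b]
  rw [show (t : ℂ) * Complex.I + (Complex.arg (b - a) : ℝ) * -Complex.I =
    ((t - Complex.arg (b - a) : ℝ) : ℂ) * Complex.I by push_cast; ring, Complex.exp_ofReal_mul_I_im]

theorem ae_sin_sub_ne_zero (β : ℝ) : ∀ᵐ t : ℝ, Real.sin (t - β) ≠ 0 := by
  have : {t : ℝ | Real.sin (t - β) = 0}.Countable := by
    refine (countable_range fun n : ℤ => n * π + β).mono fun t ht => ?_
    obtain ⟨n, hn⟩ := Real.sin_eq_zero_iff.1 ht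
    exact ⟨n, by simp only; linarith⟩
  exact this.ae_notMem volume

theorem ae_cos_sub_ne {c : ℝ} (β : ℝ) : ∀ᵐ t : ℝ, Real.cos (t - β) ≠ c := by
  have : {t : ℝ | Real.cos (t - β) = c}.Countable := by
    by_cases h : ∃ s, Real.cos s = c
    · obtain ⟨s, rfl⟩ := h
      refine ((countable_range fun n : ℤ => 2 * n * π + s + β).union
        (countable_range fun n : ℤ => 2 * n * π - s + β)).mono fun t ht => ?_
      obtain ⟨n, hn | hn⟩ := Real.cos_eq_cos_iff.1 (Eq.symm ht)
      · exact Or.inl ⟨n, by simp only; linarith⟩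
      · exact Or.inr ⟨n, by simp only; linarith⟩
    · exact countable_empty.mono fun t ht => h ⟨_, ht⟩
  exact this.ae_notMem volume

namespace IsIsoradial

theorem dist_pos (hG : IsIsoradial G p) {x y : V} (hxy : G.Adj x y) : 0 < dist (p x) (p y) :=
  _root_.dist_pos.2 (hG.injective.ne hxy.ne)

theorem halfAngle_pos (hG : IsIsoradial G p) {x y : V} (hxy : G.Adj x y) : 0 < halfAngle p x y :=
  Real.arccos_pos.2 (by linarith [hG.dist_lt_two hxy])

theorem halfAngle_lt (hG : IsIsoradial G p) {x y : V} (hxy : G.Adj x y) :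
    halfAngle p x y < π / 2 :=
  Real.arccos_lt_pi_div_two.2 (by linarith [hG.dist_pos hxy])

theorem cos_halfAngle (hG : IsIsoradial G p) {x y : V} (hxy : G.Adj x y) :
    Real.cos (halfAngle p x y) = dist (p x) (p y) / 2 :=
  Real.cos_arccos (by linarith [hG.dist_pos hxy]) (by linarith [hG.dist_lt_two hxy])

/-- The integral of a periodic function over the directions pointing into the rhombus of an edge. -/
theorem integral_indicator_rhombus (hG : IsIsoradial G p) {x y : V} (hxy : G.Adj x y) (h : ℝ → ℂ) :
    ∫ t in (Complex.arg (p y - p x) - π)..(Complex.arg (p y - p x) + π),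
        {t : ℝ | dist (p x + Complex.exp (t * Complex.I)) (p y) < 1}.indicator h t =
      ∫ t in (Complex.arg (p y - p x) - halfAngle p x y)..(Complex.arg (p y - p x) + halfAngle p x y),
        h t := by
  have hθ0 := hG.halfAngle_pos hxy
  have hθ1 := hG.halfAngle_lt hxy
  have hπ := Real.pi_pos
  rw [intervalIntegral.integral_of_le (by linarith), intervalIntegral.integral_of_le (by linarith),
    setIntegral_indicator, integral_Ioc_eq_integral_Ioo]
  · congr 2
    ext t
    simp only [mem_inter_iff, mem_Ioc, mem_ofPred_eq, mem_Ioo,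
      dist_add_exp_lt_one_iff (hG.injective.ne hxy.ne), ← hG.cos_halfAngle hxy]
    have key : ∀ s : ℝ, |s| ≤ π → (Real.cos (halfAngle p x y) < Real.cos s ↔
        |s| < halfAngle p x y) := fun s hs => by
      rw [← Real.cos_abs s]
      exact Real.strictAntiOn_cos.lt_iff_gt ⟨hθ0.le, by linarith⟩ ⟨abs_nonneg _, hs⟩
    constructor
    · rintro ⟨⟨h1, h2⟩, h3⟩
      rw [key _ (abs_le.2 ⟨by linarith, by linarith⟩), abs_lt] at h3
      constructor <;> linarith
    · rintro ⟨h1, h2⟩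
      refine ⟨⟨by linarith, by linarith⟩, ?_⟩
      rw [key _ (abs_le.2 ⟨by linarith, by linarith⟩), abs_lt]
      constructor <;> linarith
  · exact (isOpen_lt (by fun_prop) continuous_const).measurableSet

/-- The rhombi at a vertex tile a neighbourhood of this vertex. -/
theorem sum_integral_rhombus (hG : IsIsoradial G p) [G.LocallyFinite] (x : V) {h : ℝ → ℂ}
    (hc : Continuous h) (hp : Function.Periodic h (2 * π)) :
    ∑ y ∈ G.neighborFinset x,
      ∫ t in (Complex.arg (p y - p x) - halfAngle p x y)..(Complex.arg (p y - p x) + halfAngle p x y),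
        h t = ∫ t in (0)..(2 * π), h t := by
  -- Each integral becomes the integral over a full period of `h` times an indicator, and these
  -- indicators sum to `1` almost everywhere.
  set f : V → ℝ → ℂ := fun y =>
    {t : ℝ | dist (p x + Complex.exp (t * Complex.I)) (p y) < 1}.indicator h with hf
  have hfp : ∀ y, Function.Periodic (f y) (2 * π) := fun y t => by
    have : Complex.exp (((t + 2 * π : ℝ) : ℂ) * Complex.I) = Complex.exp (t * Complex.I) := by
      push_cast
      rw [add_mul, Complex.exp_periodic]
    simp only [hf, indicator, mem_ofPred_eq, this, hp t]
  have hfi : ∀ y, ∀ a b, IntervalIntegrable (f y) volume a b := fun y a b =>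
    ⟨(hc.intervalIntegrable a b).1.indicator
      (isOpen_lt (by fun_prop) continuous_const).measurableSet,
      (hc.intervalIntegrable a b).2.indicator
      (isOpen_lt (by fun_prop) continuous_const).measurableSet⟩
  have h1 : ∀ y ∈ G.neighborFinset x,
      ∫ t in (Complex.arg (p y - p x) - halfAngle p x y)..(Complex.arg (p y - p x) + halfAngle p x y),
        h t = ∫ t in (0)..(2 * π), f y t := fun y hy => by
    rw [← hG.integral_indicator_rhombus ((G.mem_neighborFinset x y).1 hy) h]
    have := (hfp y).intervalIntegral_add_eq (Complex.arg (p y - p x) - π) 0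
    rw [zero_add] at this
    rw [← this]
    congr 1
    ring
  rw [Finset.sum_congr rfl h1, ← intervalIntegral.integral_finsetSum fun y _ => hfi y _ _]
  refine intervalIntegral.integral_congr_ae ?_
  -- The discarded directions are parallel to an edge or to a side of a rhombus; there are only
  -- countably many.
  have hae : ∀ᵐ t : ℝ, ∀ y ∈ G.neighborFinset x, Real.sin (t - Complex.arg (p y - p x)) ≠ 0 ∧
      Real.cos (t - Complex.arg (p y - p x)) ≠ dist (p x) (p y) / 2 :=
    (Finset.eventually_all _).2 fun y _ => (ae_sin_sub_ne_zero _).and (ae_cos_sub_ne _)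
  filter_upwards [hae] with t ht _
  have hd : ‖Complex.exp (t * Complex.I)‖ = 1 := Complex.norm_exp_ofReal_mul_I t
  have hs : ∀ y, G.Adj x y → side (p x) (p y) (p x + Complex.exp (t * Complex.I)) ≠ 0 :=
    fun y hy => by
      rw [side_add_exp]
      exact mul_ne_zero (hG.dist_pos hy).ne' (ht y ((G.mem_neighborFinset x y).2 hy)).1
  obtain ⟨y, hxy, hy⟩ := hG.exists_dist_lt hd hs fun y hy => by
    rw [Ne, dist_add_exp_eq_one_iff (hG.injective.ne hy.ne)]
    exact (ht y ((G.mem_neighborFinset x y).2 hy)).2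
  rw [Finset.sum_eq_single y]
  · exact indicator_of_mem (s := {t : ℝ | dist (p x + Complex.exp (t * Complex.I)) (p y) < 1}) hy h
  · intro y' hy' hne
    have hxy' := (G.mem_neighborFinset x y').1 hy'
    exact indicator_of_notMem
      (s := {t : ℝ | dist (p x + Complex.exp (t * Complex.I)) (p y') < 1})
      (fun h' => hne (hG.eq_of_dist_lt hxy' hxy hd h' hy (hs _ hxy') (hs _ hxy))) h
  · exact fun h' => (h' ((G.mem_neighborFinset x y).2 hxy)).elim

end IsIsoradial

end TilingIntegral

/-! ### Step factors, independence of the path, and periods. -/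

section PathFunctions

variable {k : ℝ}

/-- A dense set accumulates at every point, so the functions agree in a punctured neighbourhood by
the identity principle. The normal form then fixes the value at the point, even at a pole. -/
theorem eq_of_eqOn_dense {f g : ℂ → ℂ} (hf : MeromorphicNFOn f univ) (hg : MeromorphicNFOn g univ)
    {S : Set ℂ} (hS : Dense S) (h : EqOn f g S) : f = g := by
  funext z
  have hf' := hf (mem_univ z)
  have hg' := hg (mem_univ z)
  refine ((hf'.eventuallyEq_nhdsNE_iff_eventuallyEq_nhds hg').1
    ((hf'.meromorphicAt.frequently_eq_iff_eventuallyEq hg'.meromorphicAt).1 ?_)).self_of_nhds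
  have h1 : ∃ᶠ u in 𝓝 z, u ∈ S \ {z} := mem_closure_iff_frequently.1 (hS.sdiff_singleton z z)
  rw [frequently_nhdsWithin_iff]
  exact h1.mono fun u hu => ⟨h hu.1, hu.2⟩

/-- The set of all `u` for which no step factor at `u` has a zero or a pole. -/
def genericSet (k : ℝ) : Set ℂ := {u | u.im / 2 ∉ scBadIm k}

theorem dense_genericSet (hk : k ^ 2 < 1) : Dense (genericSet k) := by
  have h : Dense (scBadIm k)ᶜ := (countable_scBadIm hk).dense_compl ℝ
  have h2 : IsOpenMap fun u : ℂ => u.im / 2 :=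
    (Homeomorph.mulRight₀ (2 : ℝ)⁻¹ (by norm_num)).isOpenMap.comp Complex.isOpenMap_im
  exact h.preimage h2

/-- The step factor in the direction `exp (i t)`. -/
noncomputable def dirFactor (k : ℝ) (u : ℂ) (t : ℝ) : ℂ :=
  Complex.I * (√(complModulus k) : ℝ) *
    jacobiSc k ((u - (t * (2 * ellipticK k / π) : ℝ)) / 2)

theorem im_dirFactor_arg (u : ℂ) (t : ℝ) : ((u - (t : ℝ)) / 2).im = u.im / 2 := by
  rw [show (2 : ℂ) = ((2 : ℝ) : ℂ) by norm_num, Complex.div_ofReal_im, Complex.sub_im,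
    Complex.ofReal_im, sub_zero]

theorem sqrt_complModulus_sq (hk : k ^ 2 < 1) :
    (Complex.I * (√(complModulus k) : ℝ)) ^ 2 = -complModulus k := by
  rw [mul_pow, Complex.I_sq, ← Complex.ofReal_pow, Real.sq_sqrt (complModulus_pos hk).le, neg_one_mul]

/-- Reversing a direction amounts to replacing `u` by `u - 2K`. This later exchanges the two
variables of the exponential. -/
theorem dirFactor_add_pi (u : ℂ) (t : ℝ) :
    dirFactor k u (t + π) = dirFactor k (u - 2 * ellipticK k) t := by
  rw [dirFactor, dirFactor]
  congr 2
  have := Real.pi_ne_zero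
  push_cast
  field_simp
  ring

theorem dirFactor_sub_two_mul (hk : k ^ 2 < 1) {u : ℂ} (hu : u ∈ genericSet k) (t : ℝ) :
    dirFactor k (u - 4 * ellipticK k) t = dirFactor k u t := by
  rw [dirFactor, dirFactor, ← jacobiSc_add_two_mul hk]
  · congr 2
    ring
  · rw [im_dirFactor_arg]
    simpa [genericSet] using hu

theorem periodic_dirFactor (hk : k ^ 2 < 1) {u : ℂ} (hu : u ∈ genericSet k) :
    Function.Periodic (dirFactor k u) (2 * π) := fun t => by
  rw [two_mul, ← add_assoc, dirFactor_add_pi, dirFactor_add_pi,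
    ← dirFactor_sub_two_mul hk hu]
  congr 1
  ring

/-- The square of `i√k'` is `-k'`, and `k' sc(v) sc(v - K) = -1`. This is the normalization that
makes reversed steps inverse, as needed for a potential. -/
theorem dirFactor_mul_dirFactor_add_pi (hk : k ^ 2 < 1) {u : ℂ} (hu : u ∈ genericSet k) (t : ℝ) :
    dirFactor k u t * dirFactor k u (t + π) = 1 := by
  have h := jacobiSc_mul_jacobiSc_sub hk (a := (u - (t * (2 * ellipticK k / π) : ℝ)) / 2)
    (by rw [im_dirFactor_arg]; exact hu)
  have h2 := sqrt_complModulus_sq hk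
  rw [dirFactor_add_pi, dirFactor, dirFactor,
    show (u - 2 * ellipticK k - (t * (2 * ellipticK k / π) : ℝ)) / 2 =
      (u - (t * (2 * ellipticK k / π) : ℝ)) / 2 - ellipticK k by ring]
  linear_combination -h + jacobiSc k ((u - (t * (2 * ellipticK k / π) : ℝ)) / 2) *
    jacobiSc k ((u - (t * (2 * ellipticK k / π) : ℝ)) / 2 - ellipticK k) * h2

theorem dirFactor_ne_zero (hk : k ^ 2 < 1) {u : ℂ} (hu : u ∈ genericSet k) (t : ℝ) :
    dirFactor k u t ≠ 0 :=
  left_ne_zero_of_mul_eq_one (dirFactor_mul_dirFactor_add_pi hk hu t)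

theorem dirFactor_arg_exp (hk : k ^ 2 < 1) {u : ℂ} (hu : u ∈ genericSet k) (t : ℝ) :
    dirFactor k u (Complex.arg (Complex.exp (t * Complex.I))) = dirFactor k u t := by
  rw [Complex.arg_exp_mul_I, toIocMod]
  exact (periodic_dirFactor hk hu).sub_zsmul_eq _

theorem stepFactor_of_sub_eq (hk : k ^ 2 < 1) {u : ℂ} (hu : u ∈ genericSet k) {a b : ℂ} {t : ℝ}
    (h : b - a = Complex.exp (t * Complex.I)) : stepFactor k a b u = dirFactor k u t := by
  rw [← dirFactor_arg_exp hk hu, ← h]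
  rfl

theorem neg_exp_mul_I (t : ℝ) :
    -Complex.exp (t * Complex.I) = Complex.exp ((t + π : ℝ) * Complex.I) := by
  push_cast
  rw [add_mul, Complex.exp_add, Complex.exp_pi_mul_I, mul_neg_one]

theorem analyticAt_stepFactor (hk : k ^ 2 < 1) {u : ℂ} (hu : u ∈ genericSet k) (a b : ℂ) :
    AnalyticAt ℂ (stepFactor k a b) u := by
  refine analyticAt_const.mul (AnalyticAt.comp (analyticAt_jacobiSc hk (Or.inl ?_)) (by fun_prop))
  rw [im_dirFactor_arg]
  exact hu

theorem meromorphic_stepFactor (a b : ℂ) : Meromorphic (stepFactor k a b) := fun u =>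
  (MeromorphicAt.const _ _).mul ((meromorphic_jacobiSc _).comp_analyticAt
    (g := fun u : ℂ => (u - (Complex.arg (b - a) * (2 * ellipticK k / π) : ℝ)) / 2) (by fun_prop))

variable {V : Type*} {G : SimpleGraph V} {p : V → ℂ} {a b : V ⊕ DualVertex G p}

theorem pathProduct_cons {c : V ⊕ DualVertex G p} (h : (diamondGraph G p).Adj a c)
    (w : (diamondGraph G p).Walk c b) :
    pathProduct k (.cons h w) = stepFactor k (diamondPos G p a) (diamondPos G p c) *
      pathProduct k w := by
  funext u
  simp [pathProduct]

theorem pathProduct_nil : pathProduct k (.nil : (diamondGraph G p).Walk a a) = 1 := by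
  funext u
  simp [pathProduct]

theorem meromorphic_pathProduct (w : (diamondGraph G p).Walk a b) :
    Meromorphic (pathProduct k w) := by
  induction w with
  | nil => rw [pathProduct_nil]; exact Meromorphic.const 1
  | cons h w ih => rw [pathProduct_cons]; exact (meromorphic_stepFactor _ _).mul ih

theorem analyticAt_pathProduct (hk : k ^ 2 < 1) {u : ℂ} (hu : u ∈ genericSet k)
    (w : (diamondGraph G p).Walk a b) : AnalyticAt ℂ (pathProduct k w) u := by
  induction w with
  | nil => rw [pathProduct_nil]; exact analyticAt_const
  | cons h w ih => rw [pathProduct_cons]; exact (analyticAt_stepFactor hk hu _ _).mul ih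

theorem meromorphicNFOn_pathExp (w : (diamondGraph G p).Walk a b) :
    MeromorphicNFOn (pathExp k w) univ := meromorphicNFOn_toMeromorphicNFOn _ _

theorem pathExp_eq_pathProduct (hk : k ^ 2 < 1) {u : ℂ} (hu : u ∈ genericSet k)
    (w : (diamondGraph G p).Walk a b) : pathExp k w u = pathProduct k w u :=
  (toMeromorphicNFOn_eventuallyEq_of_analyticAt (meromorphic_pathProduct w)
    (analyticAt_pathProduct hk hu w) EventuallyEq.rfl).self_of_nhds

/-- For generic `u`, the product of the step factors along a walk is a coboundary. -/
theorem IsIsoradial.exists_potential_pathProduct (hG : IsIsoradial G p) (hk : k ^ 2 < 1) {u : ℂ}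
    (hu : u ∈ genericSet k) : ∃ h : V ⊕ DualVertex G p → ℂˣ, ∀ a b,
      ∀ w : (diamondGraph G p).Walk a b, pathProduct k w u = (h a)⁻¹ * h b := by
  obtain ⟨h, hh⟩ := hG.exists_potential_walk
    (φ := fun d => Units.mk0 (dirFactor k u (Complex.arg d)) (dirFactor_ne_zero hk hu _))
    (fun d hd => by
      have h1 : d = Complex.exp (Complex.arg d * Complex.I) := by
        have := Complex.norm_mul_exp_arg_mul_I d
        rw [hd] at this
        simpa using this.symm
      rw [eq_inv_iff_mul_eq_one, mul_comm]
      ext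
      have h2 : dirFactor k u (Complex.arg (-d)) = dirFactor k u (Complex.arg d + π) := by
        nth_rewrite 1 [h1]
        rw [neg_exp_mul_I, dirFactor_arg_exp hk hu]
      simp only [Units.val_mul, Units.val_mk0, Units.val_one, h2]
      exact dirFactor_mul_dirFactor_add_pi hk hu _)
  refine ⟨h, fun a b w => ?_⟩
  have := congrArg (Units.coeHom ℂ) (hh a b w)
  rw [map_list_prod, List.map_map] at this
  simpa [pathProduct, Function.comp_def, stepFactor, dirFactor] using this

theorem IsIsoradial.pathExp_eq (hG : IsIsoradial G p) (hk : k ^ 2 < 1)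
    (w w' : (diamondGraph G p).Walk a b) : pathExp k w = pathExp k w' := by
  refine eq_of_eqOn_dense (meromorphicNFOn_pathExp w) (meromorphicNFOn_pathExp w')
    (dense_genericSet hk) fun u hu => ?_
  obtain ⟨h, hh⟩ := hG.exists_potential_pathProduct hk hu
  rw [pathExp_eq_pathProduct hk hu, pathExp_eq_pathProduct hk hu, hh, hh]

theorem IsIsoradial.pathExp_eq_massiveExp (hG : IsIsoradial G p) (hk : k ^ 2 < 1)
    (w : (diamondGraph G p).Walk a b) : pathExp k w = massiveExp k G p a b := by
  rw [massiveExp, dif_pos (hG.reachable_diamondGraph a b)]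
  exact hG.pathExp_eq hk _ _

theorem IsIsoradial.meromorphicNFOn_massiveExp (hG : IsIsoradial G p) (hk : k ^ 2 < 1) :
    MeromorphicNFOn (massiveExp k G p a b) univ := by
  rw [← hG.pathExp_eq_massiveExp hk (hG.reachable_diamondGraph a b).some]
  exact meromorphicNFOn_pathExp _

theorem IsIsoradial.massiveExp_eq_pathProduct (hG : IsIsoradial G p) (hk : k ^ 2 < 1) {u : ℂ}
    (hu : u ∈ genericSet k) (w : (diamondGraph G p).Walk a b) :
    massiveExp k G p a b u = pathProduct k w u := by
  rw [← hG.pathExp_eq_massiveExp hk w, pathExp_eq_pathProduct hk hu]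

theorem IsIsoradial.massiveExp_mul (hG : IsIsoradial G p) (hk : k ^ 2 < 1) {u : ℂ}
    (hu : u ∈ genericSet k) (a b c : V ⊕ DualVertex G p) :
    massiveExp k G p a b u * massiveExp k G p b c u = massiveExp k G p a c u := by
  obtain ⟨h, hh⟩ := hG.exists_potential_pathProduct hk hu
  rw [hG.massiveExp_eq_pathProduct hk hu (hG.reachable_diamondGraph a b).some,
    hG.massiveExp_eq_pathProduct hk hu (hG.reachable_diamondGraph b c).some,
    hG.massiveExp_eq_pathProduct hk hu (hG.reachable_diamondGraph a c).some, hh, hh, hh]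
  norm_cast
  group

/-! ### Periods -/

theorem IsIsoradial.massiveExp_add_eq (hG : IsIsoradial G p) (hk : k ^ 2 < 1) {ω : ℂ}
    (h : ∀ u ∈ genericSet k, u + ω ∈ genericSet k ∧
      ∀ w : (diamondGraph G p).Walk a b, pathProduct k w (u + ω) = pathProduct k w u) (u : ℂ) :
    massiveExp k G p a b (u + ω) = massiveExp k G p a b u := by
  have h1 := hG.meromorphicNFOn_massiveExp (a := a) (b := b) hk
  have h2 : MeromorphicNFOn (fun u => massiveExp k G p a b (u + ω)) univ := fun z _ =>
    (meromorphicNFAt_comp_add_const_iff_meromorphicNFAt).2 (h1 (mem_univ _))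
  refine congrFun (eq_of_eqOn_dense h2 h1 (dense_genericSet hk) fun v hv => ?_) u
  have w := (hG.reachable_diamondGraph a b).some
  rw [hG.massiveExp_eq_pathProduct hk (h v hv).1 w, hG.massiveExp_eq_pathProduct hk hv w,
    (h v hv).2]

theorem stepFactor_add_real (hk : k ^ 2 < 1) {u : ℂ} (hu : u ∈ genericSet k) (a b : ℂ) :
    stepFactor k a b (u + 4 * ellipticK k) = stepFactor k a b u := by
  have := dirFactor_sub_two_mul hk (u := u + 4 * ellipticK k) (by simpa [genericSet] using hu)
    (Complex.arg (b - a))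
  rw [add_sub_cancel_right] at this
  exact this.symm

theorem stepFactor_add_imaginary (hk : k ^ 2 < 1) (hk0 : k ≠ 0) {u : ℂ} (hu : u ∈ genericSet k)
    (a b : ℂ) : stepFactor k a b (u + 4 * Complex.I * ellipticK (complModulus k)) =
      -stepFactor k a b u := by
  rw [stepFactor, stepFactor, ← mul_neg, ← jacobiSc_add_imaginary hk hk0]
  · congr 2
    ring
  · rw [im_dirFactor_arg]
    exact hu

theorem add_imaginary_mem_genericSet (hk : k ^ 2 < 1) (hk0 : k ≠ 0) {u : ℂ}
    (hu : u ∈ genericSet k) : u + 4 * Complex.I * ellipticK (complModulus k) ∈ genericSet k := by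
  have : (u + 4 * Complex.I * ellipticK (complModulus k)).im / 2 =
      u.im / 2 + 2 * ellipticK (complModulus k) := by
    simp
    ring
  rw [genericSet, mem_ofPred_eq, this, add_mem_scBadIm_iff hk hk0]
  exact hu

theorem pathProduct_add_real (hk : k ^ 2 < 1) {u : ℂ} (hu : u ∈ genericSet k)
    (w : (diamondGraph G p).Walk a b) :
    pathProduct k w (u + 4 * ellipticK k) = pathProduct k w u := by
  simp only [pathProduct, stepFactor_add_real hk hu]

/-- Each step contributes a sign and crosses between `V` and the dual vertices, so the total sign
depends only on the classes of the endpoints and is `1` between vertices of `G`. -/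
theorem pathProduct_add_imaginary (hk : k ^ 2 < 1) (hk0 : k ≠ 0) {u : ℂ} (hu : u ∈ genericSet k)
    (w : (diamondGraph G p).Walk a b) :
    pathProduct k w (u + 4 * Complex.I * ellipticK (complModulus k)) =
      (Sum.elim (fun _ => 1) (fun _ => -1) a : ℂ) * Sum.elim (fun _ => 1) (fun _ => -1) b *
        pathProduct k w u := by
  induction w with
  | @nil a => rcases a with a | a <;> simp [pathProduct_nil]
  | @cons a c b h w ih =>
    rw [pathProduct_cons, Pi.mul_apply, Pi.mul_apply, ih, stepFactor_add_imaginary hk hk0 hu]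
    rcases a with a | a <;> rcases c with c | c
    · exact h.elim
    · simp; ring
    · simp; ring
    · exact h.elim

theorem IsIsoradial.massiveExp_add_mem_periodLattice (hG : IsIsoradial G p) (hk : k ^ 2 < 1)
    (x y : V) {ω : ℂ} (hω : ω ∈ periodLattice k) :
    ∀ u : ℂ, massiveExp k G p (Sum.inl x) (Sum.inl y) (u + ω) =
      massiveExp k G p (Sum.inl x) (Sum.inl y) u := by
  induction hω using AddSubgroup.closure_induction with
  | mem ω h =>
    rcases h with rfl | ⟨hk0, rfl⟩
    · exact hG.massiveExp_add_eq hk fun u hu =>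
        ⟨by simpa [genericSet] using hu, pathProduct_add_real hk hu⟩
    · refine hG.massiveExp_add_eq hk fun u hu =>
        ⟨add_imaginary_mem_genericSet hk hk0 hu, fun w => ?_⟩
      rw [pathProduct_add_imaginary hk hk0 hu]
      simp
  | zero => simp
  | add ω ω' _ _ h h' => intro u; rw [← add_assoc, h', h]
  | neg ω _ h => intro u; rw [← h (u + -ω), neg_add_cancel_right]

end PathFunctions

/-! ### Massive harmonicity. -/

section Harmonicity

variable {k : ℝ} {V : Type*} {G : SimpleGraph V} {p : V → ℂ}

theorem sub_eq_exp_of_dist_eq_one {a c : ℂ} (h : dist a c = 1) :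
    c - a = Complex.exp ((Complex.arg (c - a) : ℝ) * Complex.I) := by
  nth_rewrite 1 [sub_eq_dist_mul_exp a c]
  rw [h, Complex.ofReal_one, one_mul]

theorem exp_two_pi_mul_int_add (n : ℤ) (t : ℝ) :
    Complex.exp ((2 * n * π + t : ℝ) * Complex.I) = Complex.exp (t * Complex.I) := by
  rw [← Complex.exp_periodic.int_mul n (t * Complex.I)]
  congr 1
  push_cast
  ring

theorem diamondPos_inl (x : V) : diamondPos G p (.inl x) = p x := rfl

theorem diamondPos_inr (c : DualVertex G p) : diamondPos G p (.inr c) = c.1 := rfl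

namespace IsIsoradial

/-- The two sides of the rhombus of the edge `xy` leading from `x` to `y`. -/
theorem exists_face_of_adj_exp (hG : IsIsoradial G p) {x y : V} (hxy : G.Adj x y) :
    ∃ c, IsCircumcenter G p c ∧ x ∈ faceVerts G p c ∧ y ∈ faceVerts G p c ∧ ∃ s s' : ℝ,
      c - p x = Complex.exp (s * Complex.I) ∧ p y - c = Complex.exp (s' * Complex.I) ∧
      (s = Complex.arg (p y - p x) + halfAngle p x y ∧
        s' = Complex.arg (p y - p x) - halfAngle p x y ∨
      s = Complex.arg (p y - p x) - halfAngle p x y ∧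
        s' = Complex.arg (p y - p x) + halfAngle p x y) := by
  obtain ⟨c, hc, hx, hy⟩ := hG.exists_face_of_adj hxy
  refine ⟨c, hc, hx, hy, ?_⟩
  have hne := hG.injective.ne hxy.ne
  have h1 := sub_eq_exp_of_dist_eq_one (hc.2 x hx)
  set t := Complex.arg (c - p x)
  set β := Complex.arg (p y - p x) with hβ
  -- The center is at distance `1` from `p y`, so the side from `p x` makes the half-angle with the
  -- edge. Its sign, hence the order of the two sides, depends on which side of the edge the face
  -- lies.
  have h2 : Real.cos (t - β) = Real.cos (halfAngle p x y) := by
    rw [hG.cos_halfAngle hxy, ← dist_add_exp_eq_one_iff hne, ← h1, add_sub_cancel, dist_comm]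
    exact hc.2 y hy
  have hsum : p y - p x = Complex.exp ((β + halfAngle p x y : ℝ) * Complex.I) +
      Complex.exp ((β - halfAngle p x y : ℝ) * Complex.I) := by
    rw [sub_eq_dist_mul_exp (p x) (p y), ← hβ]
    have h3 : dist (p x) (p y) = 2 * Real.cos (halfAngle p x y) := by
      rw [hG.cos_halfAngle hxy]; ring
    rw [h3]
    push_cast
    rw [Complex.two_cos, add_mul, ← Complex.exp_add, ← Complex.exp_add]
    congr 2 <;> ring
  obtain ⟨n, hn | hn⟩ := Real.cos_eq_cos_iff.1 h2.symm
  · have h4 : c - p x = Complex.exp ((β + halfAngle p x y : ℝ) * Complex.I) := by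
      rw [h1, show t = 2 * n * π + (β + halfAngle p x y) by linarith, exp_two_pi_mul_int_add]
    exact ⟨_, _, h4, by linear_combination hsum - h4, Or.inl ⟨rfl, rfl⟩⟩
  · have h4 : c - p x = Complex.exp ((β - halfAngle p x y : ℝ) * Complex.I) := by
      rw [h1, show t = 2 * n * π + (β - halfAngle p x y) by linarith, exp_two_pi_mul_int_add]
    exact ⟨_, _, h4, by linear_combination hsum - h4, Or.inr ⟨rfl, rfl⟩⟩

/-- The massive exponential function along an edge and its inverse. -/
theorem massiveExp_of_adj (hG : IsIsoradial G p) (hk : k ^ 2 < 1) {u : ℂ}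
    (hu : u ∈ genericSet k) {x y : V} (hxy : G.Adj x y) :
    massiveExp k G p (.inl x) (.inl y) u =
      dirFactor k u (Complex.arg (p y - p x) - halfAngle p x y) *
        dirFactor k u (Complex.arg (p y - p x) + halfAngle p x y) ∧
    massiveExp k G p (.inl y) (.inl x) u =
      dirFactor k (u - 2 * ellipticK k) (Complex.arg (p y - p x) - halfAngle p x y) *
        dirFactor k (u - 2 * ellipticK k) (Complex.arg (p y - p x) + halfAngle p x y) := by
  obtain ⟨c, hc, hx, hy, s, s', hs, hs', h⟩ := hG.exists_face_of_adj_exp hxy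
  obtain ⟨d, rfl⟩ : ∃ d : DualVertex G p, d.1 = c := ⟨⟨c, hc⟩, rfl⟩
  have h1 : (diamondGraph G p).Adj (.inl x) (.inr d) := hx
  have h2 : (diamondGraph G p).Adj (.inr d) (.inl y) := hy
  have hs1 : p x - d.1 = Complex.exp ((s + π : ℝ) * Complex.I) := by
    rw [← neg_exp_mul_I, ← hs, neg_sub]
  have hs1' : d.1 - p y = Complex.exp ((s' + π : ℝ) * Complex.I) := by
    rw [← neg_exp_mul_I, ← hs', neg_sub]
  rw [hG.massiveExp_eq_pathProduct hk hu (.cons h1 (.cons h2 .nil)),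
    hG.massiveExp_eq_pathProduct hk hu (.cons h2.symm (.cons h1.symm .nil))]
  simp only [pathProduct_cons, pathProduct_nil, mul_one, Pi.mul_apply, diamondPos_inl,
    diamondPos_inr]
  rw [stepFactor_of_sub_eq hk hu hs, stepFactor_of_sub_eq hk hu hs',
    stepFactor_of_sub_eq hk hu hs1, stepFactor_of_sub_eq hk hu hs1', dirFactor_add_pi,
    dirFactor_add_pi]
  rcases h with ⟨rfl, rfl⟩ | ⟨rfl, rfl⟩
  · exact ⟨mul_comm _ _, rfl⟩
  · exact ⟨rfl, mul_comm _ _⟩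

theorem theta_mem (hG : IsIsoradial G p) (hk : k ^ 2 < 1) {x y : V} (hxy : G.Adj x y) :
    0 ≤ theta k p x y ∧ theta k p x y < ellipticK k := by
  have h0 := hG.halfAngle_pos hxy
  have h1 := hG.halfAngle_lt hxy
  have hK := ellipticK_pos hk
  have hπ := Real.pi_pos
  refine ⟨by unfold theta; positivity, ?_⟩
  have : theta k p x y < π / 2 * (2 * ellipticK k / π) := by
    unfold theta
    gcongr
  refine this.trans_eq ?_
  field_simp

/-- The contribution of one edge to the massive Laplacian is an integral over its rhombus. -/
theorem ellipticA_sub_eq_integral (hG : IsIsoradial G p) (hk : k ^ 2 < 1) {u : ℂ}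
    (hu : u ∈ genericSet k) {x y : V} (hxy : G.Adj x y) :
    ellipticA k (theta k p x y) - conductance k p x y *
      (dirFactor k u (Complex.arg (p y - p x) - halfAngle p x y) *
        dirFactor k u (Complex.arg (p y - p x) + halfAngle p x y)) =
    1 / complModulus k *
      ∫ t in (Complex.arg (p y - p x) - halfAngle p x y)..(Complex.arg (p y - p x) + halfAngle p x y),
        ((ellipticK k / π : ℝ) : ℂ) * (dcSq k (u / 2 - (ellipticK k / π * t : ℝ)) +
          ((ellipticE k : ℂ) - ellipticK k) / ellipticK k) := by
  have hπ := Real.pi_ne_zero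
  have hK := (ellipticK_pos hk).ne'
  obtain ⟨hθ0, hθ1⟩ := hG.theta_mem hk hxy
  set β := Complex.arg (p y - p x)
  -- With this `a` the two factors are at `a` and `a - θ`: their directions differ by twice the
  -- half-angle, and the argument of `sc` is halved.
  set a : ℂ := u / 2 - ((β - halfAngle p x y) * (ellipticK k / π) : ℝ) with ha
  have hw : (u / 2).im ∉ scBadIm k := by
    have := im_dirFactor_arg u 0
    rw [Complex.ofReal_zero, sub_zero] at this
    rw [this]; exact hu
  have haim : a.im ∉ scBadIm k := by
    rw [ha, Complex.sub_im, Complex.ofReal_im, sub_zero]; exact hw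
  have h1 : (u - ((β - halfAngle p x y) * (2 * ellipticK k / π) : ℝ)) / 2 = a := by
    rw [ha]; push_cast; ring
  have h2 : (u - ((β + halfAngle p x y) * (2 * ellipticK k / π) : ℝ)) / 2 = a - theta k p x y := by
    rw [ha, theta]; push_cast; ring
  have hA := ellipticA_add hk haim hθ0 hθ1
  have hsq := sqrt_complModulus_sq hk
  have hint : ∫ t in (β - halfAngle p x y)..(β + halfAngle p x y),
      ((ellipticK k / π : ℝ) : ℂ) * (dcSq k (u / 2 - (ellipticK k / π * t : ℝ)) +
          ((ellipticE k : ℂ) - ellipticK k) / ellipticK k) =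
      (∫ s in (0 : ℝ)..theta k p x y, dcSq k (a - s)) +
        ((ellipticE k : ℂ) - ellipticK k) / ellipticK k * theta k p x y := by
    have hcont : Continuous fun t : ℝ => dcSq k (u / 2 - (ellipticK k / π * t : ℝ)) :=
      (continuous_dcSq_sub hk hw).comp (g := fun s : ℝ => dcSq k (u / 2 - (s : ℝ))) (by fun_prop)
    rw [intervalIntegral.integral_const_mul, intervalIntegral.integral_add
      (hcont.intervalIntegrable _ _) intervalIntegrable_const, mul_add]
    -- An affine substitution of ratio `K/π` carries the directions inside the rhombus onto `[0,
    -- θ]`.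
    have hsub := intervalIntegral.smul_integral_comp_mul_sub (a := β - halfAngle p x y)
      (b := β + halfAngle p x y) (fun s : ℝ => dcSq k (a - s)) (ellipticK k / π)
      ((β - halfAngle p x y) * (ellipticK k / π))
    rw [show ellipticK k / π * (β - halfAngle p x y) - (β - halfAngle p x y) * (ellipticK k / π) = 0
      by ring, show ellipticK k / π * (β + halfAngle p x y) -
        (β - halfAngle p x y) * (ellipticK k / π) = theta k p x y by rw [theta]; ring] at hsub
    rw [← hsub, Complex.real_smul]
    congr 1
    · congr 1
      refine intervalIntegral.integral_congr fun t _ => ?_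
      rw [ha]
      congr 1
      push_cast
      ring
    · rw [intervalIntegral.integral_const, Complex.real_smul, theta]
      push_cast
      ring
  rw [hint, ← hA, dirFactor, dirFactor, h1, h2, conductance]
  linear_combination -jacobiSc k (theta k p x y) * jacobiSc k a * jacobiSc k (a - theta k p x y) *
    hsq

/-- The rhombi at a vertex contribute an integral over a full period, which vanishes. -/
theorem sum_ellipticA_sub (hG : IsIsoradial G p) [G.LocallyFinite] (hk : k ^ 2 < 1) {u : ℂ}
    (hu : u ∈ genericSet k) (x : V) :
    ∑ y ∈ G.neighborFinset x, (ellipticA k (theta k p x y) - conductance k p x y *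
      (dirFactor k u (Complex.arg (p y - p x) - halfAngle p x y) *
        dirFactor k u (Complex.arg (p y - p x) + halfAngle p x y))) = 0 := by
  have hπ := Real.pi_ne_zero
  have hK := (ellipticK_pos hk).ne'
  have hw : (u / 2).im ∉ scBadIm k := by
    have := im_dirFactor_arg u 0
    rw [Complex.ofReal_zero, sub_zero] at this
    rw [this]; exact hu
  have hcont : Continuous fun t : ℝ => dcSq k (u / 2 - (ellipticK k / π * t : ℝ)) :=
    (continuous_dcSq_sub hk hw).comp (g := fun s : ℝ => dcSq k (u / 2 - (s : ℝ))) (by fun_prop)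
  rw [Finset.sum_congr rfl fun y hy =>
    hG.ellipticA_sub_eq_integral hk hu ((G.mem_neighborFinset x y).1 hy), ← Finset.mul_sum,
    hG.sum_integral_rhombus x (by fun_prop)]
  -- A full turn of directions is a period `2K` after rescaling: `dc²` contributes `2(K - E)`,
  -- cancelled by the constant `(E - K)/K` integrated over length `2K`.
  · rw [intervalIntegral.integral_const_mul, intervalIntegral.integral_add
      (hcont.intervalIntegrable _ _) intervalIntegrable_const, mul_add]
    have hsub := intervalIntegral.smul_integral_comp_mul_left (a := 0)
      (b := 2 * π) (fun s : ℝ => dcSq k (u / 2 - s)) (ellipticK k / π)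
    rw [mul_zero, show ellipticK k / π * (2 * π) = 2 * ellipticK k by field_simp,
      integral_dcSq_sub hk hw, Complex.real_smul] at hsub
    rw [hsub, intervalIntegral.integral_const, Complex.real_smul]
    have hKc : (ellipticK k : ℂ) ≠ 0 := by exact_mod_cast hK
    have hπc : (π : ℂ) ≠ 0 := by exact_mod_cast hπ
    push_cast
    field_simp
    ring
  · intro t
    simp only
    rw [← dcSq_add_two_mul hk]
    · congr 3
      push_cast
      field_simp
      ring
    · rw [Complex.sub_im, Complex.ofReal_im, sub_zero]
      exact hw

end IsIsoradial

/-- The mass term cancels the conductances on the diagonal, which leaves the coefficient `A(θ)`. -/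
theorem massiveLaplacian_eq_sum [G.LocallyFinite] (f : V → ℂ) (x : V) :
    massiveLaplacian k G p f x =
      ∑ y ∈ G.neighborFinset x, (ellipticA k (theta k p x y) * f x - conductance k p x y * f y) := by
  rw [massiveLaplacian, massSq, Finset.sum_mul, ← Finset.sum_add_distrib]
  exact Finset.sum_congr rfl fun y _ => by ring

namespace IsIsoradial

/-- By multiplicativity the value at `(x, y)` factors out and leaves the sum over the rhombi at `y`.
-/
theorem massiveLaplacian_snd_of_generic (hG : IsIsoradial G p) [G.LocallyFinite] (hk : k ^ 2 < 1)
    {u : ℂ} (hu : u ∈ genericSet k) (x y : V) :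
    massiveLaplacian k G p (fun z => massiveExp k G p (.inl x) (.inl z) u) y = 0 := by
  have h := congrArg (massiveExp k G p (.inl x) (.inl y) u * ·) (hG.sum_ellipticA_sub hk hu y)
  simp only [mul_zero, Finset.mul_sum] at h
  rw [massiveLaplacian_eq_sum, ← h]
  refine Finset.sum_congr rfl fun z hz => ?_
  rw [← hG.massiveExp_mul hk hu (.inl x) (.inl y) (.inl z),
    (hG.massiveExp_of_adj hk hu ((G.mem_neighborFinset y z).1 hz)).1]
  ring

/-- Here the steps lead from the neighbours back to `x`. Reversing them replaces `u` by `u - 2K`, so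
the same sum is used at the shifted point, which is again generic. -/
theorem massiveLaplacian_fst_of_generic (hG : IsIsoradial G p) [G.LocallyFinite] (hk : k ^ 2 < 1)
    {u : ℂ} (hu : u ∈ genericSet k) (x y : V) :
    massiveLaplacian k G p (fun z => massiveExp k G p (.inl z) (.inl y) u) x = 0 := by
  have h := congrArg (massiveExp k G p (.inl x) (.inl y) u * ·)
    (hG.sum_ellipticA_sub hk (u := u - 2 * ellipticK k) (by simpa [genericSet] using hu) x)
  simp only [mul_zero, Finset.mul_sum] at h
  rw [massiveLaplacian_eq_sum, ← h]
  refine Finset.sum_congr rfl fun z hz => ?_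
  rw [← hG.massiveExp_mul hk hu (.inl z) (.inl x) (.inl y),
    (hG.massiveExp_of_adj hk hu ((G.mem_neighborFinset x z).1 hz)).2]
  ring

end IsIsoradial

/-- An identity for generic `u` extends by continuity. -/
theorem massiveLaplacian_eq_zero_of_dense [G.LocallyFinite] {S : Set ℂ} (hS : Dense S)
    {F : V → ℂ → ℂ} {x : V} (h : ∀ u ∈ S, massiveLaplacian k G p (fun z => F z u) x = 0) {u : ℂ}
    (hx : ContinuousAt (F x) u) (hy : ∀ y, G.Adj x y → ContinuousAt (F y) u) :
    massiveLaplacian k G p (fun z => F z u) x = 0 := by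
  have hc : ContinuousAt (fun u => massiveLaplacian k G p (fun z => F z u) x) u := by
    simp only [massiveLaplacian_eq_sum]
    refine tendsto_finsetSum _ fun y hy' => ?_
    exact (hx.const_mul _).sub ((hy y ((G.mem_neighborFinset x y).1 hy')).const_mul _)
  have : (𝓝[S] u).NeBot := mem_closure_iff_nhdsWithin_neBot.1 (hS u)
  refine tendsto_nhds_unique (l := 𝓝[S] u) (hc.mono_left nhdsWithin_le_nhds) (tendsto_const_nhds.congr' ?_)
  filter_upwards [self_mem_nhdsWithin] with v hv
  exact (h v hv).symm

end Harmonicity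

end IsoradialMassive

theorem proposition3p5 {V : Type*} (G : SimpleGraph V) [G.LocallyFinite] (p : V → ℂ)
    (hG : IsIsoradial G p) (k : ℝ) (hk0 : 0 ≤ k) (hk1 : k < 1) :
    -- the massive exponential function is well defined, independently of the path
    (∀ a b : V ⊕ DualVertex G p, (diamondGraph G p).Reachable a b ∧
      ∀ w : (diamondGraph G p).Walk a b,
        Meromorphic (pathProduct k w) ∧ pathExp k w = massiveExp k G p a b) ∧
    -- between vertices of `G`, it is a function on the torus
    (∀ x y : V, ∀ u : ℂ, ∀ ω ∈ periodLattice k,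
      massiveExp k G p (Sum.inl x) (Sum.inl y) (u + ω) =
        massiveExp k G p (Sum.inl x) (Sum.inl y) u) ∧
    -- it is massive harmonic in the first variable
    (∀ x y : V, ∀ u : ℂ, AnalyticAt ℂ (massiveExp k G p (Sum.inl x) (Sum.inl y)) u →
      (∀ z, G.Adj x z → AnalyticAt ℂ (massiveExp k G p (Sum.inl z) (Sum.inl y)) u) →
      massiveLaplacian k G p (fun z => massiveExp k G p (Sum.inl z) (Sum.inl y) u) x = 0) ∧
    -- it is massive harmonic in the second variable
    (∀ x y : V, ∀ u : ℂ, AnalyticAt ℂ (massiveExp k G p (Sum.inl x) (Sum.inl y)) u →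
      (∀ z, G.Adj y z → AnalyticAt ℂ (massiveExp k G p (Sum.inl x) (Sum.inl z)) u) →
      massiveLaplacian k G p (fun z => massiveExp k G p (Sum.inl x) (Sum.inl z) u) y = 0) := by
  have hk : k ^ 2 < 1 := by nlinarith
  refine ⟨fun a b => ⟨hG.reachable_diamondGraph a b, fun w =>
    ⟨meromorphic_pathProduct w, hG.pathExp_eq_massiveExp hk w⟩⟩,
    fun x y u ω hω => hG.massiveExp_add_mem_periodLattice hk x y hω u,
    fun x y u hx hz => ?_, fun x y u hy hz => ?_⟩
  · exact massiveLaplacian_eq_zero_of_dense (dense_genericSet hk)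
      (F := fun z => massiveExp k G p (Sum.inl z) (Sum.inl y))
      (fun v hv => hG.massiveLaplacian_fst_of_generic hk hv x y) hx.continuousAt
      fun z h => (hz z h).continuousAt
  · exact massiveLaplacian_eq_zero_of_dense (dense_genericSet hk)
      (F := fun z => massiveExp k G p (Sum.inl x) (Sum.inl z))
      (fun v hv => hG.massiveLaplacian_snd_of_generic hk hv x y) hy.continuousAt
      fun z h => (hz z h).continuousAt
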